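/- For a finite $3$-group $G$ put $d_n(G)=\dim_{\mathbb{F}_3}H^n(G,\mathbb{F}_3)$ (trivial action), let $G=\gamma_1(G)\ge\gamma_2(G)\ge\dots$ be its lower central series and $\mathrm{cl}(G)$ its nilpotency class; the coclass of $G$ is $\log_3|G|-\mathrm{cl}(G)$. $G$ is called a *Schur $\sigma$-group* if $d_2(G)=d_1(G)$ and $G$ has an automorphism which induces inversion on $G/G'$. A finite non-abelian $3$-group $V$ of class $c$ is an *immediate descendant* of $W$, and $W$ is the *parent* of $V$, if $V/\gamma_c(V)\simeq W$; its *step size* is $\log_3|V|-\log_3|W|$. A finite $3$-group is *terminal* if it has no immediate descendants. The vertices of the coclass forest $\mathcal{F}(2)$ are the (isomorphism classes of) finite $3$-groups of coclass $2$, and its edges join immediate descendants to their parents. If $G/G'\simeq C_3\times C_3$, and $M_1,\dots,M_4$ are the subgroups of index $3$ in $G$, then $G$ has *transfer kernel type* $\varkappa=(\varkappa(1),\dots,\varkappa(4))\in\{1,2,3,4\}^4$ if, for a suitable numbering of the $M_i$, the kernel of the transfer $G/G'\to M_i/M_i'$ is $M_{\varkappa(i)}/G'$ for each $1\le i\le 4$.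 Type D.10 is $\varkappa=(1123)$ and type D.5 is $\varkappa=(1212)$. In terms of generators $x,y$ and $s=[y,x]$, $u=[s,x]$, $v=[s,y]$, let $\langle 27,3\rangle$ be the extra special group $\langle x,y\mid x^3=y^3=s^3=1,\ s\text{ central}\rangle$ of order $27$ and exponent $3$, and let $$\langle 243,5\rangle=\langle x,y\mid x^3=y^3=u,\ s^3=u^3=v^3=1,\ u,v\text{ central}\rangle,$$ $$\langle 243,7\rangle=\langle x,y\mid x^3=u,\ y^3=v,\ s^3=u^3=v^3=1,\ u,v\text{ central}\rangle$$ (the names are the identifiers in the SmallGroups library). **Proposition.** Among the finite $3$-groups $V$ with $V/V'\simeq C_3\times C_3$ there exist, up to isomorphism, precisely two metabelian Schur $\sigma$-groups, namely the two non-isomorphic groups $\langle 243,5\rangle$ and $\langle 243,7\rangle$. Both are of order $3^5=243$, nilpotency class $3$ and coclass $2$. The group $\langle 243,5\rangle$ has transfer kernel type D.10, and $\langle 243,7\rangle$ has transfer kernel type D.5. They are, up to isomorphism, precisely the terminal immediate descendants with step size $2$ of $\langle 27,3\rangle$, and they are isolated vertices of the coclass forest $\mathcal{F}(2)$: they have neither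 a parent nor an immediate descendant of coclass $2$. -/

import Mathlib

/-! ### Schur σ-groups -/

/-- The dimension over `𝔽_p` of the cohomology group `Hⁿ(G, 𝔽_p)` with trivial action.
For `n = 1` it is the generator rank `d₁(G)`, for `n = 2` the relation rank `d₂(G)`
(for a finite `p`-group `G`). -/
noncomputable def cohomologyRank (p : ℕ) (G : Type) [Group G] (n : ℕ) : ℕ :=
  Module.finrank (ZMod p) (groupCohomology (Rep.trivial (ZMod p) G (ZMod p)) n)

/-- `G` has an automorphism acting as inversion on the abelianization `G/G'`. -/
def IsSigmaGroup (G : Type) [Group G] : Prop :=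
  ∃ σ : G ≃* G, ∀ g : G, Abelianization.of (σ g) = (Abelianization.of g)⁻¹

/-- A finite Schur σ-group: a finite `p`-group with balanced presentation `d₂ = d₁` which
possesses an automorphism acting as inversion on the abelianization. -/
structure IsFiniteSchurSigmaGroup (p : ℕ) (G : Type) [Group G] : Prop where
  finite : Finite G
  isPGroup : IsPGroup p G
  balanced : cohomologyRank p G 2 = cohomologyRank p G 1
  sigma : IsSigmaGroup G

/-- `G'' = 1`. -/
def IsMetabelian (G : Type) [Group G] : Prop :=
  derivedSeries G 2 = ⊥

/-- The abelianization of `G` is of type `(3,3)`. -/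
def HasAbelianizationThreeThree (G : Type) [Group G] : Prop :=
  Nonempty (Abelianization G ≃* Multiplicative (ZMod 3) × Multiplicative (ZMod 3))

/-! ### Descendant trees -/

/-- The (finite `p`-)group `G` has coclass `r`, i.e. `log_p |G| = cl(G) + r`. -/
def HasCoclass (p : ℕ) (G : Type) [Group G] (r : ℕ) : Prop :=
  Nat.card G = p ^ (Group.nilpotencyClass G + r)

/-- `V` is an immediate descendant of `W`: `V` is non-abelian, of nilpotency class `c`, and
`V / γ_c(V) ≃ W`. (Mathlib counts the lower central series from `0`, so `γ_c(V)` is the member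
with index `c - 1`.) -/
def IsImmediateDescendant (V W : Type) [Group V] [Group W] : Prop :=
  2 ≤ Group.nilpotencyClass V ∧
    Nonempty
      (V ⧸ (⊤ : Subgroup V).lowerCentralSeries (Group.nilpotencyClass V - 1) ≃* W)

/-- `V` is an immediate descendant of `W` with step size `s`: `log_p |V| - log_p |W| = s`. -/
def IsImmediateDescendantOfStep (p s : ℕ) (V W : Type) [Group V] [Group W] : Prop :=
  IsImmediateDescendant V W ∧ Nat.card V = p ^ s * Nat.card W

/-- `V` is terminal: no finite `p`-group is an immediate descendant of `V`. -/
def IsTerminal (p : ℕ) (V : Type) [Group V] : Prop :=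
  ∀ (U : Type) [Group U], Finite U → IsPGroup p U → ¬ IsImmediateDescendant U V

/-- `G` is an isolated vertex of the coclass forest `ℱ(r)`, whose vertices are the finite
`p`-groups of coclass `r` and whose edges join immediate descendants to their parents:
`G` has coclass `r`, and neither a parent nor an immediate descendant of coclass `r`. -/
def IsIsolatedInCoclassForest (p r : ℕ) (G : Type) [Group G] : Prop :=
  HasCoclass p G r ∧
    ∀ (W : Type) [Group W], Finite W → IsPGroup p W → HasCoclass p W r →
      ¬ IsImmediateDescendant G W ∧ ¬ IsImmediateDescendant W G

/-! ### Transfer kernel types -/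

/-- The Artin transfer `G/G' → M/M'`. -/
noncomputable def artinTransfer {G : Type} [Group G] (M : Subgroup G) [M.FiniteIndex] :
    Abelianization G →* Abelianization M :=
  Abelianization.lift (MonoidHom.transfer (Abelianization.of : M →* Abelianization M))

/-- The subgroups of index `3`. -/
abbrev IndexThreeSubgroup (G : Type) [Group G] : Type :=
  {M : Subgroup G // M.index = 3}

instance IndexThreeSubgroup.finiteIndex {G : Type} [Group G] (M : IndexThreeSubgroup G) :
    M.1.FiniteIndex :=
  ⟨by rw [M.2]; decide⟩

/-- `G` has transfer kernel type (equivalent to) `ϰ`: the subgroups of index `3` can be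
numbered `M₀, …, M₃` in such a way that `ker (G/G' → Mᵢ/Mᵢ') = M_{ϰ(i)}/G'` for every `i`.
Types which differ by a renumbering of the subgroups are equivalent. -/
def HasTransferKernelType (G : Type) [Group G] (ϰ : Fin 4 → Fin 4) : Prop :=
  ∃ M : Fin 4 ≃ IndexThreeSubgroup G,
    ∀ i, (artinTransfer (M i).1).ker = (M (ϰ i)).1.map Abelianization.of

/-- Type D.5, `ϰ = (1212)`, with indices counted from `0`. -/
def typeD5 : Fin 4 → Fin 4 := ![0, 1, 0, 1]

/-- Type D.10, `ϰ = (1123)`, with indices counted from `0`. -/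
def typeD10 : Fin 4 → Fin 4 := ![0, 0, 1, 2]

/-! ### The groups `⟨27,3⟩`, `⟨243,5⟩` and `⟨243,7⟩` -/

namespace SmallGroups

open scoped commutatorElement

/-- The first generator `x`. -/
abbrev x : FreeGroup (Fin 2) := FreeGroup.of 0

/-- The second generator `y`. -/
abbrev y : FreeGroup (Fin 2) := FreeGroup.of 1

/-- `s = [y,x]`. -/
abbrev s : FreeGroup (Fin 2) := ⁅y, x⁆

/-- `u = [s,x]`. -/
abbrev u : FreeGroup (Fin 2) := ⁅s, x⁆

/-- `v = [s,y]`. -/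
abbrev v : FreeGroup (Fin 2) := ⁅s, y⁆

/-- The relators saying that `u` and `v` are central and that `s³ = u³ = v³ = 1`. -/
def classThreeRelators : Set (FreeGroup (Fin 2)) :=
  {s ^ 3, u ^ 3, v ^ 3, ⁅u, x⁆, ⁅u, y⁆, ⁅v, x⁆, ⁅v, y⁆}

/-- `⟨27,3⟩`, the extra special group of order `27` and exponent `3`:
`x³ = y³ = s³ = 1`, with `s = [y,x]` central. -/
abbrev G27_3 : Type :=
  PresentedGroup ({x ^ 3, y ^ 3, s ^ 3, ⁅s, x⁆, ⁅s, y⁆} : Set (FreeGroup (Fin 2)))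

/-- `⟨243,5⟩`: `x³ = y³ = u`, with `s³ = u³ = v³ = 1` and `u`, `v` central. -/
abbrev G243_5 : Type :=
  PresentedGroup (classThreeRelators ∪ {x ^ 3 * u⁻¹, y ^ 3 * u⁻¹})

/-- `⟨243,7⟩`: `x³ = u`, `y³ = v`, with `s³ = u³ = v³ = 1` and `u`, `v` central. -/
abbrev G243_7 : Type :=
  PresentedGroup (classThreeRelators ∪ {x ^ 3 * u⁻¹, y ^ 3 * v⁻¹})

end SmallGroups

/-! The free group `F` on `x`, `y` is sent to units of the free associative algebra over `ℤ[√3]/27`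
by `x ↦ 1 + √3 X`, `y ↦ 1 + √3 Y`. In the filtration by powers of `√3`, commutators add weights,
cubing raises a weight `n ≥ 2` by two, and a leading term `a` of weight one becomes `a³ + a` in
weight three. Leading terms are visible through weight five, because `√3⁶ = 27`. Fix `x³ = u^α v^β`,
`y³ = u^γ v^δ` in class three. The relation subgroup `J` consists of the words whose leading term of
weight three lies in the plane spanned by `P X - αU - βW` and `P Y - γU - δW`. The quotient `F/J`
has order 243 for all 81 shapes, and these quotients are the immediate descendants of `⟨27,3⟩` of
step size 2 (`exists_isModel_of_descendant`, `IsModel.isImmediateDescendantOfStep`).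

A finite check over all changes of generators (`exists_isBaseChange_or_descent`) leaves two cases.
Either the group is `⟨243,5⟩` or `⟨243,7⟩`, or there is a linear form, nonzero on the commutators of
weight four, that respects the relations. Such a form yields a conjugation-invariant homomorphism `J
→ 𝔽₃`, hence a descendant of class four (`IsModel.not_isTerminal`). For the two exceptional shapes,
comparing `[x³,x]`, `[y³,y]`, `[y³,x]`, `[y,x³]` in a central extension kills all commutators of
weight four and `s³` (`SatisfiedMod.rigid`), so these groups are terminal.

Hopf's formula (`cohomologyRank_two`) identifies `H²(V, 𝔽₃)` with the invariant homomorphisms `R →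
𝔽₃` on the relation subgroup. Thirds of the two exponent sums are always among them, so `d₂ = d₁ =
2` says that there are no others. For the two shapes this follows from rigidity. Conversely, let `V`
be a metabelian Schur `σ`-group. Generators can be chosen that are inverted by a `σ`-automorphism of
2-power order. Then `R` is stable under inversion of the generators, and every invariant
homomorphism is odd. The even coefficient in weight two therefore vanishes on `R`, and the weight
three coefficients are combinations of the thirds, so `R ≤ J M` for some shape `M`. If `M` had a
descent form, its product with a linear form on the generators would give a functional of weight
five whose antisymmetrization is an invariant homomorphism on `R`. It vanishes on `[s,u]` and
`[s,v]`, which lie in `R` because `V'' = 1`, while its computed values there cannot all be zero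
(`IsSchurKernel.not_descent`). Hence `V` maps onto one of the two groups, and rigidity makes this
map injective.

The subgroups of index 3 are the lines of `𝔽₃²`. On elements outside such a subgroup the transfer is
the cube, which turns the transfer kernels into a finite computation. -/

open scoped commutatorElement

noncomputable section

/-! ### Magnus expansion over `ℤ[√3]/27` and leading terms -/

namespace Magnus

/-- The ring `ℤ[√3]/27`. -/
abbrev Coeff : Type := QuadraticAlgebra (ZMod 27) 3 0

/-- The uniformizer `√3`. -/
def unif : Coeff := ⟨0, 1⟩

/-- The free associative algebra on two letters over `ℤ[√3]/27`. -/
abbrev Alg : Type := MonoidAlgebra Coeff (FreeMonoid (Fin 2))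

/-- The free associative algebra on two letters over `𝔽₃`. -/
abbrev RedAlg : Type := MonoidAlgebra (ZMod 3) (FreeMonoid (Fin 2))

theorem unif_sq : unif ^ 2 = 3 := by
  rw [pow_two]
  ext
  · rw [QuadraticAlgebra.re_mul, QuadraticAlgebra.re_ofNat]; simp [unif]
  · rw [QuadraticAlgebra.im_mul, QuadraticAlgebra.im_ofNat]; simp [unif]

theorem unif_pow_five : unif ^ 5 = ⟨0, 9⟩ := by
  have : unif ^ 5 = unif ^ 2 * unif ^ 2 * unif := by ring
  rw [this, unif_sq]
  ext <;> simp only [QuadraticAlgebra.re_mul, QuadraticAlgebra.im_mul, QuadraticAlgebra.re_ofNat,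
    QuadraticAlgebra.im_ofNat, unif] <;> decide

theorem unif_pow_six : unif ^ 6 = 0 := by
  have : unif ^ 6 = unif ^ 2 * unif ^ 2 * unif ^ 2 := by ring
  rw [this, unif_sq]
  ext <;> simp only [QuadraticAlgebra.re_mul, QuadraticAlgebra.im_mul, QuadraticAlgebra.re_ofNat,
    QuadraticAlgebra.im_ofNat, QuadraticAlgebra.re_zero, QuadraticAlgebra.im_zero] <;> decide

/-- Reduction of the coefficients modulo `√3`. -/
def coeffRed : Coeff →+* ZMod 3 where
  toFun z := ZMod.castHom (by norm_num : 3 ∣ 27) (ZMod 3) z.re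
  map_one' := by simp [QuadraticAlgebra.re_one]
  map_mul' a b := by
    rw [QuadraticAlgebra.re_mul, map_add, map_mul, map_mul, map_mul]
    have : ZMod.castHom (by norm_num : 3 ∣ 27) (ZMod 3) 3 = 0 := by decide
    rw [this]; ring
  map_zero' := by simp
  map_add' a b := by simp

theorem coeffRed_unif : coeffRed unif = 0 := by
  simp [coeffRed, unif]

/-- Reduction modulo `√3`. -/
def red : Alg →+* RedAlg := MonoidAlgebra.mapRingHom _ coeffRed

theorem coeff_red (a : Alg) (w : FreeMonoid (Fin 2)) :
    (red a).coeff w = coeffRed (a.coeff w) := by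
  simp [red, MonoidAlgebra.mapRingHom]

theorem red_smul (r : Coeff) (a : Alg) : red (r • a) = coeffRed r • red a := by
  ext w
  rw [coeff_red]
  simp [coeff_red]

theorem red_unif_pow_smul {n : ℕ} (hn : n ≠ 0) (a : Alg) : red (unif ^ n • a) = 0 := by
  rw [red_smul, map_pow, coeffRed_unif, zero_pow hn, zero_smul]

/-- Everything is pushed up to `√3⁵ = 9√3`, and multiplication by `9` on `ℤ/27` detects exactly the
residue modulo `3`. The bound five is sharp because `√3⁶ = 0`; it makes leading terms unique up to
weight five. -/
theorem red_eq_zero_of_unif_pow_smul {n : ℕ} (hn : n ≤ 5) {a : Alg}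
    (h : unif ^ n • a = 0) : red a = 0 := by
  have h5 : unif ^ 5 • a = 0 := by
    have : unif ^ 5 = unif ^ (5 - n) * unif ^ n := by rw [← pow_add]; congr 1; omega
    rw [this, mul_smul, h, smul_zero]
  ext w
  rw [coeff_red]
  have := congrArg (fun b : Alg => (b.coeff w).im) h5
  simp only [MonoidAlgebra.coeff_smul_apply, unif_pow_five, smul_eq_mul,
    QuadraticAlgebra.im_mul] at this
  have key : ∀ z : ZMod 27, 9 * z = 0 → ZMod.castHom (by norm_num : 3 ∣ 27) (ZMod 3) z = 0 := by
    decide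
  simp at this
  exact key _ this

theorem red_three : (3 : RedAlg) = 0 := by
  have : (3 : RedAlg) = ((3 : ZMod 3)) • 1 := by
    rw [← Nat.cast_ofNat, ← Nat.cast_ofNat (R := ZMod 3), Nat.cast_smul_eq_nsmul]; simp
  rw [this]
  have h : (3 : ZMod 3) = 0 := by decide
  rw [h, zero_smul]

theorem three_mul_alg (a : Alg) : (3 : Alg) * a = unif ^ 2 • a := by
  have h : (3 : Coeff) = 1 + 1 + 1 := by norm_num
  have h' : (3 : Alg) = 1 + 1 + 1 := by norm_num
  rw [unif_sq, h, h']
  simp only [add_mul, add_smul, one_mul, one_smul]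

/-- `f = 1 + √3ⁿ a` with `a` lifting `b`: `b` is the leading term of `f` in degree `n`. -/
def Lead (n : ℕ) (f : Algˣ) (b : RedAlg) : Prop :=
  ∃ a : Alg, red a = b ∧ (f : Alg) = 1 + unif ^ n • a

namespace Lead

variable {m n : ℕ} {f g : Algˣ} {a b : RedAlg}

theorem unique (hn : n ≤ 5) (h : Lead n f a) (h' : Lead n f b) : a = b := by
  obtain ⟨c, rfl, hc⟩ := h
  obtain ⟨d, rfl, hd⟩ := h'
  rw [← sub_eq_zero, ← map_sub]
  apply red_eq_zero_of_unif_pow_smul hn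
  rw [smul_sub, sub_eq_zero]
  exact add_left_cancel (hc.symm.trans hd)

theorem red_eq_one (hn : n ≠ 0) (h : Lead n f a) : red f = 1 := by
  obtain ⟨c, rfl, hc⟩ := h
  rw [hc, map_add, map_one, red_unif_pow_smul hn, add_zero]

theorem red_inv_eq_one (h : red f = 1) : red (f⁻¹ : Algˣ) = 1 := by
  have : red (f⁻¹ : Algˣ) * red f = 1 := by rw [← map_mul]; simp
  rwa [h, mul_one] at this

protected theorem one (n : ℕ) : Lead n 1 0 := ⟨0, by simp, by simp⟩

theorem weaken (h : Lead n f a) (hm : m < n) : Lead m f 0 := by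
  obtain ⟨c, rfl, hc⟩ := h
  refine ⟨unif ^ (n - m) • c, red_unif_pow_smul (by omega) _, ?_⟩
  rw [hc, smul_smul, ← pow_add]
  congr 3; omega

protected theorem mul (hn : n ≠ 0) (h : Lead n f a) (h' : Lead n g b) : Lead n (f * g) (a + b) := by
  obtain ⟨c, rfl, hc⟩ := h
  obtain ⟨d, rfl, hd⟩ := h'
  refine ⟨c + d + unif ^ n • (c * d), ?_, ?_⟩
  · rw [map_add, map_add, red_unif_pow_smul hn, add_zero]
  · rw [Units.val_mul, hc, hd]
    simp only [mul_add, add_mul, one_mul, mul_one, smul_mul_assoc, mul_smul_comm, smul_add]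
    abel

protected theorem inv (hn : n ≠ 0) (h : Lead n f a) : Lead n f⁻¹ (-a) := by
  have h1 := red_inv_eq_one (h.red_eq_one hn)
  obtain ⟨c, rfl, hc⟩ := h
  refine ⟨-(c * (f⁻¹ : Algˣ)), by rw [map_neg, map_mul, h1, mul_one], ?_⟩
  have : (f : Alg) * (f⁻¹ : Algˣ) = 1 := by simp
  rw [hc, add_mul, one_mul, smul_mul_assoc] at this
  rw [smul_neg, ← this]; abel

protected theorem conj (hf : red g = 1) (h : Lead n f a) : Lead n (g * f * g⁻¹) a := by
  obtain ⟨c, rfl, hc⟩ := h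
  refine ⟨g * c * (g⁻¹ : Algˣ), by rw [map_mul, map_mul, hf, red_inv_eq_one hf]; simp, ?_⟩
  rw [Units.val_mul, Units.val_mul, hc, mul_add, add_mul]
  simp

/-- `⁅f, g⁆ - 1 = (fg - gf) f⁻¹ g⁻¹`, where `fg - gf` is exactly `√3^(m+n)` times a ring commutator
and the two inverses reduce to `1`. -/
protected theorem comm (hm : m ≠ 0) (hn : n ≠ 0) (h : Lead m f a) (h' : Lead n g b) :
    Lead (m + n) ⁅f, g⁆ ⁅a, b⁆ := by
  have hf := red_inv_eq_one (h.red_eq_one hm)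
  have hg := red_inv_eq_one (h'.red_eq_one hn)
  obtain ⟨c, rfl, hc⟩ := h
  obtain ⟨d, rfl, hd⟩ := h'
  refine ⟨(c * d - d * c) * (f⁻¹ : Algˣ) * (g⁻¹ : Algˣ), ?_, ?_⟩
  · rw [map_mul, map_mul, hf, hg, map_sub, map_mul, map_mul, Ring.lie_def]; simp
  · have key : (f : Alg) * g - g * f = unif ^ (m + n) • (c * d - d * c) := by
      rw [hc, hd]
      simp only [mul_add, add_mul, one_mul, mul_one, smul_mul_assoc, mul_smul_comm, smul_add,
        smul_smul, smul_sub, pow_add]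
      rw [mul_comm (unif ^ n)]
      abel
    rw [← smul_mul_assoc, ← smul_mul_assoc, ← key, commutatorElement_def]
    simp [sub_mul]

protected theorem zpow (hn : n ≠ 0) (h : Lead n f a) (k : ℤ) : Lead n (f ^ k) (k • a) := by
  have hnat : ∀ j : ℕ, Lead n (f ^ j) (j • a) := by
    intro j
    induction j with
    | zero => simpa using Lead.one n
    | succ j ih => rw [pow_succ, succ_nsmul]; exact ih.mul hn h
  cases k with
  | ofNat j => simpa using hnat j
  | negSucc j =>
    rw [zpow_negSucc, negSucc_zsmul]
    exact (hnat _).inv hn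

/-- In `(1 + t)³ = 1 + 3t + 3t² + t³` with `t` of weight one, both `3t` and `t³` have weight three,
because `3 = √3²`; only `3t²` is of higher weight. -/
theorem cube_one (h : Lead 1 f a) : Lead 3 (f ^ 3) (a ^ 3 + a) := by
  obtain ⟨c, rfl, hc⟩ := h
  refine ⟨c ^ 3 + c + unif ^ 1 • c ^ 2, ?_, ?_⟩
  · rw [map_add, red_unif_pow_smul one_ne_zero, map_add, map_pow, add_zero]
  · have e : ∀ t : Alg, (1 + t) ^ 3 = 1 + (3 * t + 3 * t ^ 2 + t ^ 3) := by
      intro t; noncomm_ring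
    rw [Units.val_pow_eq_pow_val, hc, e, three_mul_alg, three_mul_alg, smul_pow, smul_pow,
      smul_smul, smul_smul]
    simp only [smul_add, smul_smul, ← pow_add, ← pow_mul]
    norm_num
    abel

/-- For `n ≥ 2` the weight `3n` of `t³` exceeds the weight `n + 2` of `3t`, so the cubic term
disappears. -/
theorem cube_of_two_le (hn : 2 ≤ n) (h : Lead n f a) : Lead (n + 2) (f ^ 3) a := by
  obtain ⟨c, rfl, hc⟩ := h
  refine ⟨c + unif ^ n • c ^ 2 + unif ^ (2 * n - 2) • c ^ 3, ?_, ?_⟩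
  · rw [map_add, map_add, red_unif_pow_smul (by omega), red_unif_pow_smul (by omega)]; simp
  · have e : ∀ t : Alg, (1 + t) ^ 3 = 1 + (3 * t + 3 * t ^ 2 + t ^ 3) := by
      intro t; noncomm_ring
    rw [Units.val_pow_eq_pow_val, hc, e, three_mul_alg, three_mul_alg, smul_pow, smul_pow,
      smul_smul, smul_smul]
    simp only [smul_add, smul_smul, ← pow_add, ← pow_mul]
    have h1 : 2 + n = n + 2 := by omega
    have h2 : 2 + n * 2 = n + 2 + n := by omega
    have h3 : n * 3 = n + 2 + (2 * n - 2) := by omega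
    rw [h1, h2, h3]

end Lead

/-- The letters of the free algebra. -/
def letter (i : Fin 2) : Alg := MonoidAlgebra.single (FreeMonoid.of i) 1

/-- The letters of the free algebra over `𝔽₃`. -/
def rletter (i : Fin 2) : RedAlg := MonoidAlgebra.single (FreeMonoid.of i) 1

theorem red_letter (i : Fin 2) : red (letter i) = rletter i := by
  simp [red, letter, rletter]

theorem isUnit_one_add_letter (i : Fin 2) : IsUnit (1 + unif ^ 1 • letter i) := by
  apply IsNilpotent.isUnit_one_add
  exact ⟨6, by rw [smul_pow, ← pow_mul, one_mul, unif_pow_six, zero_smul]⟩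

/-- The Magnus map `xᵢ ↦ 1 + √3 Xᵢ` on the free group. -/
def magnus : FreeGroup (Fin 2) →* Algˣ :=
  FreeGroup.lift fun i => (isUnit_one_add_letter i).unit

theorem lead_of (i : Fin 2) : Lead 1 (magnus (FreeGroup.of i)) (rletter i) :=
  ⟨letter i, red_letter i, by simp [magnus]⟩

theorem red_magnus (f : FreeGroup (Fin 2)) : red (magnus f) = 1 := by
  have : (Units.map (red : Alg →* RedAlg)).comp magnus = 1 := by
    refine FreeGroup.ext_hom _ _ fun i => Units.ext ?_
    simpa using (lead_of i).red_eq_one one_ne_zero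
  have := DFunLike.congr_fun this f
  simpa using congrArg Units.val this

end Magnus

end

/-! ### Lower central series of two-generated groups -/

namespace TwoGenerated

open Subgroup

/-- The lower central series of a group, counted from `0`. -/
abbrev lcs (G : Type*) [Group G] (n : ℕ) : Subgroup G := (⊤ : Subgroup G).lowerCentralSeries n

section Series

variable {G H : Type*} [Group G] [Group H]

theorem lcs_succ_le_iff {n : ℕ} {N : Subgroup G} :
    lcs G (n + 1) ≤ N ↔ ∀ g ∈ lcs G n, ∀ h : G, ⁅g, h⁆ ∈ N := by
  rw [lcs, Subgroup.lowerCentralSeries_succ, commutator_le]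
  simp

theorem commutator_mem_lcs_succ {n : ℕ} {g : G} (hg : g ∈ lcs G n) (h : G) :
    ⁅g, h⁆ ∈ lcs G (n + 1) :=
  lcs_succ_le_iff.1 le_rfl g hg h

theorem commutator_mem_lcs_succ' {n : ℕ} {g : G} (hg : g ∈ lcs G n) (h : G) :
    ⁅h, g⁆ ∈ lcs G (n + 1) := by
  rw [← commutatorElement_inv]
  exact inv_mem (commutator_mem_lcs_succ hg h)

theorem lcs_antitone : Antitone (lcs G) := Subgroup.lowerCentralSeries_antitone ⊤

theorem normal_of_lcs_le {n : ℕ} {N : Subgroup G} (h1 : lcs G (n + 1) ≤ N) (h2 : N ≤ lcs G n) :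
    N.Normal := by
  refine ⟨fun a ha g => ?_⟩
  have : g * a * g⁻¹ = ⁅g, a⁆ * a := by rw [commutatorElement_def]; group
  rw [this]
  exact mul_mem (h1 (commutator_mem_lcs_succ' (h2 ha) g)) ha

theorem map_lcs (f : G →* H) (hf : Function.Surjective f) (n : ℕ) :
    (lcs G n).map f = lcs H n := by
  rw [lcs, lcs, map_lowerCentralSeries, ← MonoidHom.range_eq_map, MonoidHom.range_eq_top.2 hf]

theorem map_mem_lcs (f : G →* H) {n : ℕ} {g : G} (hg : g ∈ lcs G n) : f g ∈ lcs H n := by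
  have h := mem_map_of_mem f hg
  rw [map_lowerCentralSeries] at h
  exact Subgroup.lowerCentralSeries_mono n le_top h

end Series

section Generators

variable {G : Type*} [Group G] {x y : G}

theorem mem_center_of_commute (hxy : closure {x, y} = ⊤) {g : G} (hx : g * x = x * g)
    (hy : g * y = y * g) : g ∈ center G := by
  have h : closure {x, y} ≤ centralizer {g} := by
    rw [closure_le]
    rintro z (rfl | rfl)
    · rw [SetLike.mem_coe, mem_centralizer_iff]; simpa using hx
    · rw [SetLike.mem_coe, mem_centralizer_iff]; simpa using hy
  rw [hxy] at h
  rw [mem_center_iff]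
  intro z
  exact (mem_centralizer_iff.1 (h (mem_top z)) g rfl).symm

theorem closure_pair_map {H : Type*} [Group H] (f : G →* H) (hf : Function.Surjective f)
    (hxy : closure {x, y} = ⊤) : closure {f x, f y} = ⊤ := by
  have := congrArg (Subgroup.map f) hxy
  rw [MonoidHom.map_closure, ← MonoidHom.range_eq_map, MonoidHom.range_eq_top.2 hf,
    Set.image_pair] at this
  exact this

theorem lcs_one_le (hxy : closure {x, y} = ⊤) (N : Subgroup G) [N.Normal] (h : ⁅y, x⁆ ∈ N) :
    lcs G 1 ≤ N := by
  have hq := closure_pair_map (QuotientGroup.mk' N) (QuotientGroup.mk'_surjective N) hxy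
  have hc : (QuotientGroup.mk' N y) * (QuotientGroup.mk' N x) =
      (QuotientGroup.mk' N x) * (QuotientGroup.mk' N y) := by
    rw [← commutatorElement_eq_one_iff_mul_comm, ← map_commutatorElement]
    exact (QuotientGroup.eq_one_iff _).2 h
  have hx := mem_center_of_commute hq rfl hc.symm
  have hy := mem_center_of_commute hq hc rfl
  have htop : center (G ⧸ N) = ⊤ := by
    rw [eq_top_iff, ← hq, closure_le]
    rintro z (rfl | rfl) <;> assumption
  rw [lcs_succ_le_iff]
  intro g _ h
  rw [← QuotientGroup.eq_one_iff, ← QuotientGroup.mk'_apply, map_commutatorElement,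
    commutatorElement_eq_one_iff_mul_comm]
  exact (mem_center_iff.1 (htop ▸ mem_top (QuotientGroup.mk' N g)) _).symm

theorem lcs_succ_le_of_central {n : ℕ} (N : Subgroup G) [N.Normal]
    (h : (lcs (G ⧸ N) n) ≤ center (G ⧸ N)) : lcs G (n + 1) ≤ N := by
  rw [lcs_succ_le_iff]
  intro g hg k
  rw [← QuotientGroup.eq_one_iff, ← QuotientGroup.mk'_apply, map_commutatorElement,
    commutatorElement_eq_one_iff_mul_comm]
  exact (mem_center_iff.1 (h (map_mem_lcs (QuotientGroup.mk' N) hg)) _).symm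

theorem normal_of_le_center {N : Subgroup G} (h : N ≤ center G) : N.Normal := by
  refine ⟨fun a ha g => ?_⟩
  rwa [mem_center_iff.1 (h ha) g, mul_inv_cancel_right]

/-- Modulo `N` the element `⁅y, x⁆` commutes with both generators, so it spans a central, hence
normal, subgroup that contains the derived subgroup. -/
theorem lcs_two_le (hxy : closure {x, y} = ⊤) (N : Subgroup G) [N.Normal] (hu : ⁅⁅y, x⁆, x⁆ ∈ N)
    (hv : ⁅⁅y, x⁆, y⁆ ∈ N) : lcs G 2 ≤ N := by
  apply lcs_succ_le_of_central
  have hq := closure_pair_map (QuotientGroup.mk' N) (QuotientGroup.mk'_surjective N) hxy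
  have hs : ⁅QuotientGroup.mk' N y, QuotientGroup.mk' N x⁆ ∈ center (G ⧸ N) := by
    apply mem_center_of_commute hq <;>
    · rw [← commutatorElement_eq_one_iff_mul_comm, ← map_commutatorElement,
        ← map_commutatorElement]
      exact (QuotientGroup.eq_one_iff _).2 (by assumption)
  have hz := zpowers_le.2 hs
  have := normal_of_le_center hz
  exact (lcs_one_le hq _ (mem_zpowers _)).trans hz

theorem lcs_three_le (hxy : closure {x, y} = ⊤) (N : Subgroup G) [N.Normal]
    (hux : ⁅⁅⁅y, x⁆, x⁆, x⁆ ∈ N) (huy : ⁅⁅⁅y, x⁆, x⁆, y⁆ ∈ N) (hvx : ⁅⁅⁅y, x⁆, y⁆, x⁆ ∈ N)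
    (hvy : ⁅⁅⁅y, x⁆, y⁆, y⁆ ∈ N) : lcs G 3 ≤ N := by
  apply lcs_succ_le_of_central
  have hq := closure_pair_map (QuotientGroup.mk' N) (QuotientGroup.mk'_surjective N) hxy
  have hu : ⁅⁅QuotientGroup.mk' N y, QuotientGroup.mk' N x⁆, QuotientGroup.mk' N x⁆ ∈
      center (G ⧸ N) := by
    apply mem_center_of_commute hq <;>
    · rw [← commutatorElement_eq_one_iff_mul_comm, ← map_commutatorElement,
        ← map_commutatorElement, ← map_commutatorElement]
      exact (QuotientGroup.eq_one_iff _).2 (by assumption)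
  have hv : ⁅⁅QuotientGroup.mk' N y, QuotientGroup.mk' N x⁆, QuotientGroup.mk' N y⁆ ∈
      center (G ⧸ N) := by
    apply mem_center_of_commute hq <;>
    · rw [← commutatorElement_eq_one_iff_mul_comm, ← map_commutatorElement,
        ← map_commutatorElement, ← map_commutatorElement]
      exact (QuotientGroup.eq_one_iff _).2 (by assumption)
  -- The normal subgroup used here is the center of `G ⧸ N`.
  exact lcs_two_le hq _ hu hv

theorem exists_zpow_mul_of_mem_zpowers_sup {N : Subgroup G} [N.Normal] {s g : G}
    (h : g ∈ zpowers s ⊔ N) : ∃ k : ℤ, ∃ c ∈ N, g = s ^ k * c := by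
  rw [mem_sup_of_normal_right] at h
  obtain ⟨a, ⟨k, rfl⟩, c, hc, rfl⟩ := h
  exact ⟨k, c, hc, rfl⟩

theorem commutator_mem_lcs_one (x y : G) : ⁅y, x⁆ ∈ lcs G 1 :=
  commutator_mem_lcs_succ (n := 0) (mem_top y) x

theorem exists_form_lcs_two (hxy : closure {x, y} = ⊤) {g : G} (hg : g ∈ lcs G 2) :
    ∃ l o : ℤ, ∃ c ∈ lcs G 3, g = ⁅⁅y, x⁆, x⁆ ^ l * ⁅⁅y, x⁆, y⁆ ^ o * c := by
  have hu := commutator_mem_lcs_succ (commutator_mem_lcs_one x y) x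
  have hv := commutator_mem_lcs_succ (commutator_mem_lcs_one x y) y
  have h1 : zpowers ⁅⁅y, x⁆, y⁆ ⊔ lcs G 3 ≤ lcs G 2 :=
    sup_le (zpowers_le.2 hv) (lcs_antitone (by norm_num))
  have n1 : (zpowers ⁅⁅y, x⁆, y⁆ ⊔ lcs G 3).Normal := normal_of_lcs_le le_sup_right h1
  have n2 : (zpowers ⁅⁅y, x⁆, x⁆ ⊔ (zpowers ⁅⁅y, x⁆, y⁆ ⊔ lcs G 3)).Normal :=
    normal_of_lcs_le (n := 2) (le_sup_right.trans le_sup_right) (sup_le (zpowers_le.2 hu) h1)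
  have h := lcs_two_le hxy _ (mem_sup_left (mem_zpowers _))
    (mem_sup_right (mem_sup_left (mem_zpowers _)) : _ ∈
      (zpowers ⁅⁅y, x⁆, x⁆ ⊔ (zpowers ⁅⁅y, x⁆, y⁆ ⊔ lcs G 3))) hg
  obtain ⟨l, c, hc, rfl⟩ := exists_zpow_mul_of_mem_zpowers_sup h
  obtain ⟨o, d, hd, rfl⟩ := exists_zpow_mul_of_mem_zpowers_sup hc
  exact ⟨l, o, d, hd, by rw [mul_assoc]⟩

theorem exists_form_lcs_one (hxy : closure {x, y} = ⊤) {g : G} (hg : g ∈ lcs G 1) :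
    ∃ k : ℤ, ∃ c ∈ lcs G 2, g = ⁅y, x⁆ ^ k * c := by
  have n1 : (zpowers ⁅y, x⁆ ⊔ lcs G 2).Normal :=
    normal_of_lcs_le (n := 1) le_sup_right
      (sup_le (zpowers_le.2 (commutator_mem_lcs_one x y)) (lcs_antitone (by norm_num)))
  exact exists_zpow_mul_of_mem_zpowers_sup
    (lcs_one_le hxy _ (mem_sup_left (mem_zpowers _) : _ ∈ zpowers ⁅y, x⁆ ⊔ lcs G 2) hg)

theorem exists_form (hxy : closure {x, y} = ⊤) (g : G) :
    ∃ n m : ℤ, ∃ c ∈ lcs G 1, g = x ^ n * y ^ m * c := by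
  have n1 : (zpowers y ⊔ lcs G 1).Normal :=
    normal_of_lcs_le (n := 0) le_sup_right le_top
  have : g ∈ zpowers x ⊔ (zpowers y ⊔ lcs G 1) := by
    have h : closure {x, y} ≤ zpowers x ⊔ (zpowers y ⊔ lcs G 1) := by
      rw [closure_le]
      rintro z (rfl | rfl)
      · exact mem_sup_left (mem_zpowers _)
      · exact mem_sup_right (mem_sup_left (mem_zpowers _))
    exact h (hxy ▸ mem_top g)
  obtain ⟨n, c, hc, rfl⟩ := exists_zpow_mul_of_mem_zpowers_sup this
  obtain ⟨m, d, hd, rfl⟩ := exists_zpow_mul_of_mem_zpowers_sup hc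
  exact ⟨n, m, d, hd, by rw [mul_assoc]⟩

theorem commutatorElement_mul_central {a b c d : G} (hc : c ∈ center G) (hd : d ∈ center G) :
    ⁅a * c, b * d⁆ = ⁅a, b⁆ := by
  have h1 : ∀ g, Commute c g := fun g => (mem_center_iff.1 hc g).symm
  have h2 : ∀ g, Commute d g := fun g => (mem_center_iff.1 hd g).symm
  have e : ∀ {p q r : G}, (∀ g, Commute r g) → ⁅p * r, q⁆ = ⁅p, q⁆ := by
    intro p q r h
    rw [commutatorElement_def, commutatorElement_def, mul_inv_rev, mul_assoc p r q, (h q).eq]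
    group
  rw [e h1, ← commutatorElement_inv, e h2, commutatorElement_inv]

/-- If `H` covers `G` modulo `lcs G (n + 1)`, each commutator agrees modulo `lcs G (n + 2)` with a
commutator of elements of `H`. So `H` also covers `G` modulo `lcs G (n + 2)`, and nilpotency ends
the induction. -/
theorem eq_top_of_sup_lcs_one [Group.IsNilpotent G] {H : Subgroup G}
    (h : H ⊔ lcs G 1 = ⊤) : H = ⊤ := by
  have key : ∀ n, H ⊔ lcs G (n + 1) = ⊤ := by
    intro n
    induction n with
    | zero => exact h
    | succ n ih =>
      rw [eq_top_iff, ← h]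
      refine sup_le le_sup_left ?_
      rw [lcs_succ_le_iff]
      intro g _ k
      have hg : g ∈ H ⊔ lcs G (n + 1) := ih ▸ mem_top g
      have hk : k ∈ H ⊔ lcs G (n + 1) := ih ▸ mem_top k
      rw [mem_sup_of_normal_right] at hg hk
      obtain ⟨a, ha, c, hc, rfl⟩ := hg
      obtain ⟨b, hb, d, hd, rfl⟩ := hk
      have hcen : ∀ c ∈ lcs G (n + 1), QuotientGroup.mk' (lcs G (n + 1 + 1)) c ∈
          center (G ⧸ lcs G (n + 1 + 1)) := by
        intro c hc
        rw [mem_center_iff]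
        intro z
        obtain ⟨z, rfl⟩ := QuotientGroup.mk'_surjective _ z
        rw [← commutatorElement_eq_one_iff_mul_comm, ← map_commutatorElement]
        exact (QuotientGroup.eq_one_iff _).2 (commutator_mem_lcs_succ' hc z)
      have e : QuotientGroup.mk' (lcs G (n + 1 + 1)) ⁅a * c, b * d⁆ =
          QuotientGroup.mk' (lcs G (n + 1 + 1)) ⁅a, b⁆ := by
        rw [map_commutatorElement, map_commutatorElement, map_mul, map_mul]
        exact commutatorElement_mul_central (hcen c hc) (hcen d hd)
      obtain ⟨z, hz, hz'⟩ := (QuotientGroup.mk'_eq_mk' _).1 e.symm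
      rw [← hz']
      refine mul_mem (mem_sup_left ?_) (mem_sup_right hz)
      rw [commutatorElement_def]
      exact mul_mem (mul_mem (mul_mem ha hb) (inv_mem ha)) (inv_mem hb)
  obtain ⟨n, hn⟩ := Subgroup.nilpotent_iff_lowerCentralSeries.1 (inferInstance : Group.IsNilpotent G)
  have h1 := key n
  have h2 : lcs G (n + 1) = ⊥ := by
    rw [eq_bot_iff, ← hn]
    exact lcs_antitone (by omega)
  rwa [h2, sup_bot_eq] at h1

end Generators

end TwoGenerated

noncomputable section

/-! ### Leading terms of cubes and basic commutators up to weight three -/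

namespace Magnus

open SmallGroups TwoGenerated

/-- The reduced letter `X`. -/
abbrev X : RedAlg := rletter 0

/-- The reduced letter `Y`. -/
abbrev Y : RedAlg := rletter 1

/-- The Lie element `[Y,X]`. -/
def S : RedAlg := ⁅Y, X⁆

/-- The Lie element `[[Y,X],X]`. -/
def U : RedAlg := ⁅S, X⁆

/-- The Lie element `[[Y,X],Y]`. -/
def W : RedAlg := ⁅S, Y⁆

/-- The coefficient of a word. -/
def cf (w : List (Fin 2)) : RedAlg →ₗ[ZMod 3] ZMod 3 where
  toFun a := a.coeff (FreeMonoid.ofList w)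
  map_add' a b := by simp
  map_smul' r a := by simp

/-- The monomial of a word. -/
def mono (w : List (Fin 2)) : RedAlg := MonoidAlgebra.single (FreeMonoid.ofList w) 1

theorem rletter_eq_mono (i : Fin 2) : rletter i = mono [i] := rfl

theorem mono_mul (w w' : List (Fin 2)) : mono w * mono w' = mono (w ++ w') := by
  rw [mono, mono, MonoidAlgebra.single_mul_single, one_mul, ← FreeMonoid.ofList_append, mono]

theorem cf_mono (w w' : List (Fin 2)) : cf w (mono w') = if w' = w then 1 else 0 := by
  classical
  change (MonoidAlgebra.single (FreeMonoid.ofList w') (1 : ZMod 3)).coeff (FreeMonoid.ofList w) = _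
  rw [MonoidAlgebra.coeff_single, Finsupp.single_apply]
  simp

theorem S_eq : S = mono [1, 0] - mono [0, 1] := by
  rw [S, Ring.lie_def]; simp only [X, Y, rletter_eq_mono, mono_mul]; rfl

theorem three_smul_eq_zero (a : RedAlg) : (3 : ℕ) • a = 0 := by
  have : (3 : ℕ) • a = (3 : RedAlg) * a := by simp
  rw [this, red_three, zero_mul]

/-- The middle word has coefficient `-2`, which is `1` in characteristic three. So `U` is the sum of
all words with two letters `X` and one `Y`, the form in which it occurs in `(X + Y)³`. -/
theorem U_eq : U = mono [1, 0, 0] + mono [0, 1, 0] + mono [0, 0, 1] := by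
  rw [U, Ring.lie_def, S_eq, X, rletter_eq_mono]
  simp only [mul_sub, sub_mul, mono_mul, List.cons_append, List.nil_append]
  have := three_smul_eq_zero (mono [0, 1, 0])
  rw [← sub_eq_zero]
  rw [← neg_eq_zero] at this
  rw [← this]; abel

theorem W_eq : W = -(mono [1, 0, 1] + mono [0, 1, 1] + mono [1, 1, 0]) := by
  rw [W, Ring.lie_def, S_eq, Y, rletter_eq_mono]
  simp only [mul_sub, sub_mul, mono_mul, List.cons_append, List.nil_append]
  have := three_smul_eq_zero (mono [1, 0, 1])
  rw [← sub_eq_zero]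
  rw [← this]; abel

theorem X_cube : X ^ 3 = mono [0, 0, 0] := by
  rw [pow_succ, pow_two]; simp only [X, rletter_eq_mono, mono_mul]; rfl

theorem Y_cube : Y ^ 3 = mono [1, 1, 1] := by
  rw [pow_succ, pow_two]; simp only [Y, rletter_eq_mono, mono_mul]; rfl

/-- The leading term of a cube. -/
abbrev P (a : RedAlg) : RedAlg := a ^ 3 + a

/-- Jacobson's formula in characteristic three: the mixed words of the expansion sum to `U` and to
`-W`, and `t³ = t` removes the cubes of the scalars. -/
theorem linear_cube (i j : ZMod 3) :
    P (i • X + j • Y) = i • P X + j • P Y + (i ^ 2 * j) • U - (i * j ^ 2) • W := by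
  have h3 : ∀ t : ZMod 3, t * (t * t) = t := by decide
  rw [P, P, P, X_cube, Y_cube, U_eq, W_eq, pow_succ, pow_two]
  simp only [X, Y, rletter_eq_mono, add_mul, mul_add, smul_mul_smul_comm, mono_mul,
    List.cons_append, List.nil_append, mul_assoc, h3, smul_add, smul_neg, sub_neg_eq_add]
  have e1 : j * (i * j) = i * j ^ 2 := by ring
  have e2 : j * (j * i) = i * j ^ 2 := by ring
  have e3 : i * (j * j) = i * j ^ 2 := by ring
  have e4 : j * (i * i) = i ^ 2 * j := by ring
  have e5 : i * (j * i) = i ^ 2 * j := by ring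
  have e6 : i * (i * j) = i ^ 2 * j := by ring
  rw [e1, e2, e3, e4, e5, e6]
  abel

theorem coeffs_degree_one (a b : ZMod 3) :
    cf [0] (a • X + b • Y) = a ∧ cf [1] (a • X + b • Y) = b := by
  simp only [X, Y, rletter_eq_mono, map_add, map_smul, cf_mono]
  simp

theorem cf_S (a : ZMod 3) : cf [1, 0] (a • S) = a := by
  rw [S_eq]
  simp only [map_sub, map_smul, cf_mono]
  simp

/-- Each of the four words occurs in just one of `P X`, `P Y`, `U`, `W`, so the coefficients at
these words are coordinates. -/
theorem coeffs_degree_three (a b c d : ZMod 3) :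
    cf [0, 0, 0] (a • P X + b • P Y + c • U + d • W) = a ∧
    cf [1, 1, 1] (a • P X + b • P Y + c • U + d • W) = b ∧
    cf [0, 0, 1] (a • P X + b • P Y + c • U + d • W) = c ∧
    -cf [0, 1, 1] (a • P X + b • P Y + c • U + d • W) = d := by
  rw [P, P, X_cube, Y_cube, U_eq, W_eq]
  simp only [X, Y, rletter_eq_mono, map_add, map_smul, map_neg, cf_mono]
  simp

theorem Lead.zpow' {n : ℕ} {f : Algˣ} {a : RedAlg} (hn : n ≠ 0) (h : Lead n f a) (k : ℤ) :
    Lead n (f ^ k) ((k : ZMod 3) • a) := by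
  rw [Int.cast_smul_eq_zsmul]
  exact h.zpow hn k

theorem lead_x : Lead 1 (magnus x) X := lead_of 0

theorem lead_y : Lead 1 (magnus y) Y := lead_of 1

theorem lead_comm {m n : ℕ} (k : ℕ) {f g : FreeGroup (Fin 2)} {a b : RedAlg} (hm : m ≠ 0)
    (hn : n ≠ 0) (hk : k = m + n) (h : Lead m (magnus f) a) (h' : Lead n (magnus g) b) :
    Lead k (magnus ⁅f, g⁆) ⁅a, b⁆ := by
  rw [map_commutatorElement, hk]
  exact h.comm hm hn h'

theorem lead_s : Lead 2 (magnus s) S :=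
  lead_comm 2 one_ne_zero one_ne_zero rfl lead_y lead_x

theorem lead_u : Lead 3 (magnus u) U :=
  lead_comm 3 two_ne_zero one_ne_zero rfl lead_s lead_x

theorem lead_v : Lead 3 (magnus v) W :=
  lead_comm 3 two_ne_zero one_ne_zero rfl lead_s lead_y

/-- The subgroup of elements congruent to `1` modulo `√3ⁿ`. -/
def D (n : ℕ) [NeZero n] : Subgroup (FreeGroup (Fin 2)) where
  carrier := {f | ∃ a, Lead n (magnus f) a}
  one_mem' := ⟨0, by rw [map_one]; exact Lead.one n⟩
  mul_mem' := by
    rintro f g ⟨a, ha⟩ ⟨b, hb⟩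
    exact ⟨a + b, by rw [map_mul]; exact ha.mul (NeZero.ne n) hb⟩
  inv_mem' := by
    rintro f ⟨a, ha⟩
    exact ⟨-a, by rw [map_inv]; exact ha.inv (NeZero.ne n)⟩

theorem lead_conj {n : ℕ} {f : FreeGroup (Fin 2)} {a : RedAlg} (h : Lead n (magnus f) a)
    (g : FreeGroup (Fin 2)) : Lead n (magnus (g * f * g⁻¹)) a := by
  rw [map_mul, map_mul, map_inv]
  exact h.conj (red_magnus g)

theorem closure_xy : Subgroup.closure {x, y} = (⊤ : Subgroup (FreeGroup (Fin 2))) := by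
  rw [← FreeGroup.closure_range_of]
  congr 1
  ext z
  constructor
  · rintro (rfl | rfl)
    · exact ⟨0, rfl⟩
    · exact ⟨1, rfl⟩
  · rintro ⟨i, rfl⟩
    fin_cases i
    · exact Or.inl rfl
    · exact Or.inr rfl

theorem mem_D_one (f : FreeGroup (Fin 2)) : f ∈ D 1 := by
  have : Subgroup.closure {x, y} ≤ D 1 := by
    rw [Subgroup.closure_le]
    rintro z (rfl | rfl)
    · exact ⟨_, lead_x⟩
    · exact ⟨_, lead_y⟩
  exact this (closure_xy ▸ Subgroup.mem_top f)

theorem lcs_le_D (n : ℕ) : lcs (FreeGroup (Fin 2)) n ≤ D (n + 1) := by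
  induction n with
  | zero => intro f _; exact mem_D_one f
  | succ n ih =>
    rw [lcs_succ_le_iff]
    intro g hg h
    obtain ⟨a, ha⟩ := ih hg
    obtain ⟨b, hb⟩ := mem_D_one h
    exact ⟨_, lead_comm _ (Nat.succ_ne_zero n) one_ne_zero rfl ha hb⟩

theorem lead_zero_of_mem_lcs {m n : ℕ} (h : m ≤ n) {f : FreeGroup (Fin 2)}
    (hf : f ∈ lcs (FreeGroup (Fin 2)) n) : Lead m (magnus f) 0 := by
  obtain ⟨a, ha⟩ := lcs_le_D n hf
  exact ha.weaken (by omega)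

/-- The exponent sum of a letter. -/
def expoHom (i : Fin 2) : FreeGroup (Fin 2) →* Multiplicative ℤ :=
  FreeGroup.lift fun j => Multiplicative.ofAdd (if j = i then 1 else 0)

/-- The exponent sum of a letter. -/
def expo (i : Fin 2) (f : FreeGroup (Fin 2)) : ℤ := (expoHom i f).toAdd

theorem expo_mul (i : Fin 2) (f g : FreeGroup (Fin 2)) : expo i (f * g) = expo i f + expo i g := by
  simp [expo]

theorem expo_inv (i : Fin 2) (f : FreeGroup (Fin 2)) : expo i f⁻¹ = -expo i f := by
  simp [expo]

theorem expo_zpow (i : Fin 2) (f : FreeGroup (Fin 2)) (n : ℤ) : expo i (f ^ n) = n * expo i f := by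
  simp [expo]

theorem expo_of (i j : Fin 2) : expo i (FreeGroup.of j) = if j = i then 1 else 0 := by
  simp [expo, expoHom]

theorem expo_lcs (i : Fin 2) {f : FreeGroup (Fin 2)} (hf : f ∈ lcs (FreeGroup (Fin 2)) 1) :
    expo i f = 0 := by
  have h : lcs (FreeGroup (Fin 2)) 1 ≤ (expoHom i).ker := by
    rw [lcs_succ_le_iff]
    intro g _ h
    rw [MonoidHom.mem_ker, map_commutatorElement, commutatorElement_eq_one_iff_mul_comm, mul_comm]
  have := h hf
  rw [MonoidHom.mem_ker] at this
  simp [expo, this]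

theorem exists_expo_form (f : FreeGroup (Fin 2)) :
    ∃ k : ℤ, ∃ c ∈ lcs (FreeGroup (Fin 2)) 2, f = x ^ expo 0 f * y ^ expo 1 f * (s ^ k * c) := by
  obtain ⟨n, m, c, hc, rfl⟩ := exists_form closure_xy f
  obtain ⟨k, d, hd, rfl⟩ := exists_form_lcs_one closure_xy hc
  refine ⟨k, d, hd, ?_⟩
  simp [expo_mul, expo_zpow, expo_of, expo_lcs _ hc] at *

theorem lead_one (f : FreeGroup (Fin 2)) :
    Lead 1 (magnus f) ((expo 0 f : ZMod 3) • X + (expo 1 f : ZMod 3) • Y) := by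
  obtain ⟨k, c, hc, h⟩ := exists_expo_form f
  have h1 : Lead 1 (magnus (s ^ k * c)) (0 + 0) := by
    rw [map_mul, map_zpow]
    exact ((lead_s.zpow two_ne_zero k).weaken one_lt_two).mul one_ne_zero
      (lead_zero_of_mem_lcs one_le_two hc)
  have h2 := ((lead_x.zpow' one_ne_zero (expo 0 f)).mul one_ne_zero
    (lead_y.zpow' one_ne_zero (expo 1 f))).mul one_ne_zero h1
  rw [← map_zpow, ← map_zpow, ← map_mul, ← map_mul, ← h] at h2
  simpa using h2

theorem lead_three_of_expo {f g : FreeGroup (Fin 2)} {a : RedAlg} {n m : ℤ}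
    (hx : f = x ^ (3 * n) * y ^ (3 * m) * g) (hg : Lead 3 (magnus g) a) :
    Lead 3 (magnus f) ((n : ZMod 3) • P X + (m : ZMod 3) • P Y + a) := by
  rw [hx, map_mul, map_mul, map_zpow, map_zpow, zpow_mul, zpow_mul]
  exact (((lead_x.cube_one).zpow' three_ne_zero n).mul three_ne_zero
    ((lead_y.cube_one).zpow' three_ne_zero m)).mul three_ne_zero hg

end Magnus

end

/-! ### Normal forms in class three -/

namespace TwoGenerated

open Subgroup

variable {G : Type*} [Group G] {x y : G}

theorem commutatorElement_pow_right {a b : G} (h : Commute ⁅a, b⁆ b) (n : ℕ) :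
    ⁅a, b ^ n⁆ = ⁅a, b⁆ ^ n := by
  have e : a * b * a⁻¹ = ⁅a, b⁆ * b := by rw [commutatorElement_def]; group
  have e1 : a * b ^ n * a⁻¹ = ⁅a, b⁆ ^ n * b ^ n := by
    rw [← conj_pow, e, h.mul_pow]
  rw [commutatorElement_def a (b ^ n), e1]; group

theorem commutatorElement_pow_left {a b : G} (h : Commute ⁅a, b⁆ a) (n : ℕ) :
    ⁅a ^ n, b⁆ = ⁅a, b⁆ ^ n := by
  rw [← commutatorElement_inv, commutatorElement_pow_right, ← commutatorElement_inv b a, inv_pow]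
  rw [← commutatorElement_inv]
  exact h.inv_left

theorem mk_mem_center {n : ℕ} {c : G} (hc : c ∈ lcs G n) :
    QuotientGroup.mk' (lcs G (n + 1)) c ∈ center (G ⧸ lcs G (n + 1)) := by
  rw [mem_center_iff]
  intro z
  obtain ⟨z, rfl⟩ := QuotientGroup.mk'_surjective _ z
  rw [← commutatorElement_eq_one_iff_mul_comm, ← map_commutatorElement]
  exact (QuotientGroup.eq_one_iff _).2 (commutator_mem_lcs_succ' hc z)

theorem commutator_cube_mem {n : ℕ} {a b : G} (ha : a ∈ lcs G n) (hb : ⁅a, b ^ 3⁆ ∈ lcs G (n + 2)) :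
    ⁅a, b⁆ ^ 3 ∈ lcs G (n + 2) := by
  rw [← QuotientGroup.eq_one_iff, ← QuotientGroup.mk'_apply] at hb ⊢
  rw [map_pow, map_commutatorElement, ← commutatorElement_pow_right, ← map_pow,
    ← map_commutatorElement, hb]
  rw [← map_commutatorElement]
  exact (mem_center_iff.1 (mk_mem_center (commutator_mem_lcs_succ ha b)) _).symm

theorem commutator_cube_mem' {n : ℕ} {a b : G} (ha : a ∈ lcs G n)
    (hb : a ^ 3 ∈ lcs G (n + 1)) : ⁅a, b⁆ ^ 3 ∈ lcs G (n + 2) := by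
  have hb := commutator_mem_lcs_succ hb b
  rw [← QuotientGroup.eq_one_iff, ← QuotientGroup.mk'_apply] at hb ⊢
  rw [map_pow, map_commutatorElement, ← commutatorElement_pow_left, ← map_pow,
    ← map_commutatorElement, hb]
  rw [← map_commutatorElement]
  exact (mem_center_iff.1 (mk_mem_center (commutator_mem_lcs_succ ha b)) _).symm

theorem zpow_emod_three (g : G) (n : ℤ) : g ^ n = g ^ (n % 3).toNat * (g ^ 3) ^ (n / 3) := by
  have h1 : ((n % 3).toNat : ℤ) = n % 3 := Int.toNat_of_nonneg (Int.emod_nonneg _ (by norm_num))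
  rw [← zpow_natCast g (n % 3).toNat, h1, ← zpow_natCast g 3, ← zpow_mul, ← zpow_add]
  congr 1
  push_cast
  rw [Int.emod_add_mul_ediv]

/-- The elements `xⁿ yᵐ sᵏ uˡ vᵒ` with exponents in `{0,1,2}`. -/
def normalForm (x y : G) (e : Fin 3 × Fin 3 × Fin 3 × Fin 3 × Fin 3) : G :=
  x ^ (e.1 : ℕ) * y ^ (e.2.1 : ℕ) * (⁅y, x⁆ ^ (e.2.2.1 : ℕ) *
    (⁅⁅y, x⁆, x⁆ ^ (e.2.2.2.1 : ℕ) * ⁅⁅y, x⁆, y⁆ ^ (e.2.2.2.2 : ℕ)))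

/-- The residue modulo `3`. -/
def residue (n : ℤ) : Fin 3 := ⟨(n % 3).toNat, by omega⟩

/-- Cubes of the generators in `lcs G 1` force `s³` into `lcs G 2` and `u³ = v³ = 1`. Exponents are
reduced modulo three from the top down, the surplus being absorbed by the next term of the series.
-/
theorem normalForm_surjective (hxy : closure {x, y} = ⊤) (h3 : lcs G 3 = ⊥) (hx : x ^ 3 ∈ lcs G 1)
    (hy : y ^ 3 ∈ lcs G 1) : Function.Surjective (normalForm x y) := by
  intro g
  have hs : ⁅y, x⁆ ^ 3 ∈ lcs G 2 :=
    commutator_cube_mem (n := 0) (mem_top y) (commutator_mem_lcs_succ' hx y)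
  have hu : ⁅⁅y, x⁆, x⁆ ^ 3 = 1 := by
    have := commutator_cube_mem' (b := x) (commutator_mem_lcs_one x y) hs
    rwa [h3, mem_bot] at this
  have hv : ⁅⁅y, x⁆, y⁆ ^ 3 = 1 := by
    have := commutator_cube_mem' (b := y) (commutator_mem_lcs_one x y) hs
    rwa [h3, mem_bot] at this
  obtain ⟨n, m, c, hc, rfl⟩ := exists_form hxy g
  have e1 : x ^ n * y ^ m * c = x ^ (n % 3).toNat * y ^ (m % 3).toNat *
      (((y ^ (m % 3).toNat)⁻¹ * (x ^ 3) ^ (n / 3) * y ^ (m % 3).toNat) * (y ^ 3) ^ (m / 3) * c) := by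
    rw [zpow_emod_three x n, zpow_emod_three y m]; group
  have hc' : ((y ^ (m % 3).toNat)⁻¹ * (x ^ 3) ^ (n / 3) * y ^ (m % 3).toNat) * (y ^ 3) ^ (m / 3) * c
      ∈ lcs G 1 := by
    refine mul_mem (mul_mem ?_ (zpow_mem hy _)) hc
    have := (inferInstance : (lcs G 1).Normal).conj_mem _ (zpow_mem hx (n / 3))
      (y ^ (m % 3).toNat)⁻¹
    rwa [inv_inv] at this
  obtain ⟨k, d, hd, e2⟩ := exists_form_lcs_one hxy hc'
  have hd' : (⁅y, x⁆ ^ 3) ^ (k / 3) * d ∈ lcs G 2 := mul_mem (zpow_mem hs _) hd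
  obtain ⟨l, o, t, ht, e3⟩ := exists_form_lcs_two hxy hd'
  rw [h3, mem_bot] at ht
  refine ⟨⟨residue n, residue m, residue k, residue l, residue o⟩, ?_⟩
  rw [e1, e2, zpow_emod_three ⁅y, x⁆ k, mul_assoc (⁅y, x⁆ ^ (k % 3).toNat), e3, ht, mul_one,
    zpow_emod_three _ l, zpow_emod_three _ o, hu, hv, one_zpow, one_zpow, mul_one, mul_one]
  rfl

end TwoGenerated

noncomputable section

namespace Magnus

section Bracket

variable (a b c : RedAlg) (t : ZMod 3)

theorem bracket_add : ⁅a, b + c⁆ = ⁅a, b⁆ + ⁅a, c⁆ := by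
  simp only [Ring.lie_def, mul_add, add_mul]; abel

theorem add_bracket : ⁅a + b, c⁆ = ⁅a, c⁆ + ⁅b, c⁆ := by
  simp only [Ring.lie_def, mul_add, add_mul]; abel

theorem bracket_smul : ⁅a, t • b⁆ = t • ⁅a, b⁆ := by
  simp only [Ring.lie_def, mul_smul_comm, smul_mul_assoc, smul_sub]

theorem smul_bracket : ⁅t • a, b⁆ = t • ⁅a, b⁆ := by
  simp only [Ring.lie_def, mul_smul_comm, smul_mul_assoc, smul_sub]

theorem bracket_self : ⁅a, a⁆ = 0 := by
  rw [Ring.lie_def, sub_self]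

theorem bracket_swap : ⁅a, b⁆ = -⁅b, a⁆ := by
  simp only [Ring.lie_def]; abel

end Bracket

end Magnus

/-- The shape `x³ = u^α v^β`, `y³ = u^γ v^δ` of the cubes in a group of order `243`. -/
structure CubeShape where
  /-- exponent of `u` in `x³` -/
  α : ZMod 3
  /-- exponent of `v` in `x³` -/
  β : ZMod 3
  /-- exponent of `u` in `y³` -/
  γ : ZMod 3
  /-- exponent of `v` in `y³` -/
  δ : ZMod 3

/-! ### Relation subgroups of the groups of order 243 and change of generators -/

namespace CubeShape

open Magnus SmallGroups TwoGenerated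

/-- The relations of a group of class three with given cubes. -/
structure Satisfied (M : CubeShape) {G : Type*} [Group G] (x y : G) : Prop where
  s_cube : ⁅y, x⁆ ^ 3 = 1
  u_cube : ⁅⁅y, x⁆, x⁆ ^ 3 = 1
  v_cube : ⁅⁅y, x⁆, y⁆ ^ 3 = 1
  ux : ⁅⁅⁅y, x⁆, x⁆, x⁆ = 1
  uy : ⁅⁅⁅y, x⁆, x⁆, y⁆ = 1
  vx : ⁅⁅⁅y, x⁆, y⁆, x⁆ = 1
  vy : ⁅⁅⁅y, x⁆, y⁆, y⁆ = 1
  x_cube : x ^ 3 = ⁅⁅y, x⁆, x⁆ ^ M.α.val * ⁅⁅y, x⁆, y⁆ ^ M.β.val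
  y_cube : y ^ 3 = ⁅⁅y, x⁆, x⁆ ^ M.γ.val * ⁅⁅y, x⁆, y⁆ ^ M.δ.val

variable (M : CubeShape)

/-- The relation subgroup of the group of order `243` with given cubes. -/
def J : Subgroup (FreeGroup (Fin 2)) where
  carrier := {f | ∃ p q : ZMod 3, Lead 3 (magnus f)
    (p • P X + q • P Y + (-(p * M.α + q * M.γ)) • U + (-(p * M.β + q * M.δ)) • W)}
  one_mem' := ⟨0, 0, by simpa using Lead.one 3⟩
  mul_mem' := by
    rintro f g ⟨p, q, h⟩ ⟨p', q', h'⟩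
    refine ⟨p + p', q + q', ?_⟩
    rw [map_mul]
    convert h.mul three_ne_zero h' using 1
    module
  inv_mem' := by
    rintro f ⟨p, q, h⟩
    refine ⟨-p, -q, ?_⟩
    rw [map_inv]
    convert h.inv three_ne_zero using 1
    module

instance : (J M).Normal := ⟨by
  rintro f ⟨p, q, h⟩ g
  exact ⟨p, q, lead_conj h g⟩⟩

variable {M}

/-- The coordinates at `P X` and `P Y` determine the parameters `p`, `q` in the definition of `J M`;
the coordinates at `U` and `W` are then forced. -/
theorem mem_J_iff {f : FreeGroup (Fin 2)} {a b c d : ZMod 3}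
    (h : Lead 3 (magnus f) (a • P X + b • P Y + c • U + d • W)) :
    f ∈ J M ↔ c = -(a * M.α + b * M.γ) ∧ d = -(a * M.β + b * M.δ) := by
  constructor
  · rintro ⟨p, q, h'⟩
    have e := h.unique (by norm_num) h'
    obtain ⟨h1, h2, h3, h4⟩ := coeffs_degree_three a b c d
    obtain ⟨h1', h2', h3', h4'⟩ := coeffs_degree_three p q (-(p * M.α + q * M.γ))
      (-(p * M.β + q * M.δ))
    rw [e] at h1 h2 h3 h4
    have ea := h1.symm.trans h1'
    have eb := h2.symm.trans h2'
    subst ea eb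
    exact ⟨h3.symm.trans h3', h4.symm.trans h4'⟩
  · rintro ⟨rfl, rfl⟩
    exact ⟨a, b, h⟩

theorem mem_J_of_lead_zero {f : FreeGroup (Fin 2)} (h : Lead 3 (magnus f) 0) : f ∈ J M :=
  ⟨0, 0, by simpa using h⟩

theorem mem_J_of_lead {f : FreeGroup (Fin 2)} {n : ℕ} (hn : 3 < n) {a : RedAlg}
    (h : Lead n (magnus f) a) : f ∈ J M :=
  mem_J_of_lead_zero (h.weaken hn)

theorem lcs_three_le_J : lcs (FreeGroup (Fin 2)) 3 ≤ J M := fun _ hf =>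
  mem_J_of_lead_zero (lead_zero_of_mem_lcs le_rfl hf)

section BaseChange

variable {f g : FreeGroup (Fin 2)} {i j k l : ZMod 3}

theorem lead_bracket (hf : Lead 1 (magnus f) (i • X + j • Y))
    (hg : Lead 1 (magnus g) (k • X + l • Y)) :
    Lead 2 (magnus ⁅g, f⁆) ((i * l - j * k) • S) := by
  convert lead_comm 2 one_ne_zero one_ne_zero rfl hg hf using 1
  simp only [S, bracket_add, add_bracket, bracket_smul, smul_bracket, bracket_self, smul_zero]
  rw [bracket_swap X Y]
  module

theorem lead_bracket_three {h : FreeGroup (Fin 2)} {d : ZMod 3} (hs : Lead 2 (magnus h) (d • S))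
    (hf : Lead 1 (magnus f) (i • X + j • Y)) :
    Lead 3 (magnus ⁅h, f⁆) ((d * i) • U + (d * j) • W) := by
  convert lead_comm 3 two_ne_zero one_ne_zero rfl hs hf using 1
  simp only [U, W, bracket_add, bracket_smul, smul_bracket]
  module

/-- The terms `m²n` and `mn²` are the corrections from `linear_cube`. The right-hand sides come from
`⁅g, f⁆`, which has leading term the determinant times `S`. -/
theorem cube_mem_J_iff (hf : Lead 1 (magnus f) (i • X + j • Y))
    (hg : Lead 1 (magnus g) (k • X + l • Y)) {h : FreeGroup (Fin 2)} {m n a b : ZMod 3}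
    (hh : Lead 1 (magnus h) (m • X + n • Y)) :
    h ^ 3 * (⁅⁅g, f⁆, f⁆ ^ a.val * ⁅⁅g, f⁆, g⁆ ^ b.val)⁻¹ ∈ J M ↔
      m * M.α + n * M.γ + m ^ 2 * n = (i * l - j * k) * (a * i + b * k) ∧
      m * M.β + n * M.δ - m * n ^ 2 = (i * l - j * k) * (a * j + b * l) := by
  have hs := lead_bracket hf hg
  have hu := (lead_bracket_three hs hf).zpow' three_ne_zero (a.val : ℤ)
  have hv := (lead_bracket_three hs hg).zpow' three_ne_zero (b.val : ℤ)
  have h1 := hh.cube_one.mul three_ne_zero ((hu.mul three_ne_zero hv).inv three_ne_zero)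
  rw [← map_zpow, ← map_zpow, ← map_mul, ← map_pow, ← map_inv, ← map_mul, zpow_natCast,
    zpow_natCast] at h1
  have ea : (((a.val : ℕ) : ℤ) : ZMod 3) = a := by simp
  have eb : (((b.val : ℕ) : ℤ) : ZMod 3) = b := by simp
  rw [ea, eb] at h1
  have e : P (m • X + n • Y) + -(a • (((i * l - j * k) * i) • U + ((i * l - j * k) * j) • W) +
      b • (((i * l - j * k) * k) • U + ((i * l - j * k) * l) • W)) =
      m • P X + n • P Y + (m ^ 2 * n - (i * l - j * k) * (a * i + b * k)) • U +
        (-(m * n ^ 2) - (i * l - j * k) * (a * j + b * l)) • W := by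
    rw [linear_cube]; module
  rw [e] at h1
  rw [mem_J_iff h1]
  constructor
  · rintro ⟨h2, h3⟩
    exact ⟨by linear_combination h2, by linear_combination h3⟩
  · rintro ⟨h2, h3⟩
    exact ⟨by linear_combination h2, by linear_combination h3⟩

/-- The condition that generators with exponent vectors `(i,j)` and `(k,l)` turn the cubes of shape
`M` into cubes of shape `M'`. -/
def IsBaseChange (M M' : CubeShape) (i j k l : ZMod 3) : Prop :=
  (i * M.α + j * M.γ + i ^ 2 * j = (i * l - j * k) * (M'.α * i + M'.β * k) ∧
    i * M.β + j * M.δ - i * j ^ 2 = (i * l - j * k) * (M'.α * j + M'.β * l)) ∧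
  (k * M.α + l * M.γ + k ^ 2 * l = (i * l - j * k) * (M'.γ * i + M'.δ * k) ∧
    k * M.β + l * M.δ - k * l ^ 2 = (i * l - j * k) * (M'.γ * j + M'.δ * l))

/-- Only the two cube relations carry information: the other seven relators have weight at least
four and so lie in every `J M`. -/
theorem satisfied_iff {V : Type*} [Group V] {π : FreeGroup (Fin 2) →* V} (hπ : π.ker = J M)
    {M' : CubeShape} (hf : Lead 1 (magnus f) (i • X + j • Y))
    (hg : Lead 1 (magnus g) (k • X + l • Y)) :
    M'.Satisfied (π f) (π g) ↔ IsBaseChange M M' i j k l := by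
  have key : ∀ h, π h = 1 ↔ h ∈ J M := fun h => by rw [← hπ, MonoidHom.mem_ker]
  have hs := lead_bracket hf hg
  have hu := lead_bracket_three hs hf
  have hv := lead_bracket_three hs hg
  rw [IsBaseChange, ← cube_mem_J_iff hf hg hf, ← cube_mem_J_iff hf hg hg, ← key, ← key]
  simp only [map_mul, map_inv, map_pow, map_commutatorElement, mul_inv_eq_one]
  constructor
  · intro h
    exact ⟨h.x_cube, h.y_cube⟩
  · rintro ⟨h1, h2⟩
    refine ⟨?_, ?_, ?_, ?_, ?_, ?_, ?_, h1, h2⟩ <;>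
    simp only [← map_commutatorElement, ← map_pow] <;> rw [key]
    · exact mem_J_of_lead (by norm_num) (n := 4) (by rw [map_pow]; exact hs.cube_of_two_le le_rfl)
    · exact mem_J_of_lead (by norm_num) (n := 5)
        (by rw [map_pow]; exact hu.cube_of_two_le (by norm_num))
    · exact mem_J_of_lead (by norm_num) (n := 5)
        (by rw [map_pow]; exact hv.cube_of_two_le (by norm_num))
    · exact mem_J_of_lead (by norm_num) (lead_comm 4 three_ne_zero one_ne_zero rfl hu hf)
    · exact mem_J_of_lead (by norm_num) (lead_comm 4 three_ne_zero one_ne_zero rfl hu hg)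
    · exact mem_J_of_lead (by norm_num) (lead_comm 4 three_ne_zero one_ne_zero rfl hv hf)
    · exact mem_J_of_lead (by norm_num) (lead_comm 4 three_ne_zero one_ne_zero rfl hv hg)

end BaseChange

end CubeShape

end

/-! ### Words with vanishing leading terms in weights one and two -/

namespace Magnus

open SmallGroups TwoGenerated

theorem intCast_zmod_three_eq_zero {n : ℤ} (h : (n : ZMod 3) = 0) : ∃ m, n = 3 * m :=
  (ZMod.intCast_zmod_eq_zero_iff_dvd n 3).1 h

theorem expo_eq_zero_of_lead {f : FreeGroup (Fin 2)} (h : Lead 1 (magnus f) 0) :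
    (expo 0 f : ZMod 3) = 0 ∧ (expo 1 f : ZMod 3) = 0 := by
  have e := (lead_one f).unique (by norm_num) h
  obtain ⟨h1, h2⟩ := coeffs_degree_one (expo 0 f : ZMod 3) (expo 1 f : ZMod 3)
  rw [e, map_zero] at h1 h2
  exact ⟨h1.symm, h2.symm⟩

theorem lead_two_of_expo {f c : FreeGroup (Fin 2)} {n m k : ℤ}
    (hc : c ∈ lcs (FreeGroup (Fin 2)) 2) (hf : f = x ^ (3 * n) * y ^ (3 * m) * (s ^ k * c)) :
    Lead 2 (magnus f) ((k : ZMod 3) • S) := by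
  have h1 := ((lead_x.cube_one).zpow three_ne_zero n).weaken (m := 2) (by norm_num)
  have h2 := ((lead_y.cube_one).zpow three_ne_zero m).weaken (m := 2) (by norm_num)
  have h3 := (h1.mul two_ne_zero h2).mul two_ne_zero
    ((lead_s.zpow' two_ne_zero k).mul two_ne_zero (lead_zero_of_mem_lcs le_rfl hc))
  rw [hf]
  simp only [map_mul, map_zpow, zpow_mul]
  simpa using h3

theorem lead_three_of_form {f d : FreeGroup (Fin 2)} {n m k l o : ℤ}
    (hd : d ∈ lcs (FreeGroup (Fin 2)) 3)
    (hf : f = x ^ (3 * n) * y ^ (3 * m) * (s ^ (3 * k) * (u ^ l * v ^ o * d))) :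
    Lead 3 (magnus f)
      ((n : ZMod 3) • P X + (m : ZMod 3) • P Y + (l : ZMod 3) • U + (o : ZMod 3) • W) := by
  have h1 := ((lead_s.cube_of_two_le le_rfl).zpow four_ne_zero k).weaken (m := 3) (by norm_num)
  have h2 := h1.mul three_ne_zero ((((lead_u.zpow' three_ne_zero l).mul three_ne_zero
    (lead_v.zpow' three_ne_zero o))).mul three_ne_zero (lead_zero_of_mem_lcs le_rfl hd))
  rw [← zpow_natCast, ← zpow_mul, ← map_zpow, ← map_zpow, ← map_zpow, ← map_mul, ← map_mul,
    ← map_mul] at h2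
  have h3 := lead_three_of_expo hf h2
  convert h3 using 1
  abel

theorem exists_form_of_expo {f : FreeGroup (Fin 2)} (h0 : (expo 0 f : ZMod 3) = 0)
    (h1 : (expo 1 f : ZMod 3) = 0) : ∃ n m k : ℤ, ∃ c ∈ lcs (FreeGroup (Fin 2)) 2,
      expo 0 f = 3 * n ∧ expo 1 f = 3 * m ∧ f = x ^ (3 * n) * y ^ (3 * m) * (s ^ k * c) := by
  obtain ⟨k, c, hc, h⟩ := exists_expo_form f
  obtain ⟨n, hn⟩ := intCast_zmod_three_eq_zero h0
  obtain ⟨m, hm⟩ := intCast_zmod_three_eq_zero h1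
  exact ⟨n, m, k, c, hc, hn, hm, by rw [← hn, ← hm]; exact h⟩

/-- The vanishing in weight one makes the exponents of `x` and `y` divisible by three; their cubes
have weight three, so the vanishing in weight two then does the same for `s`. -/
theorem exists_form_of_lead_two {f : FreeGroup (Fin 2)} (h : Lead 2 (magnus f) 0) :
    ∃ n m k l o : ℤ, ∃ d ∈ lcs (FreeGroup (Fin 2)) 3, expo 0 f = 3 * n ∧ expo 1 f = 3 * m ∧
      f = x ^ (3 * n) * y ^ (3 * m) * (s ^ (3 * k) * (u ^ l * v ^ o * d)) := by
  obtain ⟨h0, h1⟩ := expo_eq_zero_of_lead (h.weaken one_lt_two)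
  obtain ⟨n, m, k, c, hc, hn, hm, hf⟩ := exists_form_of_expo h0 h1
  have e := (lead_two_of_expo hc hf).unique (by norm_num) h
  have hk := cf_S (k : ZMod 3)
  rw [e, map_zero] at hk
  obtain ⟨k, rfl⟩ := intCast_zmod_three_eq_zero hk.symm
  obtain ⟨l, o, d, hd, rfl⟩ := exists_form_lcs_two closure_xy hc
  exact ⟨n, m, k, l, o, d, hd, hn, hm, hf⟩

end Magnus

/-! ### Models of the groups of order 243 -/

namespace CubeShape

open Magnus SmallGroups TwoGenerated

variable {M : CubeShape} {V : Type*} [Group V]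

theorem zpow_eq_of_cast_eq {g : V} (h : g ^ 3 = 1) {a b : ℤ} (hab : (a : ZMod 3) = b) :
    g ^ a = g ^ b := by
  have : (a - b : ℤ) = 3 * ((a - b) / 3) := by
    rw [← sub_eq_zero, ← Int.cast_sub] at hab
    have := (ZMod.intCast_zmod_eq_zero_iff_dvd (a - b) 3).1 hab
    push_cast at this
    omega
  rw [← mul_inv_eq_one, ← zpow_neg, ← zpow_add, ← sub_eq_add_neg, this, zpow_mul]
  norm_cast
  rw [h, one_zpow]

/-- A word of `J M` is `x^(3n) y^(3m) s^(3k) u^l v^o d`, with `l` and `o` prescribed modulo three by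
`n` and `m`. Substituting the relations for the cubes, the powers of `u` and of `v` cancel. -/
theorem Satisfied.J_le_ker {φ : FreeGroup (Fin 2) →* V} (h : M.Satisfied (φ x) (φ y)) :
    J M ≤ φ.ker := by
  intro f hf
  have hf' := hf
  obtain ⟨p, q, hL⟩ := hf
  obtain ⟨n, m, k, l, o, d, hd, -, -, rfl⟩ := exists_form_of_lead_two (hL.weaken (by norm_num))
  have h3 := (mem_J_iff (lead_three_of_form hd rfl)).1 hf'
  have hd' : φ d = 1 := by
    have : lcs (FreeGroup (Fin 2)) 3 ≤ φ.ker := by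
      apply lcs_three_le closure_xy <;>
      simp only [MonoidHom.mem_ker, map_commutatorElement, h.ux, h.uy, h.vx, h.vy]
    exact this hd
  have hu : φ u = ⁅⁅φ y, φ x⁆, φ x⁆ := by simp only [map_commutatorElement]
  have hv : φ v = ⁅⁅φ y, φ x⁆, φ y⁆ := by simp only [map_commutatorElement]
  have hs : φ s = ⁅φ y, φ x⁆ := by simp only [map_commutatorElement]
  rw [MonoidHom.mem_ker]
  simp only [map_mul, map_zpow, hd', hs, zpow_mul, mul_one]
  norm_cast
  rw [hu, hv, h.s_cube, h.x_cube, h.y_cube]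
  have hux : Commute ⁅⁅φ y, φ x⁆, φ x⁆ (φ x) := commutatorElement_eq_one_iff_mul_comm.1 h.ux
  have huy : Commute ⁅⁅φ y, φ x⁆, φ x⁆ (φ y) := commutatorElement_eq_one_iff_mul_comm.1 h.uy
  have hus : Commute ⁅⁅φ y, φ x⁆, φ x⁆ ⁅φ y, φ x⁆ := by
    rw [commutatorElement_def (φ y) (φ x)] at hux huy ⊢
    exact ((huy.mul_right hux).mul_right huy.inv_right).mul_right hux.inv_right
  have huv : Commute ⁅⁅φ y, φ x⁆, φ x⁆ ⁅⁅φ y, φ x⁆, φ y⁆ := by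
    rw [commutatorElement_def ⁅φ y, φ x⁆ (φ y)]
    exact ((hus.mul_right huy).mul_right hus.inv_right).mul_right huy.inv_right
  have hu3 := h.u_cube
  have hv3 := h.v_cube
  generalize ⁅⁅φ y, φ x⁆, φ x⁆ = U' at *
  generalize ⁅⁅φ y, φ x⁆, φ y⁆ = V' at *
  have e : (U' ^ M.α.val * V' ^ M.β.val) ^ n * (U' ^ M.γ.val * V' ^ M.δ.val) ^ m *
      (1 ^ k * (U' ^ l * V' ^ o)) =
      U' ^ ((M.α.val : ℤ) * n + M.γ.val * m + l) * V' ^ ((M.β.val : ℤ) * n + M.δ.val * m + o) := by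
    rw [(huv.pow_pow _ _).mul_zpow, (huv.pow_pow _ _).mul_zpow]
    simp only [← zpow_natCast, ← zpow_mul, zpow_add, one_zpow, one_mul]
    have c1 : ∀ a b : ℤ, U' ^ a * V' ^ b = V' ^ b * U' ^ a := fun a b => (huv.zpow_zpow a b).eq
    have c2 := c1 (M.γ.val * m) (M.β.val * n)
    have c3 := c1 l (M.β.val * n)
    have c4 := c1 l (M.δ.val * m)
    generalize U' ^ ((M.α.val : ℤ) * n) = a1 at *
    generalize U' ^ ((M.γ.val : ℤ) * m) = a2 at *
    generalize U' ^ l = a3 at *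
    generalize V' ^ ((M.β.val : ℤ) * n) = b1 at *
    generalize V' ^ ((M.δ.val : ℤ) * m) = b2 at *
    calc _ = a1 * (b1 * a2) * (b2 * a3) * V' ^ o := by group
      _ = a1 * (a2 * b1) * (a3 * b2) * V' ^ o := by rw [c2, c4]
      _ = a1 * a2 * (b1 * a3) * b2 * V' ^ o := by group
      _ = a1 * a2 * (a3 * b1) * b2 * V' ^ o := by rw [c3]
      _ = _ := by group
  rw [e, zpow_eq_of_cast_eq hu3 (b := 0), zpow_eq_of_cast_eq hv3 (b := 0), zpow_zero, zpow_zero,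
    one_mul]
  · push_cast
    rw [h3.2]
    simp only [ZMod.natCast_val, ZMod.cast_id', id_eq]
    ring
  · push_cast
    rw [h3.1]
    simp only [ZMod.natCast_val, ZMod.cast_id', id_eq]
    ring

/-- `π` presents `V` as the group of order `243` with cubes of shape `M`. -/
structure IsModel (M : CubeShape) {V : Type*} [Group V] (π : FreeGroup (Fin 2) →* V) : Prop where
  surjective : Function.Surjective π
  ker_eq : π.ker = J M

namespace IsModel

variable {π : FreeGroup (Fin 2) →* V}

theorem eq_one_iff (h : M.IsModel π) {f : FreeGroup (Fin 2)} : π f = 1 ↔ f ∈ J M := by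
  rw [← h.ker_eq, MonoidHom.mem_ker]

theorem isBaseChange_refl (M : CubeShape) : IsBaseChange M M 1 0 0 1 := by
  simp [IsBaseChange]

theorem satisfied (h : M.IsModel π) : M.Satisfied (π x) (π y) := by
  rw [satisfied_iff h.ker_eq (i := 1) (j := 0) (k := 0) (l := 1)]
  · exact isBaseChange_refl M
  · simpa using lead_x
  · simpa using lead_y

theorem closure_eq (h : M.IsModel π) : Subgroup.closure {π x, π y} = ⊤ :=
  closure_pair_map π h.surjective closure_xy

theorem lcs_three (h : M.IsModel π) : lcs V 3 = ⊥ := by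
  rw [eq_bot_iff]
  have := h.satisfied
  apply lcs_three_le h.closure_eq <;> rw [Subgroup.mem_bot]
  exacts [this.ux, this.uy, this.vx, this.vy]

theorem u_notMem : u ∉ J M := by
  have h : Lead 3 (magnus u) ((0 : ZMod 3) • P X + (0 : ZMod 3) • P Y + (1 : ZMod 3) • U +
    (0 : ZMod 3) • W) := by simpa using lead_u
  rw [mem_J_iff h]
  simp

theorem lcs_two_ne (h : M.IsModel π) : lcs V 2 ≠ ⊥ := by
  intro hb
  have h1 : π u ∈ lcs V 2 := map_mem_lcs π
    (commutator_mem_lcs_succ (commutator_mem_lcs_one x y) x)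
  rw [hb, Subgroup.mem_bot, h.eq_one_iff] at h1
  exact u_notMem h1

theorem isNilpotent (h : M.IsModel π) : Group.IsNilpotent V :=
  Subgroup.nilpotent_iff_lowerCentralSeries.2 ⟨3, h.lcs_three⟩

theorem nilpotencyClass_eq (h : M.IsModel π) : Group.nilpotencyClass V = 3 := by
  have := h.isNilpotent
  apply le_antisymm
  · rw [← Subgroup.lowerCentralSeries_eq_bot_iff_nilpotencyClass_le]
    exact h.lcs_three
  · by_contra hlt
    have : Group.nilpotencyClass V ≤ 2 := by omega
    rw [← Subgroup.lowerCentralSeries_eq_bot_iff_nilpotencyClass_le] at this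
    exact h.lcs_two_ne this

theorem commutator_mem_lcs_two (a b c : V) : ⁅⁅a, b⁆, c⁆ ∈ lcs V 2 :=
  commutator_mem_lcs_succ (commutator_mem_lcs_one _ _) _

theorem x_cube_mem (h : M.IsModel π) : π x ^ 3 ∈ lcs V 2 := by
  rw [h.satisfied.x_cube]
  exact mul_mem (pow_mem (commutator_mem_lcs_two _ _ _) _)
    (pow_mem (commutator_mem_lcs_two _ _ _) _)

theorem y_cube_mem (h : M.IsModel π) : π y ^ 3 ∈ lcs V 2 := by
  rw [h.satisfied.y_cube]
  exact mul_mem (pow_mem (commutator_mem_lcs_two _ _ _) _)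
    (pow_mem (commutator_mem_lcs_two _ _ _) _)

theorem map_normalForm (π : FreeGroup (Fin 2) →* V) (e) :
    π (normalForm x y e) = normalForm (π x) (π y) e := by
  simp only [normalForm, map_mul, map_pow, map_commutatorElement]

theorem expo_normalForm (e : Fin 3 × Fin 3 × Fin 3 × Fin 3 × Fin 3) :
    expo 0 (normalForm x y e) = (e.1 : ℕ) ∧ expo 1 (normalForm x y e) = (e.2.1 : ℕ) := by
  have hs : s ∈ lcs (FreeGroup (Fin 2)) 1 := commutator_mem_lcs_one x y
  have h2 := lcs_antitone (G := FreeGroup (Fin 2)) one_le_two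
  have hu : u ∈ lcs (FreeGroup (Fin 2)) 1 := h2 (commutator_mem_lcs_succ hs x)
  have hv : v ∈ lcs (FreeGroup (Fin 2)) 1 := h2 (commutator_mem_lcs_succ hs y)
  have hc := mul_mem (pow_mem hs e.2.2.1) (mul_mem (pow_mem hu e.2.2.2.1) (pow_mem hv e.2.2.2.2))
  constructor <;>
  · rw [normalForm, expo_mul, expo_lcs _ hc, expo_mul, ← zpow_natCast, ← zpow_natCast, expo_zpow,
      expo_zpow, expo_of, expo_of]
    simp

theorem fin_eq_of_cast_eq {a b : Fin 3} (h : ((a : ℕ) : ZMod 3) = ((b : ℕ) : ZMod 3)) : a = b := by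
  revert a b; decide

/-- A quotient of two normal words in `J M` is compared in weights one, two and three in turn. At
the last stage a combination of `U` and `W` alone lies in the plane defining `J M` only if it is
zero. -/
theorem normalForm_injective (h : M.IsModel π) : Function.Injective (normalForm (π x) (π y)) := by
  rintro e e' hee
  rw [← map_normalForm, ← map_normalForm, ← inv_mul_eq_one, ← map_inv, ← map_mul,
    h.eq_one_iff] at hee
  obtain ⟨h0, h1⟩ := expo_normalForm e
  obtain ⟨h0', h1'⟩ := expo_normalForm e'
  obtain ⟨a, b, c, d, t⟩ := e
  obtain ⟨a', b', c', d', t'⟩ := e'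
  have hJ := hee
  obtain ⟨p, q, hL⟩ := hee
  obtain ⟨ha, hb⟩ := expo_eq_zero_of_lead (hL.weaken (by norm_num))
  rw [expo_mul, expo_inv, h0, h0', Int.cast_add, Int.cast_neg, neg_add_eq_zero] at ha
  rw [expo_mul, expo_inv, h1, h1', Int.cast_add, Int.cast_neg, neg_add_eq_zero] at hb
  have ha2 := fin_eq_of_cast_eq (by simpa using ha)
  have hb2 := fin_eq_of_cast_eq (by simpa using hb)
  subst ha2 hb2
  have e1 : (normalForm x y (a, b, c, d, t))⁻¹ * normalForm x y (a, b, c', d', t') =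
      (s ^ (c : ℕ) * (u ^ (d : ℕ) * v ^ (t : ℕ)))⁻¹ *
        (s ^ (c' : ℕ) * (u ^ (d' : ℕ) * v ^ (t' : ℕ))) := by
    simp only [normalForm]; group
  rw [e1] at hL hJ
  have l3 : ∀ d t : ℕ, Lead 3 (magnus (u ^ d * v ^ t)) ((d : ZMod 3) • U + (t : ZMod 3) • W) := by
    intro d t
    have := (lead_u.zpow' three_ne_zero d).mul three_ne_zero (lead_v.zpow' three_ne_zero t)
    simpa only [zpow_natCast, Int.cast_natCast, ← map_pow, ← map_mul] using this
  have l2 : ∀ c d t : ℕ, Lead 2 (magnus (s ^ c * (u ^ d * v ^ t))) ((c : ZMod 3) • S) := by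
    intro c d t
    have := (lead_s.zpow' two_ne_zero c).mul two_ne_zero ((l3 d t).weaken (by norm_num))
    simpa only [zpow_natCast, Int.cast_natCast, ← map_pow, ← map_mul, add_zero] using this
  have m2 := ((l2 c d t).inv two_ne_zero).mul two_ne_zero (l2 c' d' t')
  rw [← map_inv, ← map_mul] at m2
  have m2' := m2.unique (by norm_num) (hL.weaken (by norm_num))
  have m2'' := cf_S (-((c : ℕ) : ZMod 3) + ((c' : ℕ) : ZMod 3))
  rw [add_smul, neg_smul, m2', map_zero] at m2''
  have hc := fin_eq_of_cast_eq (neg_add_eq_zero.1 m2''.symm)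
  subst hc
  have e2 : (s ^ (c : ℕ) * (u ^ (d : ℕ) * v ^ (t : ℕ)))⁻¹ *
        (s ^ (c : ℕ) * (u ^ (d' : ℕ) * v ^ (t' : ℕ))) =
        (u ^ (d : ℕ) * v ^ (t : ℕ))⁻¹ * (u ^ (d' : ℕ) * v ^ (t' : ℕ)) := by
    group
  rw [e2] at hJ
  have m3 := ((l3 d t).inv three_ne_zero).mul three_ne_zero (l3 d' t')
  rw [← map_inv, ← map_mul] at m3
  have m3' : Lead 3 (magnus ((u ^ (d : ℕ) * v ^ (t : ℕ))⁻¹ * (u ^ (d' : ℕ) * v ^ (t' : ℕ))))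
      ((0 : ZMod 3) • P X + (0 : ZMod 3) • P Y + (-((d : ℕ) : ZMod 3) + ((d' : ℕ) : ZMod 3)) • U +
      (-((t : ℕ) : ZMod 3) + ((t' : ℕ) : ZMod 3)) • W) := by
    convert m3 using 1
    module
  have m4 := (mem_J_iff m3').1 hJ
  simp only [zero_mul, add_zero, neg_zero, neg_add_eq_zero] at m4
  rw [fin_eq_of_cast_eq m4.1, fin_eq_of_cast_eq m4.2]

theorem card_eq (h : M.IsModel π) : Nat.card V = 3 ^ 5 := by
  have h12 := lcs_antitone (G := V) one_le_two
  rw [← Nat.card_congr (Equiv.ofBijective _ ⟨h.normalForm_injective,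
    normalForm_surjective h.closure_eq h.lcs_three (h12 h.x_cube_mem) (h12 h.y_cube_mem)⟩)]
  simp

theorem finite (h : M.IsModel π) : Finite V :=
  Nat.finite_of_card_ne_zero (by rw [h.card_eq]; norm_num)

theorem isPGroup (h : M.IsModel π) : IsPGroup 3 V := IsPGroup.of_card h.card_eq

end IsModel

theorem isModel_mk (M : CubeShape) : M.IsModel (QuotientGroup.mk' (J M)) :=
  ⟨QuotientGroup.mk'_surjective _, QuotientGroup.ker_mk' _⟩

theorem card_quotient_le_of_surjective {V : Type*} [Group V] (hV : lcs V 3 = ⊥) {a b : V}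
    (hab : Subgroup.closure {a, b} = ⊤) (ha : a ^ 3 ∈ lcs V 1) (hb : b ^ 3 ∈ lcs V 1) :
    Finite V ∧ Nat.card V ≤ 3 ^ 5 := by
  have hs := normalForm_surjective hab hV ha hb
  have := Finite.of_surjective _ hs
  refine ⟨this, (Nat.card_le_card_of_surjective _ hs).trans ?_⟩
  simp

theorem injective_of_card {G H : Type*} [Group G] [Group H] (f : G →* H)
    (hf : Function.Surjective f) [Finite G] (hc : Nat.card G = Nat.card H) :
    Function.Injective f := by
  exact ((Nat.bijective_iff_surjective_and_card f).2 ⟨hf, hc⟩).1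

/-- The homomorphism from the free group with given images of the generators. -/
def liftPair {V : Type*} [Group V] (a b : V) : FreeGroup (Fin 2) →* V := FreeGroup.lift ![a, b]

@[simp] theorem liftPair_x {V : Type*} [Group V] (a b : V) : liftPair a b x = a := by
  simp [liftPair]

@[simp] theorem liftPair_y {V : Type*} [Group V] (a b : V) : liftPair a b y = b := by
  simp [liftPair]

theorem surjective_of_closure {V : Type*} [Group V] {φ : FreeGroup (Fin 2) →* V}
    (h : Subgroup.closure {φ x, φ y} = ⊤) : Function.Surjective φ := by
  rw [← MonoidHom.range_eq_top, eq_top_iff, ← h, Subgroup.closure_le]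
  rintro z (rfl | rfl)
  · exact ⟨x, rfl⟩
  · exact ⟨y, rfl⟩

/-- A group of order `243` satisfying the relations is presented by them. -/
theorem Satisfied.isModel {φ : FreeGroup (Fin 2) →* V} (h : M.Satisfied (φ x) (φ y))
    (hg : Subgroup.closure {φ x, φ y} = ⊤) (hV : Nat.card V = 3 ^ 5) : M.IsModel φ := by
  have hs := surjective_of_closure hg
  refine ⟨hs, le_antisymm ?_ h.J_le_ker⟩
  have hfin := (isModel_mk M).finite
  have hinj := injective_of_card (QuotientGroup.lift (J M) φ h.J_le_ker)
    (QuotientGroup.lift_surjective_of_surjective _ _ hs _)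
    (by rw [hV, (isModel_mk M).card_eq])
  intro f hf
  rw [← QuotientGroup.eq_one_iff]
  apply hinj
  rw [map_one]
  exact hf

theorem IsModel.nonempty_mulEquiv {V V' : Type*} [Group V] [Group V']
    {π : FreeGroup (Fin 2) →* V} {π' : FreeGroup (Fin 2) →* V'} (h : M.IsModel π)
    (h' : M.IsModel π') : Nonempty (V ≃* V') :=
  ⟨((QuotientGroup.quotientKerEquivOfSurjective π h.surjective).symm.trans
    (QuotientGroup.quotientMulEquivOfEq (h.ker_eq.trans h'.ker_eq.symm))).trans
    (QuotientGroup.quotientKerEquivOfSurjective π' h'.surjective)⟩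

theorem IsModel.comp_mulEquiv {V V' : Type*} [Group V] [Group V'] {π : FreeGroup (Fin 2) →* V}
    (h : M.IsModel π) (e : V ≃* V') : M.IsModel (e.toMonoidHom.comp π) :=
  ⟨e.surjective.comp h.surjective, by rw [← h.ker_eq]; ext f; simp [MonoidHom.mem_ker]⟩

/-- The shape of the cubes in `⟨243,5⟩`. -/
def shape5 : CubeShape := ⟨1, 0, 1, 0⟩

/-- The shape of the cubes in `⟨243,7⟩`. -/
def shape7 : CubeShape := ⟨1, 0, 0, 1⟩

/-- The relators hold in `F/J M`, and `Satisfied.J_le_ker` gives the reverse inclusion, so no order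
of the presented group needs to be known beforehand. -/
theorem isModel_presentedGroup (M : CubeShape) {w w' : FreeGroup (Fin 2)}
    (hw : w = u ^ M.α.val * v ^ M.β.val) (hw' : w' = u ^ M.γ.val * v ^ M.δ.val) :
    M.IsModel (PresentedGroup.mk (classThreeRelators ∪ {x ^ 3 * w⁻¹, y ^ 3 * w'⁻¹})) := by
  have hk : (PresentedGroup.mk (classThreeRelators ∪ {x ^ 3 * w⁻¹, y ^ 3 * w'⁻¹})).ker =
    Subgroup.normalClosure _ := QuotientGroup.ker_mk' _
  refine ⟨PresentedGroup.mk_surjective _, le_antisymm ?_ (Satisfied.J_le_ker ?_)⟩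
  · rw [hk]
    apply Subgroup.normalClosure_le_normal
    have h := (isModel_mk M).satisfied
    have e : ∀ {f}, QuotientGroup.mk' (J M) f = 1 → f ∈ J M := (QuotientGroup.eq_one_iff _).1
    have h1 := mul_inv_eq_one.2 h.x_cube
    have h2 := mul_inv_eq_one.2 h.y_cube
    have h3 := h.s_cube
    have h4 := h.u_cube
    have h5 := h.v_cube
    have h6 := h.ux
    have h7 := h.uy
    have h8 := h.vx
    have h9 := h.vy
    simp only [← map_commutatorElement, ← map_pow, ← map_mul, ← map_inv]
      at h1 h2 h3 h4 h5 h6 h7 h8 h9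
    rw [← hw] at h1
    rw [← hw'] at h2
    rintro f ((rfl | rfl | rfl | rfl | rfl | rfl | rfl) | rfl | rfl)
    exacts [e h3, e h4, e h5, e h6, e h7, e h8, e h9, e h1, e h2]
  · have e : ∀ {f}, f ∈ classThreeRelators ∪ {x ^ 3 * w⁻¹, y ^ 3 * w'⁻¹} →
        PresentedGroup.mk (classThreeRelators ∪ {x ^ 3 * w⁻¹, y ^ 3 * w'⁻¹}) f = 1 :=
      PresentedGroup.one_of_mem
    refine ⟨?_, ?_, ?_, ?_, ?_, ?_, ?_, ?_, ?_⟩ <;>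
    simp only [← map_commutatorElement, ← map_pow, ← map_mul]
    case refine_8 =>
      rw [← hw, ← mul_inv_eq_one, ← map_inv, ← map_mul]
      exact e (by simp)
    case refine_9 =>
      rw [← hw', ← mul_inv_eq_one, ← map_inv, ← map_mul]
      exact e (by simp)
    all_goals exact e (Or.inl (by simp [classThreeRelators]))

theorem isModel_G243_5 : shape5.IsModel (PresentedGroup.mk _ : _ →* G243_5) :=
  isModel_presentedGroup shape5 (by simp [shape5, ZMod.val_one]) (by simp [shape5, ZMod.val_one])

theorem isModel_G243_7 : shape7.IsModel (PresentedGroup.mk _ : _ →* G243_7) :=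
  isModel_presentedGroup shape7 (by simp [shape7, ZMod.val_one]) (by simp [shape7, ZMod.val_one])

theorem nonempty_mulEquiv_iff {V V' : Type*} [Group V] [Group V'] {π' : FreeGroup (Fin 2) →* V'}
    (h' : M.IsModel π') : Nonempty (V ≃* V') ↔ ∃ π : FreeGroup (Fin 2) →* V, M.IsModel π :=
  ⟨fun ⟨e⟩ => ⟨_, h'.comp_mulEquiv e.symm⟩, fun ⟨_, h⟩ => h.nonempty_mulEquiv h'⟩

end CubeShape

/-! ### Descendants, and commutator identities with central commutators of weight four -/

namespace TwoGenerated

open Subgroup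

section Class

variable {G : Type*} [Group G]

theorem nilpotencyClass_eq_succ {n : ℕ} (h : lcs G (n + 1) = ⊥) (h' : lcs G n ≠ ⊥) :
    Group.nilpotencyClass G = n + 1 := by
  have : Group.IsNilpotent G := Subgroup.nilpotent_iff_lowerCentralSeries.2 ⟨n + 1, h⟩
  apply le_antisymm
  · rwa [← Subgroup.lowerCentralSeries_eq_bot_iff_nilpotencyClass_le]
  · by_contra hlt
    have : Group.nilpotencyClass G ≤ n := by omega
    rw [← Subgroup.lowerCentralSeries_eq_bot_iff_nilpotencyClass_le] at this
    exact h' this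

theorem lcs_stable {n : ℕ} (h : lcs G n ≤ lcs G (n + 1)) (k : ℕ) : lcs G n ≤ lcs G (n + k) := by
  induction k with
  | zero => exact le_rfl
  | succ k ih =>
    refine h.trans ?_
    rw [lcs_succ_le_iff]
    intro g hg z
    exact commutator_mem_lcs_succ (ih hg) z

theorem lcs_eq_bot_of_le_succ [Group.IsNilpotent G] {n : ℕ} (h : lcs G n ≤ lcs G (n + 1)) :
    lcs G n = ⊥ := by
  obtain ⟨m, hm⟩ := Subgroup.nilpotent_iff_lowerCentralSeries.1 ‹Group.IsNilpotent G›
  rw [eq_bot_iff, ← hm]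
  exact (lcs_stable h m).trans (lcs_antitone (by omega))

theorem lcs_le_ker_iff {H : Type*} [Group H] (f : G →* H) (hf : Function.Surjective f) (n : ℕ) :
    lcs G n ≤ f.ker ↔ lcs H n = ⊥ := by
  rw [← map_lcs f hf, Subgroup.map_eq_bot_iff]

/-- An immediate descendant of a group of class `n + 1` has class `n + 2`. -/
theorem descendant_lcs {U V : Type} [Group U] [Group V] [Group.IsNilpotent U] {n : ℕ}
    (hV : lcs V (n + 1) = ⊥) (hV' : lcs V n ≠ ⊥) (h : IsImmediateDescendant U V) :
    lcs U (n + 2) = ⊥ ∧ lcs U (n + 1) ≠ ⊥ ∧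
      ∃ f : U →* V, Function.Surjective f ∧ f.ker = lcs U (n + 1) := by
  obtain ⟨h2, ⟨e⟩⟩ := h
  set c := Group.nilpotencyClass U with hc
  have hcc : lcs U c = ⊥ := Subgroup.lowerCentralSeries_eq_bot_iff_nilpotencyClass_le.2 hc.symm.le
  have hc1 : lcs U (c - 1) ≠ ⊥ := fun hb => by
    have := Subgroup.lowerCentralSeries_eq_bot_iff_nilpotencyClass_le.1 hb
    omega
  let f : U →* V := e.toMonoidHom.comp (QuotientGroup.mk' (lcs U (c - 1)))
  have hf : Function.Surjective f := e.surjective.comp (QuotientGroup.mk'_surjective _)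
  have hk : f.ker = lcs U (c - 1) := by
    ext z
    simp [f]
  have k1 := (lcs_le_ker_iff f hf (n + 1)).2 hV
  have k2 := mt (lcs_le_ker_iff f hf n).1 hV'
  rw [hk] at k1 k2
  have k3 : n + 1 ≤ c - 1 := by
    by_contra hlt
    exact k2 (lcs_antitone (by omega))
  -- Otherwise the series of `U` would be stationary from `lcs U (n + 1)` on, hence trivial there by
  -- nilpotency, although `lcs U (c - 1)` is nontrivial.
  have k4 : c - 1 = n + 1 := by
    by_contra hne
    have : lcs U (n + 1) = ⊥ := lcs_eq_bot_of_le_succ (k1.trans (lcs_antitone (by omega)))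
    rw [this, le_bot_iff.1 ((lcs_antitone k3).trans this.le)] at k1
    exact hc1 (le_bot_iff.1 ((lcs_antitone k3).trans this.le))
  have k5 : c = n + 2 := by omega
  rw [k5] at hcc
  rw [k4] at hk hc1
  exact ⟨hcc, hc1, f, hf, hk⟩

theorem isImmediateDescendant_of_lcs {U V : Type} [Group U] [Group V] {n : ℕ}
    (h : lcs U (n + 2) = ⊥) (h' : lcs U (n + 1) ≠ ⊥) (f : U →* V) (hf : Function.Surjective f)
    (hk : f.ker = lcs U (n + 1)) : IsImmediateDescendant U V := by
  have hc : Group.nilpotencyClass U = n + 2 := nilpotencyClass_eq_succ h h'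
  have hk' : lcs U (Group.nilpotencyClass U - 1) = f.ker := by rw [hk, hc]; rfl
  exact ⟨by omega, ⟨(QuotientGroup.quotientMulEquivOfEq hk').trans
    (QuotientGroup.quotientKerEquivOfSurjective f hf)⟩⟩

theorem closure_eq_top_of_map [Group.IsNilpotent G] {H : Type*} [Group H] {f : G →* H} {x y : G}
    (hf : f.ker ≤ lcs G 1) (h : closure {f x, f y} = ⊤) : closure {x, y} = ⊤ := by
  apply eq_top_of_sup_lcs_one
  rw [eq_top_iff]
  intro g _
  have hg : f g ∈ (closure {x, y}).map f := by
    rw [MonoidHom.map_closure, Set.image_pair, h]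
    trivial
  obtain ⟨g', hg', he⟩ := hg
  have h1 : g'⁻¹ * g ∈ lcs G 1 := hf (by rw [MonoidHom.mem_ker, map_mul, map_inv, he]; simp)
  have h2 : g = g' * (g'⁻¹ * g) := by group
  rw [h2]
  exact mul_mem (mem_sup_left hg') (mem_sup_right h1)

end Class

section Central

variable {E : Type*} [Group E] {x y : E}

/-- Conjugation by `g` multiplies `a` and `b` by central elements, which does not change their
commutator. -/
theorem commute_commutator_of_central {g a b : E} (ha : ⁅g, a⁆ ∈ center E)
    (hb : ⁅g, b⁆ ∈ center E) : Commute g ⁅a, b⁆ := by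
  have h : g * ⁅a, b⁆ * g⁻¹ = ⁅a, b⁆ := by
    have e1 : g * a * g⁻¹ = a * ⁅g, a⁆ := by
      rw [← mem_center_iff.1 ha a |>.symm, commutatorElement_def]; group
    have e2 : g * b * g⁻¹ = b * ⁅g, b⁆ := by
      rw [← mem_center_iff.1 hb b |>.symm, commutatorElement_def]; group
    rw [conjugate_commutatorElement, e1, e2]
    exact commutatorElement_mul_central ha hb
  rw [Commute, SemiconjBy]
  calc g * ⁅a, b⁆ = g * ⁅a, b⁆ * g⁻¹ * g := by group
    _ = _ := by rw [h]

/-- The commutators of weight four are central. -/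
structure CentralFour (x y : E) : Prop where
  ux : ⁅⁅⁅y, x⁆, x⁆, x⁆ ∈ center E
  uy : ⁅⁅⁅y, x⁆, x⁆, y⁆ ∈ center E
  vx : ⁅⁅⁅y, x⁆, y⁆, x⁆ ∈ center E
  vy : ⁅⁅⁅y, x⁆, y⁆, y⁆ ∈ center E

namespace CentralFour

theorem us (h : CentralFour x y) : Commute ⁅⁅y, x⁆, x⁆ ⁅y, x⁆ :=
  commute_commutator_of_central h.uy h.ux

theorem vs (h : CentralFour x y) : Commute ⁅⁅y, x⁆, y⁆ ⁅y, x⁆ :=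
  commute_commutator_of_central h.vy h.vx

theorem vu (h : CentralFour x y) : Commute ⁅⁅y, x⁆, y⁆ ⁅⁅y, x⁆, x⁆ :=
  commute_commutator_of_central
    (by rw [commutatorElement_eq_one_iff_mul_comm.2 h.vs]; exact one_mem _) h.vx

theorem conj_x (x s : E) : x * s * x⁻¹ = ⁅s, x⁆⁻¹ * s := by
  rw [commutatorElement_def]; group

/-- A form of the Hall–Witt identity. Since `yx = s·xy`, the conjugates of `s` by `yx` and by `xy`
differ by conjugation with `s`, which acts trivially on the latter. Expanding both conjugates leaves
the two commutators. -/
theorem uy_eq_vx (h : CentralFour x y) : ⁅⁅⁅y, x⁆, x⁆, y⁆ = ⁅⁅⁅y, x⁆, y⁆, x⁆ := by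
  have h1 := h.us
  have h2 := h.vs
  have h3 := h.vu
  have hb := h.uy
  have hb' := h.vx
  have e0 : y * x = ⁅y, x⁆ * (x * y) := by rw [commutatorElement_def]; group
  have e1 := conj_x x ⁅y, x⁆
  have e2 := conj_x y ⁅y, x⁆
  have e3 := conj_x y ⁅⁅y, x⁆, x⁆
  have e4 := conj_x x ⁅⁅y, x⁆, y⁆
  generalize ⁅⁅⁅y, x⁆, x⁆, y⁆ = b at *
  generalize ⁅⁅⁅y, x⁆, y⁆, x⁆ = b' at *
  generalize ⁅⁅y, x⁆, x⁆ = u at *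
  generalize ⁅⁅y, x⁆, y⁆ = v at *
  generalize ⁅y, x⁆ = s at *
  have f1 : (y * x) * s * (y * x)⁻¹ = u⁻¹ * b * (v⁻¹ * s) := by
    calc (y * x) * s * (y * x)⁻¹ = y * (x * s * x⁻¹) * y⁻¹ := by group
      _ = (y * u * y⁻¹)⁻¹ * (y * s * y⁻¹) := by rw [e1]; group
      _ = _ := by rw [e2, e3]; group
  have f2 : (x * y) * s * (x * y)⁻¹ = v⁻¹ * b' * (u⁻¹ * s) := by
    calc (x * y) * s * (x * y)⁻¹ = x * (y * s * y⁻¹) * x⁻¹ := by group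
      _ = (x * v * x⁻¹)⁻¹ * (x * s * x⁻¹) := by rw [e2]; group
      _ = _ := by rw [e1, e4]; group
  have f3 : s * (v⁻¹ * b' * (u⁻¹ * s)) * s⁻¹ = v⁻¹ * b' * (u⁻¹ * s) := by
    have c1 : s * v⁻¹ = v⁻¹ * s := h2.inv_left.eq.symm
    have c2 : s * b' = b' * s := mem_center_iff.1 hb' s
    have c3 : s * u⁻¹ = u⁻¹ * s := h1.inv_left.eq.symm
    calc _ = (s * v⁻¹) * b' * u⁻¹ := by group
      _ = v⁻¹ * (s * b') * u⁻¹ := by rw [c1]; group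
      _ = v⁻¹ * b' * (s * u⁻¹) := by rw [c2]; group
      _ = _ := by rw [c3]
  have f4 : u⁻¹ * b * (v⁻¹ * s) = v⁻¹ * b' * (u⁻¹ * s) := by
    rw [← f3, ← f2, ← f1, e0]; group
  have c1 : u⁻¹ * b = b * u⁻¹ := mem_center_iff.1 hb _
  have c2 : v⁻¹ * b' = b' * v⁻¹ := mem_center_iff.1 hb' _
  have c3 : v⁻¹ * u⁻¹ = u⁻¹ * v⁻¹ := h3.inv_inv.eq
  rw [c1, c2] at f4
  have f5 : b * (u⁻¹ * v⁻¹ * s) = b' * (u⁻¹ * v⁻¹ * s) := by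
    calc b * (u⁻¹ * v⁻¹ * s) = b * u⁻¹ * (v⁻¹ * s) := by simp only [mul_assoc]
      _ = b' * (v⁻¹ * u⁻¹ * s) := by rw [f4]; simp only [mul_assoc]
      _ = _ := by rw [c3]
  exact mul_right_cancel f5

/-- `⁅y³, x⁆` is the product of the conjugates of `s` by `y²`, `y` and `1`, where conjugation by `y`
sends `s` to `v⁻¹s` and `v` to `⁅v, y⁆⁻¹v`. -/
theorem y_cube (h : CentralFour x y) :
    ⁅y ^ 3, x⁆ = ⁅⁅⁅y, x⁆, y⁆, y⁆ * (⁅⁅y, x⁆, y⁆ ^ 3)⁻¹ * ⁅y, x⁆ ^ 3 := by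
  have h2 := h.vs
  have hc := h.vy
  have e0 : ⁅y ^ 3, x⁆ = y * (y * ⁅y, x⁆ * y⁻¹) * y⁻¹ * (y * ⁅y, x⁆ * y⁻¹) * ⁅y, x⁆ := by
    simp only [commutatorElement_def, pow_succ, pow_zero, one_mul]; group
  have e2 := conj_x y ⁅y, x⁆
  have e3 := conj_x y ⁅⁅y, x⁆, y⁆
  rw [e0]
  generalize ⁅⁅⁅y, x⁆, y⁆, y⁆ = c at *
  generalize ⁅⁅y, x⁆, y⁆ = v at *
  generalize ⁅y, x⁆ = s at *
  have c1 : s * v⁻¹ = v⁻¹ * s := h2.inv_left.eq.symm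
  have c2 : v⁻¹ * c = c * v⁻¹ := mem_center_iff.1 hc _
  rw [e2]
  have c1' : ∀ t, s * (v⁻¹ * t) = v⁻¹ * (s * t) := fun t => by
    rw [← mul_assoc, c1, mul_assoc]
  have c2' : ∀ t, v⁻¹ * (c * t) = c * (v⁻¹ * t) := fun t => by
    rw [← mul_assoc, c2, mul_assoc]
  calc y * (v⁻¹ * s) * y⁻¹ * (v⁻¹ * s) * s
      = (y * v * y⁻¹)⁻¹ * (y * s * y⁻¹) * (v⁻¹ * s) * s := by group
    _ = v⁻¹ * c * v⁻¹ * s * v⁻¹ * s * s := by rw [e2, e3]; group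
    _ = _ := by simp only [pow_succ, pow_zero, one_mul, mul_assoc, mul_inv_rev, c1', c2']

theorem x_cube (h : CentralFour x y) :
    ⁅y, x ^ 3⁆ = ⁅⁅⁅y, x⁆, x⁆, x⁆ * (⁅⁅y, x⁆, x⁆ ^ 3)⁻¹ * ⁅y, x⁆ ^ 3 := by
  have h2 := h.us
  have hc := h.ux
  have e0 : ⁅y, x ^ 3⁆ = ⁅y, x⁆ * (x * ⁅y, x⁆ * x⁻¹) * (x * (x * ⁅y, x⁆ * x⁻¹) * x⁻¹) := by
    simp only [commutatorElement_def, pow_succ, pow_zero, one_mul]; group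
  have e2 := conj_x x ⁅y, x⁆
  have e3 := conj_x x ⁅⁅y, x⁆, x⁆
  rw [e0]
  generalize ⁅⁅⁅y, x⁆, x⁆, x⁆ = c at *
  generalize ⁅⁅y, x⁆, x⁆ = v at *
  generalize ⁅y, x⁆ = s at *
  have c1 : s * v⁻¹ = v⁻¹ * s := h2.inv_left.eq.symm
  have c2 : v⁻¹ * c = c * v⁻¹ := mem_center_iff.1 hc _
  have c1' : ∀ t, s * (v⁻¹ * t) = v⁻¹ * (s * t) := fun t => by
    rw [← mul_assoc, c1, mul_assoc]
  have c2' : ∀ t, v⁻¹ * (c * t) = c * (v⁻¹ * t) := fun t => by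
    rw [← mul_assoc, c2, mul_assoc]
  have c3 : ∀ t, s * (c * t) = c * (s * t) := fun t => by
    rw [← mul_assoc, mem_center_iff.1 hc, mul_assoc]
  rw [e2]
  calc s * (v⁻¹ * s) * (x * (v⁻¹ * s) * x⁻¹)
      = s * v⁻¹ * s * (x * v * x⁻¹)⁻¹ * (x * s * x⁻¹) := by group
    _ = s * v⁻¹ * s * v⁻¹ * c * v⁻¹ * s := by rw [e2, e3]; group
    _ = _ := by simp only [pow_succ, pow_zero, one_mul, mul_assoc, mul_inv_rev, c1', c2', c3]

theorem u_cube (h : CentralFour x y) (hs : ⁅y, x⁆ ^ 3 ∈ center E) : ⁅⁅y, x⁆, x⁆ ^ 3 = 1 := by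
  rw [← commutatorElement_pow_left h.us, commutatorElement_eq_one_iff_mul_comm]
  exact (mem_center_iff.1 hs _).symm

theorem v_cube (h : CentralFour x y) (hs : ⁅y, x⁆ ^ 3 ∈ center E) : ⁅⁅y, x⁆, y⁆ ^ 3 = 1 := by
  rw [← commutatorElement_pow_left h.vs, commutatorElement_eq_one_iff_mul_comm]
  exact (mem_center_iff.1 hs _).symm

end CentralFour

theorem commutator_congr_left {a b c : E} (h : a * b⁻¹ ∈ center E) : ⁅a, c⁆ = ⁅b, c⁆ := by
  have : a = b * (a * b⁻¹) := by rw [mem_center_iff.1 h]; group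
  rw [this]
  simpa using commutatorElement_mul_central (a := b) (b := c) h (one_mem _)

theorem commutator_congr_right {a b c : E} (h : a * b⁻¹ ∈ center E) : ⁅c, a⁆ = ⁅c, b⁆ := by
  rw [← commutatorElement_inv, commutator_congr_left h, commutatorElement_inv]

end Central

end TwoGenerated

/-! ### Rigidity of the two Schur shapes, and the dichotomy for all shapes -/

namespace CubeShape

open Magnus SmallGroups TwoGenerated

/-- The relations hold modulo the center. -/
structure SatisfiedMod (M : CubeShape) {E : Type*} [Group E] (x y : E) : Prop where
  central : CentralFour x y
  s_cube : ⁅y, x⁆ ^ 3 ∈ Subgroup.center E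
  x_cube : x ^ 3 * (⁅⁅y, x⁆, x⁆ ^ M.α.val * ⁅⁅y, x⁆, y⁆ ^ M.β.val)⁻¹ ∈ Subgroup.center E
  y_cube : y ^ 3 * (⁅⁅y, x⁆, x⁆ ^ M.γ.val * ⁅⁅y, x⁆, y⁆ ^ M.δ.val)⁻¹ ∈ Subgroup.center E

theorem Satisfied.satisfiedMod {M : CubeShape} {E V : Type*} [Group E] [Group V] {x y : E}
    {f : E →* V} (hf : f.ker ≤ Subgroup.center E) (h : M.Satisfied (f x) (f y)) :
    M.SatisfiedMod x y := by
  have e : ∀ {z}, f z = 1 → z ∈ Subgroup.center E := fun hz => hf hz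
  refine ⟨⟨e ?_, e ?_, e ?_, e ?_⟩, e ?_, e ?_, e ?_⟩ <;>
    simp only [map_commutatorElement, map_pow, map_mul, map_inv, mul_inv_eq_one]
  exacts [h.ux, h.uy, h.vx, h.vy, h.s_cube, h.x_cube, h.y_cube]

/-- The conclusion that the commutators of weight four and the cube of `s` are trivial. -/
def Rigid {E : Type*} [Group E] (x y : E) : Prop :=
  ⁅y, x⁆ ^ 3 = 1 ∧ ⁅⁅⁅y, x⁆, x⁆, x⁆ = 1 ∧ ⁅⁅⁅y, x⁆, x⁆, y⁆ = 1 ∧ ⁅⁅⁅y, x⁆, y⁆, x⁆ = 1 ∧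
    ⁅⁅⁅y, x⁆, y⁆, y⁆ = 1

/-- Modulo the center `x³ = u = y³`, so `⁅u, x⁆ = ⁅x³, x⁆ = 1` and `⁅u, y⁆ = ⁅y³, y⁆ = 1`. The
expansion of `⁅y, x³⁆ = ⁅y, u⁆` then gives `s³ = 1`, and that of `⁅y³, x⁆ = ⁅u, x⁆` gives `⁅v, y⁆ =
1`. -/
theorem SatisfiedMod.rigid_shape5 {E : Type*} [Group E] {x y : E} (h : shape5.SatisfiedMod x y) :
    Rigid x y := by
  have hx := h.x_cube
  have hy := h.y_cube
  simp only [shape5, ZMod.val_one, ZMod.val_zero, pow_one, pow_zero, mul_one] at hx hy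
  have a1 := (commutator_congr_left (c := x) hx).symm
  have b1 := (commutator_congr_left (c := y) hy).symm
  have c1 := (commutator_congr_left (c := x) hy)
  have d1 := (commutator_congr_right (c := y) hx)
  have e3 : ∀ z : E, ⁅z ^ 3, z⁆ = 1 := fun z =>
    commutatorElement_eq_one_iff_mul_comm.2 ((Commute.refl z).pow_left 3)
  rw [e3] at a1 b1
  rw [h.central.y_cube, h.central.v_cube h.s_cube, a1] at c1
  rw [h.central.x_cube, h.central.u_cube h.s_cube, a1, ← commutatorElement_inv ⁅⁅y, x⁆, x⁆ y, b1] at d1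
  have b2 := h.central.uy_eq_vx
  rw [b1] at b2
  simp only [inv_one, one_mul, mul_one] at c1 d1
  rw [d1, mul_one] at c1
  exact ⟨d1, a1, b1, b2.symm, c1⟩

/-- Modulo the center `x³ = u` and `y³ = v`, so `⁅u, x⁆ = ⁅v, y⁆ = 1`. Expanding `⁅y³, x⁆` and `⁅y,
x³⁆` identifies `s³` both with `⁅u, y⁆` and with its inverse; the absence of 2-torsion finishes. -/
theorem SatisfiedMod.rigid_shape7 {E : Type*} [Group E] {x y : E} (h : shape7.SatisfiedMod x y)
    (hE : ∀ z : E, z ^ 2 = 1 → z = 1) : Rigid x y := by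
  have hx := h.x_cube
  have hy := h.y_cube
  simp only [shape7, ZMod.val_one, ZMod.val_zero, pow_one, pow_zero, mul_one, one_mul] at hx hy
  have a1 := (commutator_congr_left (c := x) hx).symm
  have b1 := (commutator_congr_left (c := y) hy).symm
  have c1 := (commutator_congr_left (c := x) hy)
  have d1 := (commutator_congr_right (c := y) hx)
  have e3 : ∀ z : E, ⁅z ^ 3, z⁆ = 1 := fun z =>
    commutatorElement_eq_one_iff_mul_comm.2 ((Commute.refl z).pow_left 3)
  rw [e3] at a1 b1
  rw [h.central.y_cube, h.central.v_cube h.s_cube, b1, ← h.central.uy_eq_vx] at c1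
  rw [h.central.x_cube, h.central.u_cube h.s_cube, a1, ← commutatorElement_inv ⁅⁅y, x⁆, x⁆ y] at d1
  simp only [inv_one, one_mul, mul_one] at c1 d1
  have b2 := h.central.uy_eq_vx
  have b3 : ⁅⁅⁅y, x⁆, x⁆, y⁆ = 1 := by
    apply hE
    rw [pow_two]
    nth_rewrite 1 [← c1, d1]
    exact inv_mul_cancel _
  rw [b3] at b2 c1
  exact ⟨c1, a1, b3, b2.symm, b1⟩

/-- One of the two shapes of Schur type. -/
def IsSchurShape (M : CubeShape) : Prop := M = shape5 ∨ M = shape7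

theorem SatisfiedMod.rigid {M : CubeShape} (hM : M.IsSchurShape) {E : Type*} [Group E] {x y : E}
    (h : M.SatisfiedMod x y) (hE : ∀ z : E, z ^ 2 = 1 → z = 1) : Rigid x y := by
  rcases hM with rfl | rfl
  exacts [h.rigid_shape5, h.rigid_shape7 hE]

theorem eq_one_of_sq_eq_one {E : Type*} [Group E] (hE : IsPGroup 3 E) (z : E) (hz : z ^ 2 = 1) :
    z = 1 := by
  obtain ⟨k, hk⟩ := hE z
  have h1 := orderOf_dvd_of_pow_eq_one hz
  have h2 := orderOf_dvd_of_pow_eq_one hk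
  rw [← orderOf_eq_one_iff]
  exact Nat.eq_one_of_dvd_coprimes (Nat.Coprime.pow_right k (by norm_num)) h1 h2

variable {M : CubeShape} {V : Type*} [Group V] {π : FreeGroup (Fin 2) →* V}

/-- The kernel is central because `lcs E 4` is trivial. Lifted generators therefore satisfy the
relations modulo the center, and rigidity applies. -/
theorem IsModel.lcs_three_eq_bot_of_extension (hM : M.IsSchurShape) (h : M.IsModel π) {E : Type*}
    [Group E] (hE : ∀ z : E, z ^ 2 = 1 → z = 1) (h4 : lcs E 4 = ⊥) {f : E →* V}
    (hf : Function.Surjective f) (hk : f.ker = lcs E 3) : lcs E 3 = ⊥ := by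
  have : Group.IsNilpotent E := Subgroup.nilpotent_iff_lowerCentralSeries.2 ⟨4, h4⟩
  have hc : lcs E 3 ≤ Subgroup.center E := by
    intro z hz
    rw [Subgroup.mem_center_iff]
    intro w
    rw [← commutatorElement_eq_one_iff_mul_comm, ← Subgroup.mem_bot, ← h4]
    exact commutator_mem_lcs_succ' hz w
  obtain ⟨a, ha⟩ := hf (π x)
  obtain ⟨b, hb⟩ := hf (π y)
  have hab : Subgroup.closure {a, b} = ⊤ := by
    apply closure_eq_top_of_map (f := f)
    · rw [hk]; exact lcs_antitone (by norm_num)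
    · rw [ha, hb, h.closure_eq]
  have hs := h.satisfied
  rw [← ha, ← hb] at hs
  obtain ⟨-, h1, h2, h3, h5⟩ := (hs.satisfiedMod (hk.trans_le hc)).rigid hM hE
  rw [eq_bot_iff]
  apply lcs_three_le hab <;> rw [Subgroup.mem_bot] <;> assumption

theorem IsModel.isTerminal {V : Type} [Group V] {π : FreeGroup (Fin 2) →* V}
    (hM : M.IsSchurShape) (h : M.IsModel π) : IsTerminal 3 V := by
  intro U _ _ hU hd
  have : Fact (Nat.Prime 3) := ⟨Nat.prime_three⟩
  have := hU.isNilpotent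
  obtain ⟨h4, h3, f, hf, hk⟩ := descendant_lcs h.lcs_three h.lcs_two_ne hd
  exact h3 (h.lcs_three_eq_bot_of_extension hM (eq_one_of_sq_eq_one hU) h4 hf hk)

/-- A linear form on the commutators of weight four and the cube of `s` that is compatible with the
relations of shape `M`. -/
structure Descent (M : CubeShape) (a b c e : ZMod 3) : Prop where
  ne : a ≠ 0 ∨ b ≠ 0 ∨ c ≠ 0
  xx : M.α * a + M.β * b = 0
  yy : M.γ * b + M.δ * c = 0
  yx : e + a + M.α * b + M.β * c = 0
  xy : e + c - M.γ * a - M.δ * b = 0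

/-- Settled by evaluation over the 81 shapes. The first alternative leads to terminal groups, the
second to capable ones. -/
theorem exists_isBaseChange_or_descent (M : CubeShape) :
    (∃ i j k l : ZMod 3, i * l - j * k ≠ 0 ∧
      (CubeShape.IsBaseChange M shape5 i j k l ∨ CubeShape.IsBaseChange M shape7 i j k l)) ∨
    ∃ a b c e : ZMod 3, Descent M a b c e := by
  obtain ⟨α, β, γ, δ⟩ := M
  have key : ∀ α β γ δ : ZMod 3, (∃ i j k l : ZMod 3, i * l - j * k ≠ 0 ∧
      (CubeShape.IsBaseChange ⟨α, β, γ, δ⟩ shape5 i j k l ∨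
        CubeShape.IsBaseChange ⟨α, β, γ, δ⟩ shape7 i j k l)) ∨
      ∃ a b c e : ZMod 3, (a ≠ 0 ∨ b ≠ 0 ∨ c ≠ 0) ∧ α * a + β * b = 0 ∧ γ * b + δ * c = 0 ∧
        e + a + α * b + β * c = 0 ∧ e + c - γ * a - δ * b = 0 := by
    simp only [CubeShape.IsBaseChange, shape5, shape7]
    decide +kernel
  rcases key α β γ δ with h | ⟨a, b, c, e, h1, h2, h3, h4, h5⟩
  · exact Or.inl h
  · exact Or.inr ⟨a, b, c, e, h1, h2, h3, h4, h5⟩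

theorem not_isBaseChange_shape7_shape5 {i j k l : ZMod 3} (h : i * l - j * k ≠ 0) :
    ¬ CubeShape.IsBaseChange shape7 shape5 i j k l := by
  simp only [CubeShape.IsBaseChange, shape5, shape7]
  revert i j k l
  decide +kernel

/-- The generators of the second model are expressed in the first. A vanishing determinant would
remove the leading term of `⁅g, f⁆` and make the image of `u` in the second model trivial. -/
theorem IsModel.exists_isBaseChange {M' : CubeShape} {π' : FreeGroup (Fin 2) →* V}
    (h : M.IsModel π) (h' : M'.IsModel π') :
    ∃ i j k l : ZMod 3, i * l - j * k ≠ 0 ∧ CubeShape.IsBaseChange M M' i j k l := by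
  obtain ⟨f, hf⟩ := h.surjective (π' x)
  obtain ⟨g, hg⟩ := h.surjective (π' y)
  have hs := h'.satisfied
  rw [← hf, ← hg] at hs
  refine ⟨_, _, _, _, fun hd => ?_, (satisfied_iff h.ker_eq (lead_one f) (lead_one g)).1 hs⟩
  have h2 := lead_bracket (lead_one f) (lead_one g)
  rw [hd] at h2
  have h3 := lead_bracket_three h2 (lead_one f)
  simp only [zero_mul, zero_smul, add_zero] at h3
  have h4 : π ⁅⁅g, f⁆, f⁆ = 1 := h.eq_one_iff.2 (mem_J_of_lead_zero h3)
  rw [map_commutatorElement, map_commutatorElement, hf, hg, ← map_commutatorElement,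
    ← map_commutatorElement, h'.eq_one_iff] at h4
  exact u_notMem h4

/-- Cramer's rule, written multiplicatively; a nonzero determinant modulo three is its own inverse,
hence the outer exponent. -/
theorem mem_closure_of_det {A : Type*} [CommGroup A] {a b : A} (ha : a ^ 3 = 1) (hb : b ^ 3 = 1)
    {i j k l : ℤ} (hd : ((i * l - j * k : ℤ) : ZMod 3) ≠ 0) (H : Subgroup A)
    (h1 : a ^ i * b ^ j ∈ H) (h2 : a ^ k * b ^ l ∈ H) : a ∈ H ∧ b ∈ H := by
  have h3 : ∀ t : ZMod 3, t ≠ 0 → t * t = 1 := by decide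
  have h4 := h3 _ hd
  constructor
  · have e : ((a ^ i * b ^ j) ^ l * (a ^ k * b ^ l) ^ (-j)) ^ (i * l - j * k) = a := by
      rw [mul_zpow (a ^ i), mul_zpow (a ^ k), mul_mul_mul_comm, ← zpow_mul, ← zpow_mul, ← zpow_mul, ← zpow_mul,
        ← zpow_add, ← zpow_add]
      have : j * l + l * -j = 0 := by ring
      rw [this, zpow_zero, mul_one, ← zpow_mul, zpow_eq_of_cast_eq ha (b := 1), zpow_one]
      rw [Int.cast_one, ← h4, ← Int.cast_mul]
      congr 1; ring
    rw [← e]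
    exact zpow_mem (mul_mem (zpow_mem h1 _) (zpow_mem h2 _)) _
  · have e : ((a ^ i * b ^ j) ^ (-k) * (a ^ k * b ^ l) ^ i) ^ (i * l - j * k) = b := by
      rw [mul_zpow (a ^ i), mul_zpow (a ^ k), mul_mul_mul_comm, ← zpow_mul, ← zpow_mul, ← zpow_mul, ← zpow_mul,
        ← zpow_add, ← zpow_add]
      have : i * -k + k * i = 0 := by ring
      rw [this, zpow_zero, one_mul, ← zpow_mul, zpow_eq_of_cast_eq hb (b := 1), zpow_one]
      rw [Int.cast_one, ← h4, ← Int.cast_mul]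
      congr 1; ring
    rw [← e]
    exact zpow_mem (mul_mem (zpow_mem h1 _) (zpow_mem h2 _)) _

theorem closure_eq_top_of_det [Group.IsNilpotent V] {a b : V} (hab : Subgroup.closure {a, b} = ⊤)
    (ha : a ^ 3 ∈ lcs V 1) (hb : b ^ 3 ∈ lcs V 1) {i j k l : ℤ}
    (hd : ((i * l - j * k : ℤ) : ZMod 3) ≠ 0) :
    Subgroup.closure {a ^ i * b ^ j, a ^ k * b ^ l} = ⊤ := by
  have hl : lcs V 1 = commutator V := Subgroup.top_lowerCentralSeries_one
  have e : ∀ z ∈ lcs V 1, Abelianization.of z = 1 := fun z hz => by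
    rw [hl] at hz
    exact (QuotientGroup.eq_one_iff z).2 hz
  apply closure_eq_top_of_map (f := Abelianization.of)
  · rw [Abelianization.ker_of, hl]
  · have h1 := mem_closure_of_det (a := Abelianization.of a) (b := Abelianization.of b)
      (by rw [← map_pow, e _ ha]) (by rw [← map_pow, e _ hb]) hd
      (Subgroup.closure {Abelianization.of (a ^ i * b ^ j), Abelianization.of (a ^ k * b ^ l)})
      (Subgroup.subset_closure (by simp)) (Subgroup.subset_closure (by simp))
    rw [eq_top_iff, ← closure_pair_map Abelianization.of (QuotientGroup.mk'_surjective _) hab,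
      Subgroup.closure_le]
    rintro z (rfl | rfl)
    exacts [h1.1, h1.2]

theorem lead_one_of_zpow (i j : ZMod 3) :
    Lead 1 (magnus (x ^ (i.val : ℤ) * y ^ (j.val : ℤ))) (i • X + j • Y) := by
  have := lead_one (x ^ (i.val : ℤ) * y ^ (j.val : ℤ))
  simpa [expo_mul, expo_zpow, expo_of] using this

theorem IsModel.of_isBaseChange {M' : CubeShape} (h : M.IsModel π) {i j k l : ZMod 3}
    (hd : i * l - j * k ≠ 0) (hb : CubeShape.IsBaseChange M M' i j k l) :
    M'.IsModel (liftPair (π (x ^ (i.val : ℤ) * y ^ (j.val : ℤ)))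
      (π (x ^ (k.val : ℤ) * y ^ (l.val : ℤ)))) := by
  have := h.isNilpotent
  have h12 := lcs_antitone (G := V) one_le_two
  apply Satisfied.isModel
  · simp only [liftPair_x, liftPair_y]
    rw [satisfied_iff h.ker_eq (lead_one_of_zpow i j) (lead_one_of_zpow k l)]
    exact hb
  · simp only [liftPair_x, liftPair_y, map_mul, map_zpow]
    exact closure_eq_top_of_det h.closure_eq (h12 h.x_cube_mem) (h12 h.y_cube_mem)
      (by simpa using hd)
  · exact h.card_eq

/-- A model either has one of the two shapes of Schur type or admits a descent form. -/
theorem IsModel.schur_or_descent (h : M.IsModel π) :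
    (∃ M' : CubeShape, M'.IsSchurShape ∧ ∃ π' : FreeGroup (Fin 2) →* V, M'.IsModel π') ∨
      ∃ a b c e : ZMod 3, Descent M a b c e := by
  rcases exists_isBaseChange_or_descent M with ⟨i, j, k, l, hd, hb | hb⟩ | h'
  · exact Or.inl ⟨_, Or.inl rfl, _, h.of_isBaseChange hd hb⟩
  · exact Or.inl ⟨_, Or.inr rfl, _, h.of_isBaseChange hd hb⟩
  · exact Or.inr h'

theorem isEmpty_mulEquiv : IsEmpty (G243_5 ≃* G243_7) := by
  refine ⟨fun e => ?_⟩
  obtain ⟨i, j, k, l, hd, hb⟩ :=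
    isModel_G243_7.exists_isBaseChange (isModel_G243_5.comp_mulEquiv e)
  exact not_isBaseChange_shape7_shape5 hd hb

end CubeShape

/-! ### The group `⟨27,3⟩` and its descendants of step size two -/

namespace Magnus

open SmallGroups TwoGenerated

instance : (D 3).Normal := ⟨by
  rintro f ⟨a, h⟩ g
  exact ⟨a, lead_conj h g⟩⟩

theorem lcs_two_le_D_three : lcs (FreeGroup (Fin 2)) 2 ≤ D 3 := lcs_le_D 2

theorem D_three_le {V : Type*} [Group V] (π : FreeGroup (Fin 2) →* V) (N : Subgroup V)
    (hN : lcs V 2 ≤ N) (hx : π x ^ 3 ∈ N) (hy : π y ^ 3 ∈ N) (hs : π s ^ 3 ∈ N)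
    {f : FreeGroup (Fin 2)} (hf : f ∈ D 3) : π f ∈ N := by
  obtain ⟨a, ha⟩ := hf
  obtain ⟨n, m, k, l, o, d, hd, -, -, rfl⟩ := exists_form_of_lead_two (ha.weaken (by norm_num))
  have hu : π u ∈ N := hN (map_mem_lcs π (commutator_mem_lcs_succ (commutator_mem_lcs_one x y) x))
  have hv : π v ∈ N := hN (map_mem_lcs π (commutator_mem_lcs_succ (commutator_mem_lcs_one x y) y))
  have hd' : π d ∈ N := hN (map_mem_lcs π (lcs_antitone (by norm_num : 2 ≤ 3) hd))
  simp only [map_mul, map_zpow, zpow_mul]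
  norm_cast
  exact mul_mem (mul_mem (zpow_mem hx _) (zpow_mem hy _)) (mul_mem (zpow_mem hs _)
    (mul_mem (mul_mem (zpow_mem hu _) (zpow_mem hv _)) hd'))

/-- All five relators have weight at least three. Conversely, a word in `D 3` is a product of powers
of `x³`, `y³`, `s³` and an element of `lcs 2`. -/
theorem ker_mk_G27_3 : (PresentedGroup.mk _ : FreeGroup (Fin 2) →* G27_3).ker = D 3 := by
  have hr : ∀ {f}, f ∈ ({x ^ 3, y ^ 3, s ^ 3, ⁅s, x⁆, ⁅s, y⁆} : Set (FreeGroup (Fin 2))) →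
      (PresentedGroup.mk _ : FreeGroup (Fin 2) →* G27_3) f = 1 := PresentedGroup.one_of_mem
  have hk : (PresentedGroup.mk _ : FreeGroup (Fin 2) →* G27_3).ker =
    Subgroup.normalClosure _ := QuotientGroup.ker_mk' _
  apply le_antisymm
  · rw [hk]
    apply Subgroup.normalClosure_le_normal
    rintro f (rfl | rfl | rfl | rfl | rfl)
    · exact ⟨_, by rw [map_pow]; exact lead_x.cube_one⟩
    · exact ⟨_, by rw [map_pow]; exact lead_y.cube_one⟩
    · exact ⟨0, by rw [map_pow]; exact (lead_s.cube_of_two_le le_rfl).weaken (by norm_num)⟩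
    · exact ⟨_, lead_u⟩
    · exact ⟨_, lead_v⟩
  · intro f hf
    have := D_three_le (PresentedGroup.mk _ : FreeGroup (Fin 2) →* G27_3) ⊥ ?_ ?_ ?_ ?_ hf
    · rwa [Subgroup.mem_bot] at this
    · apply lcs_two_le (closure_pair_map _ (PresentedGroup.mk_surjective _) closure_xy) <;>
      rw [← map_commutatorElement, ← map_commutatorElement] <;> exact hr (by simp)
    all_goals rw [← map_pow]; exact hr (by simp)

theorem lcs_one_G27_3 : lcs G27_3 1 ≠ ⊥ := by
  rw [Ne, ← lcs_le_ker_iff _ (PresentedGroup.mk_surjective _), ker_mk_G27_3]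
  intro h
  obtain ⟨a, ha⟩ := h (commutator_mem_lcs_one x y)
  have e := lead_s.unique (by norm_num) (ha.weaken (by norm_num : 2 < 3))
  have := cf_S 1
  rw [e, smul_zero, map_zero] at this
  exact zero_ne_one this

theorem lcs_two_G27_3 : lcs G27_3 2 = ⊥ := by
  rw [← lcs_le_ker_iff _ (PresentedGroup.mk_surjective _), ker_mk_G27_3]
  exact lcs_two_le_D_three

end Magnus

namespace CubeShape

open Magnus SmallGroups TwoGenerated

variable {M : CubeShape} {V : Type*} [Group V] {π : FreeGroup (Fin 2) →* V}

theorem J_le_D_three : J M ≤ D 3 := fun _ ⟨_, _, h⟩ => ⟨_, h⟩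

theorem IsModel.mem_lcs_two_iff (h : M.IsModel π) {f : FreeGroup (Fin 2)} :
    π f ∈ lcs V 2 ↔ f ∈ D 3 := by
  constructor
  · intro hf
    rw [← map_lcs π h.surjective] at hf
    obtain ⟨g, hg, he⟩ := hf
    have h1 : f * g⁻¹ ∈ J M := by rw [← h.eq_one_iff, map_mul, map_inv, he, mul_inv_cancel]
    simpa using mul_mem (J_le_D_three h1) (lcs_two_le_D_three hg)
  · apply D_three_le π (lcs V 2) le_rfl h.x_cube_mem h.y_cube_mem
    rw [map_commutatorElement, h.satisfied.s_cube]
    exact one_mem _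

theorem IsModel.exists_onto_G27_3 (h : M.IsModel π) :
    ∃ f : V →* G27_3, Function.Surjective f ∧ f.ker = lcs V 2 := by
  have hk : π.ker ≤ (PresentedGroup.mk _ : FreeGroup (Fin 2) →* G27_3).ker := by
    rw [ker_mk_G27_3, h.ker_eq]; exact J_le_D_three
  let f := π.liftOfSurjective h.surjective ⟨_, hk⟩
  have hf : ∀ g, f (π g) = PresentedGroup.mk _ g :=
    MonoidHom.liftOfRightInverse_comp_apply π _ _ ⟨_, hk⟩
  refine ⟨f, ?_, ?_⟩
  · intro z
    obtain ⟨g, rfl⟩ := PresentedGroup.mk_surjective _ z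
    exact ⟨π g, hf g⟩
  · ext z
    obtain ⟨g, rfl⟩ := h.surjective z
    rw [MonoidHom.mem_ker, hf, ← MonoidHom.mem_ker, ker_mk_G27_3, h.mem_lcs_two_iff]

theorem IsModel.card_lcs_two (h : M.IsModel π) : Nat.card (lcs V 2) = 3 ^ 2 := by
  let F : Fin 3 × Fin 3 → lcs V 2 := fun e => ⟨normalForm (π x) (π y) (0, 0, 0, e.1, e.2), by
    simp only [normalForm, Fin.val_zero, pow_zero, one_mul]
    exact mul_mem (pow_mem (commutator_mem_lcs_two _ _ _) _)
      (pow_mem (commutator_mem_lcs_two _ _ _) _)⟩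
  have hF : Function.Bijective F := by
    constructor
    · intro e e' hee
      have := h.normalForm_injective (congrArg Subtype.val hee)
      simp only [Prod.mk.injEq, true_and] at this
      exact Prod.ext this.1 this.2
    · rintro ⟨z, hz⟩
      obtain ⟨l, o, t, ht, e⟩ := exists_form_lcs_two h.closure_eq hz
      rw [h.lcs_three, Subgroup.mem_bot] at ht
      refine ⟨(residue l, residue o), Subtype.ext ?_⟩
      change _ = z
      rw [e, zpow_emod_three _ l, zpow_emod_three _ o, h.satisfied.u_cube, h.satisfied.v_cube, ht]
      simp [F, normalForm, residue]
  rw [← Nat.card_congr (Equiv.ofBijective F hF)]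
  simp

theorem card_G27_3 : Nat.card G27_3 = 3 ^ 3 := by
  obtain ⟨f, hf, hk⟩ := isModel_G243_5.exists_onto_G27_3
  have h1 := Subgroup.card_eq_card_quotient_mul_card_subgroup f.ker
  rw [Nat.card_congr (QuotientGroup.quotientKerEquivOfSurjective f hf).toEquiv, hk,
    isModel_G243_5.card_lcs_two, isModel_G243_5.card_eq] at h1
  omega

theorem IsModel.isImmediateDescendantOfStep {V : Type} [Group V] {π : FreeGroup (Fin 2) →* V}
    (h : M.IsModel π) : IsImmediateDescendantOfStep 3 2 V G27_3 := by
  obtain ⟨f, hf, hk⟩ := h.exists_onto_G27_3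
  refine ⟨isImmediateDescendant_of_lcs h.lcs_three h.lcs_two_ne f hf hk, ?_⟩
  rw [h.card_eq, card_G27_3]
  norm_num

theorem lcs_le_center {G : Type*} [Group G] {n : ℕ} (h : lcs G (n + 1) = ⊥) :
    lcs G n ≤ Subgroup.center G := by
  intro z hz
  rw [Subgroup.mem_center_iff]
  intro w
  rw [← commutatorElement_eq_one_iff_mul_comm, ← Subgroup.mem_bot, ← h]
  exact commutator_mem_lcs_succ' hz w

theorem exists_satisfied {G : Type*} [Group G] (h3 : lcs G 3 = ⊥) {a b : G}
    (hab : Subgroup.closure {a, b} = ⊤) (ha : a ^ 3 ∈ lcs G 2) (hb : b ^ 3 ∈ lcs G 2)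
    (hs : ⁅b, a⁆ ^ 3 ∈ lcs G 2) : ∃ M : CubeShape, M.Satisfied a b := by
  have e4 : ∀ p q r t : G, ⁅⁅⁅p, q⁆, r⁆, t⁆ = 1 := fun p q r t => by
    rw [← Subgroup.mem_bot, ← h3]
    exact commutator_mem_lcs_succ (commutator_mem_lcs_succ (commutator_mem_lcs_one _ _) _) _
  have hc := lcs_le_center h3
  have h4 : CentralFour a b := ⟨by rw [e4]; exact one_mem _, by rw [e4]; exact one_mem _,
    by rw [e4]; exact one_mem _, by rw [e4]; exact one_mem _⟩
  have hu := h4.u_cube (hc hs)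
  have hv := h4.v_cube (hc hs)
  -- Since `a³` is central, the left-hand side `⁅b, a³⁆` is trivial, and only `⁅b, a⁆³` survives on
  -- the right.
  have hs' := h4.x_cube
  rw [hu, e4, commutatorElement_eq_one_iff_mul_comm.2 (Subgroup.mem_center_iff.1 (hc ha) b)] at hs'
  obtain ⟨l, o, t, ht, e⟩ := exists_form_lcs_two hab ha
  obtain ⟨l', o', t', ht', e'⟩ := exists_form_lcs_two hab hb
  rw [h3, Subgroup.mem_bot] at ht ht'
  have ez : ∀ {g : G}, g ^ 3 = 1 → ∀ n : ℤ, g ^ n = g ^ (n : ZMod 3).val := fun hg n => by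
    rw [← zpow_natCast]
    exact zpow_eq_of_cast_eq hg (by simp)
  refine ⟨⟨l, o, l', o'⟩, ⟨by simpa using hs'.symm, hu, hv, e4 _ _ _ _, e4 _ _ _ _, e4 _ _ _ _,
    e4 _ _ _ _, ?_, ?_⟩⟩
  · rw [e, ht, mul_one, ez hu, ez hv]
  · rw [e', ht', mul_one, ez hu, ez hv]

theorem exists_isModel_of_descendant {V : Type} [Group V] [Finite V] (hV : IsPGroup 3 V)
    (h : IsImmediateDescendantOfStep 3 2 V G27_3) :
    ∃ M : CubeShape, ∃ π : FreeGroup (Fin 2) →* V, M.IsModel π := by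
  have : Fact (Nat.Prime 3) := ⟨Nat.prime_three⟩
  have := hV.isNilpotent
  obtain ⟨hd, hc⟩ := h
  obtain ⟨h3, h2, f, hf, hk⟩ := descendant_lcs lcs_two_G27_3 lcs_one_G27_3 hd
  rw [card_G27_3] at hc
  let mk := (PresentedGroup.mk _ : FreeGroup (Fin 2) →* G27_3)
  have hmk : ∀ {g}, g ∈ D 3 → mk g = 1 := fun {g} hg => by
    rwa [← MonoidHom.mem_ker, ker_mk_G27_3]
  obtain ⟨a, ha⟩ := hf (mk x)
  obtain ⟨b, hb⟩ := hf (mk y)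
  have hab : Subgroup.closure {a, b} = ⊤ := by
    apply closure_eq_top_of_map (f := f)
    · rw [hk]; exact lcs_antitone one_le_two
    · rw [ha, hb]
      exact closure_pair_map _ (PresentedGroup.mk_surjective _) closure_xy
  obtain ⟨M, hM⟩ := exists_satisfied h3 hab
    (by rw [← hk, MonoidHom.mem_ker, map_pow, ha, ← map_pow]
        exact hmk ⟨_, by rw [map_pow]; exact lead_x.cube_one⟩)
    (by rw [← hk, MonoidHom.mem_ker, map_pow, hb, ← map_pow]
        exact hmk ⟨_, by rw [map_pow]; exact lead_y.cube_one⟩)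
    (by rw [← hk, MonoidHom.mem_ker, map_pow, map_commutatorElement, ha, hb,
          ← map_commutatorElement, ← map_pow]
        exact hmk ⟨0, by
          rw [map_pow]; exact (lead_s.cube_of_two_le le_rfl).weaken (by norm_num)⟩)
  refine ⟨M, liftPair a b, Satisfied.isModel ?_ ?_ (by rw [hc]; norm_num)⟩ <;>
  rwa [liftPair_x, liftPair_y]

end CubeShape

/-! ### Invariant homomorphisms on relations, and descendants from descent forms -/

noncomputable section

/-- `χ` restricts to a homomorphism `R → 𝔽₃` which is invariant under conjugation. -/
structure IsInvHom {F : Type*} [Group F] (R : Subgroup F) (χ : F → ZMod 3) : Prop where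
  map_mul : ∀ f ∈ R, ∀ g ∈ R, χ (f * g) = χ f + χ g
  conj : ∀ f ∈ R, ∀ g, χ (g * f * g⁻¹) = χ f

namespace IsInvHom

variable {F : Type*} [Group F] {R : Subgroup F} {χ : F → ZMod 3}

theorem map_one (h : IsInvHom R χ) : χ 1 = 0 := by
  have := h.map_mul 1 (one_mem R) 1 (one_mem R)
  rw [mul_one] at this
  exact left_eq_add.1 this

theorem map_inv (h : IsInvHom R χ) {f : F} (hf : f ∈ R) : χ f⁻¹ = -χ f := by
  have := h.map_mul f hf f⁻¹ (inv_mem hf)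
  rw [mul_inv_cancel, h.map_one] at this
  linear_combination -this

theorem map_pow (h : IsInvHom R χ) {f : F} (hf : f ∈ R) (n : ℕ) : χ (f ^ n) = n * χ f := by
  induction n with
  | zero => simp [h.map_one]
  | succ n ih =>
    rw [pow_succ, h.map_mul _ (pow_mem hf n) _ hf, ih]
    push_cast
    ring

theorem commutator [R.Normal] (h : IsInvHom R χ) {f : F} (hf : f ∈ R) (g : F) : χ ⁅f, g⁆ = 0 := by
  have hn := (inferInstance : R.Normal)
  have e : ⁅f, g⁆ = f * (g * f⁻¹ * g⁻¹) := by rw [commutatorElement_def]; group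
  rw [e, h.map_mul _ hf _ (hn.conj_mem _ (inv_mem hf) g), h.conj _ (inv_mem hf), h.map_inv hf,
    add_neg_cancel]

/-- The homomorphism on `R`. -/
def hom (h : IsInvHom R χ) : R →* Multiplicative (ZMod 3) where
  toFun r := Multiplicative.ofAdd (χ r)
  map_one' := by rw [OneMemClass.coe_one, h.map_one]; rfl
  map_mul' r r' := by
    rw [Subgroup.coe_mul, h.map_mul _ r.2 _ r'.2]; rfl

/-- The kernel in `R`. -/
def kernel (h : IsInvHom R χ) : Subgroup F := h.hom.ker.map R.subtype

theorem mem_kernel (h : IsInvHom R χ) {f : F} : f ∈ h.kernel ↔ f ∈ R ∧ χ f = 0 := by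
  constructor
  · rintro ⟨r, hr, rfl⟩
    exact ⟨r.2, Multiplicative.ofAdd.injective hr⟩
  · rintro ⟨hf, h0⟩
    exact ⟨⟨f, hf⟩, by
      rw [SetLike.mem_coe, MonoidHom.mem_ker]; exact congrArg Multiplicative.ofAdd h0, rfl⟩

instance kernel_normal [R.Normal] (h : IsInvHom R χ) : h.kernel.Normal := ⟨by
  intro f hf g
  rw [mem_kernel] at hf ⊢
  exact ⟨(inferInstance : R.Normal).conj_mem _ hf.1 g, by rw [h.conj _ hf.1, hf.2]⟩⟩

theorem kernel_index_ne_zero (h : IsInvHom R χ) (hR : R.index ≠ 0) : h.kernel.index ≠ 0 := by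
  have hle : h.kernel ≤ R := fun f hf => (h.mem_kernel.1 hf).1
  rw [← Subgroup.relIndex_mul_index hle, Subgroup.relIndex]
  refine mul_ne_zero ?_ hR
  have e : h.kernel.subgroupOf R = h.hom.ker :=
    Subgroup.comap_map_eq_self_of_injective R.subtype_injective _
  rw [e, Subgroup.index_ker]
  exact Nat.card_pos.ne'

end IsInvHom

namespace Magnus

open SmallGroups TwoGenerated

/-- A combination of coefficient functionals. -/
def wordForm (t : List (ZMod 3 × List (Fin 2))) : RedAlg →ₗ[ZMod 3] ZMod 3 :=
  (t.map fun p => p.1 • cf p.2).sum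

/-- The combination of the irrational parts of coefficients that lifts `wordForm`. -/
def wordFormLift (t : List (ZMod 3 × List (Fin 2))) (a : Alg) : ZMod 27 :=
  (t.map fun p => (p.1.val : ZMod 27) * (a.coeff (FreeMonoid.ofList p.2)).im).sum

variable (t : List (ZMod 3 × List (Fin 2)))

theorem wordFormLift_add (a b : Alg) :
    wordFormLift t (a + b) = wordFormLift t a + wordFormLift t b := by
  rw [wordFormLift, wordFormLift, wordFormLift, ← List.sum_map_add]
  simp [mul_add]

theorem wordFormLift_zero : wordFormLift t 0 = 0 := by
  have := wordFormLift_add t 0 0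
  rw [add_zero] at this
  exact left_eq_add.1 this

theorem wordFormLift_nsmul (n : ℕ) (a : Alg) : wordFormLift t (n • a) = n * wordFormLift t a := by
  induction n with
  | zero => simp [wordFormLift_zero]
  | succ n ih => rw [succ_nsmul, wordFormLift_add, ih]; push_cast; ring

/-- Multiplication by `9`. -/
def nine (z : ZMod 3) : ZMod 27 := 9 * (z.val : ZMod 27)

/-- Division by `9`. -/
def divNine (z : ZMod 27) : ZMod 3 := ((z.val / 9 : ℕ) : ZMod 3)

theorem nine_add : ∀ a b, nine (a + b) = nine a + nine b := by
  unfold nine; decide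

theorem divNine_nine : ∀ a, divNine (nine a) = a := by
  unfold nine divNine; decide

/-- The condition `3a = 0` makes `a` a multiple of `9`, so adding it to `b` produces no carry below
the digit that is read. -/
theorem divNine_add : ∀ a b : ZMod 27, 3 * a = 0 → divNine (a + b) = divNine a + divNine b := by
  unfold divNine; decide +kernel

/-- Since `√3⁵ = 9√3`, the irrational part of `√3⁵ a` is nine times the rational part of `a`, which
modulo `27` depends only on the reduction of `a`. -/
theorem wordFormLift_unif_pow_five (a : Alg) :
    wordFormLift t (unif ^ 5 • a) = nine (wordForm t (red a)) := by
  induction t with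
  | nil => simp [wordFormLift, wordForm, nine]
  | cons p t ih =>
    have h1 : wordFormLift (p :: t) (unif ^ 5 • a) =
        (p.1.val : ZMod 27) * ((unif ^ 5 • a).coeff (FreeMonoid.ofList p.2)).im +
          wordFormLift t (unif ^ 5 • a) := by simp [wordFormLift]
    have h2 : wordForm (p :: t) (red a) = p.1 * cf p.2 (red a) + wordForm t (red a) := by
      simp [wordForm]
    rw [h1, h2, nine_add, ih]
    congr 1
    have h3 : cf p.2 (red a) = coeffRed (a.coeff (FreeMonoid.ofList p.2)) := coeff_red _ _
    rw [h3]
    simp only [MonoidAlgebra.coeff_smul_apply, unif_pow_five, smul_eq_mul,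
      QuadraticAlgebra.im_mul]
    have key : ∀ (z : ZMod 27) (c : ZMod 3), (c.val : ZMod 27) * (9 * z) =
        nine (c * ZMod.castHom (by norm_num : 3 ∣ 27) (ZMod 3) z) := by
      unfold nine; decide
    simpa [coeffRed] using key _ _

theorem P_X : P X = mono [0, 0, 0] + mono [0] := by
  rw [P, X_cube, X, rletter_eq_mono]

theorem P_Y : P Y = mono [1, 1, 1] + mono [1] := by
  rw [P, Y_cube, Y, rletter_eq_mono]

/-- The value of the lift of a functional on `√3ʳ(f - 1)`. -/
def level (r : ℕ) (f : FreeGroup (Fin 2)) : ZMod 27 :=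
  wordFormLift t (unif ^ r • ((magnus f : Alg) - 1))

/-- The only obstruction is the cross term of the product, which has weight `r + m + n ≥ 6` and
vanishes. -/
theorem level_mul {r m n : ℕ} {f g : FreeGroup (Fin 2)} {a b : RedAlg} (hf : Lead m (magnus f) a)
    (hg : Lead n (magnus g) b) (h : 6 ≤ r + m + n) :
    level t r (f * g) = level t r f + level t r g := by
  obtain ⟨a, -, ha⟩ := hf
  obtain ⟨b, -, hb⟩ := hg
  rw [level, level, level, ← wordFormLift_add, map_mul, Units.val_mul, ha, hb]
  congr 1
  have h0 : unif ^ r • ((unif ^ m • a) * (unif ^ n • b)) = 0 := by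
    have : r + m + n = 6 + (r + m + n - 6) := by omega
    rw [smul_mul_smul_comm, smul_smul, ← pow_add, ← pow_add, ← add_assoc, this, pow_add,
      unif_pow_six, zero_mul, zero_smul]
  generalize unif ^ m • a = A at *
  generalize unif ^ n • b = B at *
  have e : (1 + A) * (1 + B) - 1 = (1 + A - 1 + (1 + B - 1)) + A * B := by
    simp only [add_mul, mul_add, one_mul, mul_one]; abel
  rw [e, smul_add, h0, add_zero, smul_add]

theorem three_mul_level {r n : ℕ} {f : FreeGroup (Fin 2)} {a : RedAlg} (hf : Lead n (magnus f) a)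
    (h : 4 ≤ r + n) : 3 * level t r f = 0 := by
  obtain ⟨a, -, ha⟩ := hf
  have e : (3 : ℕ) • (unif ^ r • ((magnus f : Alg) - 1)) = 0 := by
    rw [ha, add_sub_cancel_left, smul_smul, ← pow_add, nsmul_eq_mul, Nat.cast_ofNat,
      three_mul_alg, smul_smul, ← pow_add]
    have : 2 + (r + n) = 6 + (r + n - 4) := by omega
    rw [this, pow_add, unif_pow_six, zero_mul, zero_smul]
  have := wordFormLift_nsmul t 3 (unif ^ r • ((magnus f : Alg) - 1))
  rw [e, wordFormLift_zero] at this
  exact_mod_cast this.symm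

theorem level_eq_nine {r n : ℕ} {f : FreeGroup (Fin 2)} {a : RedAlg} (hf : Lead n (magnus f) a)
    (h : r + n = 5) : level t r f = nine (wordForm t a) := by
  obtain ⟨a, rfl, ha⟩ := hf
  rw [level, ha, add_sub_cancel_left, smul_smul, ← pow_add, h, wordFormLift_unif_pow_five]

end Magnus

namespace CubeShape

open Magnus SmallGroups TwoGenerated

variable {M : CubeShape}

/-- The word form with prescribed values on the brackets of weight four. -/
abbrev descentForm (a b c e : ZMod 3) : List (ZMod 3 × List (Fin 2)) :=
  [(-a, [0, 0, 0, 1]), (b, [0, 0, 1, 1]), (-c, [0, 1, 1, 1]), (-e, [0, 1])]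

/-- The word `XY` sees only the linear parts of `P X` and `P Y`; its coefficient supplies the value
`e` attached to `s³`. The words of length four supply the values on the commutators of weight four.
-/
theorem descentForm_brackets (a b c e : ZMod 3) :
    wordForm (descentForm a b c e) ⁅P X, X⁆ = 0 ∧
    wordForm (descentForm a b c e) ⁅P X, Y⁆ = -(a + e) ∧
    wordForm (descentForm a b c e) ⁅P Y, X⁆ = c + e ∧
    wordForm (descentForm a b c e) ⁅P Y, Y⁆ = 0 ∧
    wordForm (descentForm a b c e) ⁅U, X⁆ = a ∧
    wordForm (descentForm a b c e) ⁅U, Y⁆ = b ∧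
    wordForm (descentForm a b c e) ⁅W, X⁆ = b ∧
    wordForm (descentForm a b c e) ⁅W, Y⁆ = c := by
  rw [P_X, P_Y]
  refine ⟨?_, ?_, ?_, ?_, ?_, ?_, ?_, ?_⟩ <;>
  simp only [descentForm, wordForm, List.map_cons, List.map_nil, List.sum_cons, List.sum_nil,
    LinearMap.add_apply, LinearMap.smul_apply, LinearMap.zero_apply, Ring.lie_def, U_eq, W_eq, X, Y,
    rletter_eq_mono, mul_add, add_mul, mul_neg, neg_mul, mono_mul, List.cons_append,
    List.nil_append, map_add, map_sub, map_neg, cf_mono] <;> simp <;> ring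

/-- The four equations of `Descent` are precisely the vanishing of the form on the brackets of the
two relator terms with `X` and `Y`. -/
theorem Descent.wordForm_bracket {a b c e : ZMod 3} (h : Descent M a b c e) (p q i j : ZMod 3) :
    wordForm (descentForm a b c e) ⁅p • P X + q • P Y + (-(p * M.α + q * M.γ)) • U +
      (-(p * M.β + q * M.δ)) • W, i • X + j • Y⁆ = 0 := by
  obtain ⟨h1, h2, h3, h4, h5, h6, h7, h8⟩ := descentForm_brackets a b c e
  generalize P X = A at *
  generalize P Y = B at *
  simp only [bracket_add, add_bracket, bracket_smul, smul_bracket, map_add, map_smul, smul_eq_mul,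
    h1, h2, h3, h4, h5, h6, h7, h8]
  linear_combination (-(i * p)) * h.xx - j * q * h.yy - j * p * h.yx + i * q * h.xy

/-- The invariant homomorphism on the relations defined by a descent form. -/
def descentChar (a b c e : ZMod 3) (f : FreeGroup (Fin 2)) : ZMod 3 :=
  divNine (level (descentForm a b c e) 1 f)

theorem descentChar_eq {a b c e : ZMod 3} {f : FreeGroup (Fin 2)} {z : RedAlg}
    (hf : Lead 4 (magnus f) z) : descentChar a b c e f = wordForm (descentForm a b c e) z := by
  rw [descentChar, level_eq_nine _ hf rfl, divNine_nine]

theorem descentChar_mul {a b c e : ZMod 3} {f g : FreeGroup (Fin 2)} {z w : RedAlg}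
    (hf : Lead 3 (magnus f) z) (hg : Lead 3 (magnus g) w) :
    descentChar a b c e (f * g) = descentChar a b c e f + descentChar a b c e g := by
  rw [descentChar, level_mul _ hf hg (by norm_num), divNine_add _ _ (three_mul_level _ hf le_rfl)]
  rfl

/-- Conjugation changes a relation by a commutator whose leading term, in weight four, is
annihilated by `Descent.wordForm_bracket`. -/
theorem Descent.isInvHom {a b c e : ZMod 3} (h : Descent M a b c e) :
    IsInvHom (J M) (descentChar a b c e) := by
  refine ⟨?_, ?_⟩
  · rintro f ⟨p, q, hf⟩ g ⟨p', q', hg⟩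
    exact descentChar_mul hf hg
  · rintro f ⟨p, q, hf⟩ g
    have e1 : g * f * g⁻¹ = ⁅f, g⁆⁻¹ * f := by rw [commutatorElement_def]; group
    have h4 := lead_comm 4 three_ne_zero one_ne_zero rfl hf (lead_one g)
    have h4' := h4.inv four_ne_zero
    rw [← map_inv] at h4'
    rw [e1, descentChar_mul (h4'.weaken (by norm_num)) hf, descentChar_eq h4', map_neg,
      h.wordForm_bracket, neg_zero, zero_add]

theorem Descent.exists_lcs_three {a b c e : ZMod 3} (h : Descent M a b c e) :
    ∃ f ∈ lcs (FreeGroup (Fin 2)) 3, descentChar a b c e f ≠ 0 := by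
  obtain ⟨-, -, -, -, h5, h6, h7, h8⟩ := descentForm_brackets a b c e
  have hu : u ∈ lcs (FreeGroup (Fin 2)) 2 := commutator_mem_lcs_succ (commutator_mem_lcs_one x y) x
  have hv : v ∈ lcs (FreeGroup (Fin 2)) 2 := commutator_mem_lcs_succ (commutator_mem_lcs_one x y) y
  rcases h.ne with h0 | h0 | h0
  · refine ⟨⁅u, x⁆, commutator_mem_lcs_succ hu x, ?_⟩
    rwa [descentChar_eq (lead_comm 4 three_ne_zero one_ne_zero rfl lead_u lead_x), h5]
  · refine ⟨⁅u, y⁆, commutator_mem_lcs_succ hu y, ?_⟩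
    rwa [descentChar_eq (lead_comm 4 three_ne_zero one_ne_zero rfl lead_u lead_y), h6]
  · refine ⟨⁅v, y⁆, commutator_mem_lcs_succ hv y, ?_⟩
    rwa [descentChar_eq (lead_comm 4 three_ne_zero one_ne_zero rfl lead_v lead_y), h8]

/-- The quotient of the free group by the kernel of the character on `J M` is a central extension of
`V` by `𝔽₃`. Its class is four because the character is nonzero on `lcs 3`. -/
theorem IsModel.not_isTerminal {V : Type} [Group V] {π : FreeGroup (Fin 2) →* V}
    (h : M.IsModel π) {a b c e : ZMod 3} (hd : Descent M a b c e) : ¬ IsTerminal 3 V := by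
  intro hT
  have hI := hd.isInvHom
  have hle : hI.kernel ≤ J M := fun f hf => (hI.mem_kernel.1 hf).1
  have hJ : (J M).index ≠ 0 := by
    rw [← h.ker_eq, Subgroup.index_ker, MonoidHom.range_eq_top.2 h.surjective,
      Nat.card_congr Subgroup.topEquiv.toEquiv, h.card_eq]
    norm_num
  have : hI.kernel.FiniteIndex := ⟨hI.kernel_index_ne_zero hJ⟩
  have hfin : Finite (FreeGroup (Fin 2) ⧸ hI.kernel) := Subgroup.finite_quotient_of_finiteIndex
  have hmk := QuotientGroup.mk'_surjective hI.kernel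
  have hker := QuotientGroup.ker_mk' hI.kernel
  have hp : IsPGroup 3 (FreeGroup (Fin 2) ⧸ hI.kernel) := by
    intro z
    obtain ⟨f, rfl⟩ := hmk z
    obtain ⟨k, hk⟩ := h.isPGroup (π f)
    refine ⟨k + 1, ?_⟩
    rw [← map_pow, h.eq_one_iff] at hk
    rw [← map_pow, pow_succ, pow_mul, ← MonoidHom.mem_ker, hker, hI.mem_kernel]
    refine ⟨pow_mem hk 3, ?_⟩
    rw [hI.map_pow hk]
    have : ((3 : ℕ) : ZMod 3) = 0 := by decide
    rw [this, zero_mul]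
  have h4 : lcs (FreeGroup (Fin 2) ⧸ hI.kernel) 4 = ⊥ := by
    rw [← lcs_le_ker_iff _ hmk, hker, lcs_succ_le_iff]
    intro f hf g
    have hfJ := lcs_three_le_J hf (M := M)
    have hn := (inferInstance : (J M).Normal)
    rw [hI.mem_kernel]
    refine ⟨?_, hI.commutator hfJ g⟩
    have e : ⁅f, g⁆ = f * (g * f⁻¹ * g⁻¹) := by rw [commutatorElement_def]; group
    rw [e]
    exact mul_mem hfJ (hn.conj_mem _ (inv_mem hfJ) g)
  obtain ⟨c0, hc0, hne⟩ := hd.exists_lcs_three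
  have h3 : lcs (FreeGroup (Fin 2) ⧸ hI.kernel) 3 ≠ ⊥ := by
    rw [Ne, ← lcs_le_ker_iff _ hmk, hker]
    intro hle'
    exact hne (hI.mem_kernel.1 (hle' hc0)).2
  let p : FreeGroup (Fin 2) ⧸ hI.kernel →* V := QuotientGroup.lift hI.kernel π
    (fun f hf => h.eq_one_iff.2 (hle hf))
  refine hT _ hfin hp (isImmediateDescendant_of_lcs h4 h3 p
    (QuotientGroup.lift_surjective_of_surjective _ _ h.surjective _) ?_)
  apply le_antisymm
  · intro z hz
    obtain ⟨f, rfl⟩ := hmk z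
    have hf : f ∈ J M := h.eq_one_iff.1 hz
    have key : ∀ s t : ZMod 3, t ≠ 0 → s + ((-(s * t)).val : ZMod 3) * t = 0 := by decide
    -- Nonzero squares in `𝔽₃` equal one, so the character takes on `c0 ^ n` the value opposite to
    -- that on `f`.
    set n := (-(descentChar a b c e f * descentChar a b c e c0)).val with hn
    have hcJ := lcs_three_le_J hc0 (M := M)
    have h1 : f * c0 ^ n ∈ hI.kernel := by
      rw [hI.mem_kernel]
      refine ⟨mul_mem hf (pow_mem hcJ n), ?_⟩
      rw [hI.map_mul _ hf _ (pow_mem hcJ n), hI.map_pow hcJ, hn, key _ _ hne]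
    rw [← hker, MonoidHom.mem_ker, map_mul, mul_eq_one_iff_eq_inv] at h1
    rw [h1]
    exact inv_mem (map_mem_lcs _ (pow_mem hc0 n))
  · rw [lcs_le_ker_iff p (QuotientGroup.lift_surjective_of_surjective _ _ h.surjective _)]
    exact h.lcs_three

/-- The terminal immediate descendants of `⟨27,3⟩` with step size `2`. -/
theorem terminal_descendant_iff (V : Type) [Group V] :
    (Finite V ∧ IsPGroup 3 V ∧ IsImmediateDescendantOfStep 3 2 V G27_3 ∧ IsTerminal 3 V) ↔
      ∃ M : CubeShape, M.IsSchurShape ∧ ∃ π : FreeGroup (Fin 2) →* V, M.IsModel π := by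
  constructor
  · rintro ⟨hf, hp, hd, ht⟩
    obtain ⟨M, π, h⟩ := exists_isModel_of_descendant hp hd
    rcases h.schur_or_descent with h' | ⟨a, b, c, e, h'⟩
    · exact h'
    · exact absurd ht (h.not_isTerminal h')
  · rintro ⟨M, hM, π, h⟩
    exact ⟨h.finite, h.isPGroup, h.isImmediateDescendantOfStep, h.isTerminal hM⟩

theorem exists_isModel_iff (V : Type) [Group V] :
    (∃ M : CubeShape, M.IsSchurShape ∧ ∃ π : FreeGroup (Fin 2) →* V, M.IsModel π) ↔
      (Nonempty (V ≃* G243_5) ∨ Nonempty (V ≃* G243_7)) := by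
  rw [nonempty_mulEquiv_iff isModel_G243_5, nonempty_mulEquiv_iff isModel_G243_7]
  constructor
  · rintro ⟨M, rfl | rfl, h⟩
    exacts [Or.inl h, Or.inr h]
  · rintro (h | h)
    exacts [⟨_, Or.inl rfl, h⟩, ⟨_, Or.inr rfl, h⟩]

theorem IsModel.hasCoclass {V : Type} [Group V] {π : FreeGroup (Fin 2) →* V} (h : M.IsModel π) :
    HasCoclass 3 V 2 := by
  rw [HasCoclass, h.nilpotencyClass_eq, h.card_eq]

/-- The parent is `⟨27,3⟩`, of order `27` and class two, hence of coclass one; descendants are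
excluded by terminality. -/
theorem IsModel.isIsolated {V : Type} [Group V] {π : FreeGroup (Fin 2) →* V}
    (hM : M.IsSchurShape) (h : M.IsModel π) : IsIsolatedInCoclassForest 3 2 V := by
  refine ⟨h.hasCoclass, fun W _ hW hp hc => ⟨fun hd => ?_, h.isTerminal hM W hW hp⟩⟩
  obtain ⟨f, hf, hk⟩ := h.exists_onto_G27_3
  obtain ⟨-, ⟨e⟩⟩ := hd
  have hk' : lcs V (Group.nilpotencyClass V - 1) = f.ker := by rw [hk, h.nilpotencyClass_eq]
  have e' : W ≃* G27_3 := e.symm.trans ((QuotientGroup.quotientMulEquivOfEq hk').trans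
    (QuotientGroup.quotientKerEquivOfSurjective f hf))
  have h3 : Group.nilpotencyClass W = 2 := by
    refine nilpotencyClass_eq_succ ?_ ?_
    · rw [← map_lcs e'.symm.toMonoidHom e'.symm.surjective, lcs_two_G27_3, Subgroup.map_bot]
    · intro hb
      apply lcs_one_G27_3
      rw [← map_lcs e'.toMonoidHom e'.surjective, hb, Subgroup.map_bot]
  rw [HasCoclass, h3, Nat.card_congr e'.toEquiv, card_G27_3] at hc
  norm_num at hc

end CubeShape

end

noncomputable section

/-! ### Hopf's formula for `H²(V, 𝔽₃)` -/

namespace Hopf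

open groupCohomology

variable {V : Type} [Group V]

/-- The trivial module `𝔽₃`. -/
abbrev triv (V : Type) [Group V] : Rep (ZMod 3) V := Rep.trivial (ZMod 3) V (ZMod 3)

theorem mem_cocycles_iff (c : V × V → ZMod 3) : c ∈ cocycles₂ (triv V) ↔
    ∀ g h j : V, c (g * h, j) + c (g, h) = c (h, j) + c (g, h * j) :=
  mem_cocycles₂_iff (A := triv V) c

theorem mem_coboundaries_iff (c : V × V → ZMod 3) : c ∈ coboundaries₂ (triv V) ↔
    ∃ β : V → ZMod 3, ∀ g h : V, c (g, h) = β h - β (g * h) + β g := by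
  constructor
  · rintro ⟨β, rfl⟩
    exact ⟨β, fun g h => rfl⟩
  · rintro ⟨β, h⟩
    exact ⟨β, funext fun p => (h p.1 p.2).symm⟩

theorem cocycle_one_fst {c : V × V → ZMod 3} (hc : c ∈ cocycles₂ (triv V)) (g : V) :
    c (1, g) = c (1, 1) := by
  have := (mem_cocycles_iff c).1 hc 1 1 g
  simp only [one_mul] at this
  linear_combination -this

theorem cocycle_one_snd {c : V × V → ZMod 3} (hc : c ∈ cocycles₂ (triv V)) (g : V) :
    c (g, 1) = c (1, 1) := by
  have := (mem_cocycles_iff c).1 hc g 1 1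
  simp only [mul_one] at this
  linear_combination this

/-- The central extension defined by a cocycle. -/
@[ext]
structure CocycleExt (c : cocycles₂ (triv V)) where
  /-- the component in the group -/
  fst : V
  /-- the component in `𝔽₃` -/
  snd : ZMod 3

namespace CocycleExt

variable (c : cocycles₂ (triv V))

instance : Mul (CocycleExt c) := ⟨fun p q => ⟨p.1 * q.1, p.2 + q.2 + c.1 (p.1, q.1)⟩⟩

/-- Cocycles are not assumed normalized, hence the correction by `c (1, 1)` here and in the
transgression. -/
instance : One (CocycleExt c) := ⟨⟨1, -c.1 (1, 1)⟩⟩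

instance : Inv (CocycleExt c) := ⟨fun p => ⟨p.1⁻¹, -p.2 - c.1 (p.1⁻¹, p.1) - c.1 (1, 1)⟩⟩

theorem snd_mul (p q : CocycleExt c) : (p * q).snd = p.2 + q.2 + c.1 (p.1, q.1) := rfl

instance : Group (CocycleExt c) := Group.ofLeftAxioms
  (by
    intro p q r
    refine CocycleExt.ext (mul_assoc p.1 q.1 r.1) ?_
    have := (mem_cocycles_iff c.1).1 c.2 p.1 q.1 r.1
    change p.2 + q.2 + c.1 (p.1, q.1) + r.2 + c.1 (p.1 * q.1, r.1) =
      p.2 + (q.2 + r.2 + c.1 (q.1, r.1)) + c.1 (p.1, q.1 * r.1)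
    linear_combination this)
  (by
    rintro ⟨v, a⟩
    refine CocycleExt.ext (one_mul v) ?_
    have := cocycle_one_fst c.2 v
    change -c.1 (1, 1) + a + c.1 (1, v) = a
    linear_combination this)
  (by
    rintro ⟨v, a⟩
    refine CocycleExt.ext (inv_mul_cancel v) ?_
    change -a - c.1 (v⁻¹, v) - c.1 (1, 1) + a + c.1 (v⁻¹, v) = -c.1 (1, 1)
    ring)

/-- The projection of the extension. -/
def proj : CocycleExt c →* V where
  toFun p := p.1
  map_one' := rfl
  map_mul' _ _ := rfl

end CocycleExt

variable {ι : Type} {π : FreeGroup ι →* V}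

/-- `k` trivializes the inflation of `c` to the free group. -/
def IsPrimitive (π : FreeGroup ι →* V) (c : V × V → ZMod 3) (k : FreeGroup ι → ZMod 3) : Prop :=
  ∀ f g, k (f * g) = k f + k g + c (π f, π g)

/-- By freeness `π` lifts to the extension defined by `c`; the second component of the lift is a
primitive. -/
theorem exists_isPrimitive (π : FreeGroup ι →* V) {c : V × V → ZMod 3}
    (hc : c ∈ cocycles₂ (triv V)) : ∃ k, IsPrimitive π c k := by
  let φ : FreeGroup ι →* CocycleExt ⟨c, hc⟩ :=
    FreeGroup.lift fun i => ⟨π (FreeGroup.of i), 0⟩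
  have h1 : (CocycleExt.proj ⟨c, hc⟩).comp φ = π := by
    ext i
    simp only [MonoidHom.comp_apply, φ, FreeGroup.lift_apply_of]
    rfl
  refine ⟨fun f => (φ f).2, fun f g => ?_⟩
  have h2 : ∀ f, (φ f).1 = π f := fun f => DFunLike.congr_fun h1 f
  dsimp only
  rw [map_mul, CocycleExt.snd_mul, ← h2, ← h2]

variable (R : Subgroup (FreeGroup ι))

/-- The homomorphisms `R → 𝔽₃` invariant under conjugation. -/
def invHoms : Submodule (ZMod 3) (R → ZMod 3) where
  carrier := {χ | (∀ r t, χ (r * t) = χ r + χ t) ∧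
    ∀ (g : FreeGroup ι) (r t : R), (t : FreeGroup ι) = g * r * g⁻¹ → χ t = χ r}
  zero_mem' := by simp
  add_mem' := by
    rintro χ χ' ⟨h1, h2⟩ ⟨h1', h2'⟩
    refine ⟨fun r t => ?_, fun g r t e => ?_⟩
    · simp only [Pi.add_apply, h1, h1']; ring
    · simp only [Pi.add_apply, h2 g r t e, h2' g r t e]
  smul_mem' := by
    rintro a χ ⟨h1, h2⟩
    refine ⟨fun r t => ?_, fun g r t e => ?_⟩
    · simp only [Pi.smul_apply, h1, smul_add]
    · simp only [Pi.smul_apply, h2 g r t e]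

/-- Every homomorphism from the free group to `𝔽₃` is trivial on `R`. -/
def InFrattini : Prop :=
  ∀ ξ : FreeGroup ι → ZMod 3, (∀ f g, ξ (f * g) = ξ f + ξ g) → ∀ r ∈ R, ξ r = 0

variable {R}

theorem IsPrimitive.unique (hR : InFrattini R) {c : V × V → ZMod 3} {k k' : FreeGroup ι → ZMod 3}
    (h : IsPrimitive π c k) (h' : IsPrimitive π c k') {r : FreeGroup ι} (hr : r ∈ R) :
    k r = k' r := by
  have := hR (fun f => k f - k' f) (fun f g => by rw [h, h']; ring) r hr
  exact sub_eq_zero.1 this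

theorem IsPrimitive.mem_invHoms {c : V × V → ZMod 3} (hc : c ∈ cocycles₂ (triv V))
    {k : FreeGroup ι → ZMod 3} (h : IsPrimitive π c k) :
    (fun r : π.ker => k r + c (1, 1)) ∈ invHoms π.ker := by
  refine ⟨fun r t => ?_, fun g r t e => ?_⟩
  · have hr : π r = 1 := r.2
    have ht : π t = 1 := t.2
    dsimp only
    rw [Subgroup.coe_mul, h, hr, ht]; ring
  · have hr : π r = 1 := r.2
    have ht : π t = 1 := t.2
    have e1 : (t : FreeGroup ι) * g = g * r := by rw [e]; group
    have h1 := h t g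
    have h2 := h g r
    rw [ht, cocycle_one_fst hc] at h1
    rw [hr, cocycle_one_snd hc] at h2
    rw [e1] at h1
    linear_combination h2 - h1

/-- The invariant homomorphism of a cocycle. -/
def transgression (hR : InFrattini π.ker) : cocycles₂ (triv V) →ₗ[ZMod 3] invHoms π.ker where
  toFun c := ⟨_, (exists_isPrimitive π c.2).choose_spec.mem_invHoms c.2⟩
  map_add' c c' := by
    apply Subtype.ext
    funext r
    have h := (exists_isPrimitive π c.2).choose_spec
    have h' := (exists_isPrimitive π c'.2).choose_spec
    have := (exists_isPrimitive π (c + c').2).choose_spec.unique hR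
      (k' := fun f => (exists_isPrimitive π c.2).choose f + (exists_isPrimitive π c'.2).choose f)
      (fun f g => by dsimp only; rw [h, h', Submodule.coe_add, Pi.add_apply]; ring) r.2
    simp only [Submodule.coe_add, Pi.add_apply] at this ⊢
    rw [this]; ring
  map_smul' a c := by
    apply Subtype.ext
    funext r
    have h := (exists_isPrimitive π c.2).choose_spec
    have := (exists_isPrimitive π (a • c).2).choose_spec.unique hR
      (k' := fun f => a * (exists_isPrimitive π c.2).choose f)
      (fun f g => by dsimp only; rw [h, Submodule.coe_smul, Pi.smul_apply, smul_eq_mul]; ring) r.2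
    simp only [Submodule.coe_smul, Pi.smul_apply, smul_eq_mul, RingHom.id_apply] at this ⊢
    rw [this]; ring

theorem transgression_apply (hR : InFrattini π.ker) (c : cocycles₂ (triv V))
    {k : FreeGroup ι → ZMod 3} (h : IsPrimitive π c.1 k) (r : π.ker) :
    (transgression hR c).1 r = k r + c.1 (1, 1) := by
  have := (exists_isPrimitive π c.2).choose_spec.unique hR h r.2
  exact congrArg (· + c.1 (1, 1)) this

/-- A set-theoretic section `τ` of `π` gives the cocycle `χ(τ(g) τ(h) τ(gh)⁻¹)` with primitive `χ(f
τ(π f)⁻¹)`. The cocycle identity then follows from associativity in the free group. -/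
theorem transgression_surjective (hπ : Function.Surjective π) (hR : InFrattini π.ker) :
    Function.Surjective (transgression hR) := by
  rintro ⟨χ, h1, h2⟩
  let τ := Function.surjInv hπ
  have hτ : ∀ v, π (τ v) = v := Function.surjInv_eq hπ
  have hk : ∀ f, f * (τ (π f))⁻¹ ∈ π.ker := fun f => by
    rw [MonoidHom.mem_ker, map_mul, map_inv, hτ, mul_inv_cancel]
  have hc : ∀ p : V × V, τ p.1 * τ p.2 * (τ (p.1 * p.2))⁻¹ ∈ π.ker := fun p => by
    rw [MonoidHom.mem_ker, map_mul, map_mul, map_inv, hτ, hτ, hτ, mul_inv_cancel]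
  let k : FreeGroup ι → ZMod 3 := fun f => χ ⟨_, hk f⟩
  let c : V × V → ZMod 3 := fun p => χ ⟨_, hc p⟩
  have hp : IsPrimitive π c k := by
    intro f g
    have hg : τ (π f) * (g * (τ (π g))⁻¹) * (τ (π f))⁻¹ ∈ π.ker :=
      (inferInstance : π.ker.Normal).conj_mem _ (hk g) _
    have e : (⟨_, hk (f * g)⟩ : π.ker) = ⟨_, hk f⟩ * ⟨_, hg⟩ * ⟨_, hc (π f, π g)⟩ := by
      apply Subtype.ext
      simp only [Subgroup.coe_mul, map_mul]
      group
    change χ _ = χ _ + χ _ + χ _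
    rw [e, h1, h1, h2 (τ (π f)) ⟨_, hk g⟩ ⟨_, hg⟩ rfl]
  have hcc : c ∈ cocycles₂ (triv V) := by
    rw [mem_cocycles_iff]
    intro g h j
    obtain ⟨g, rfl⟩ := hπ g
    obtain ⟨h, rfl⟩ := hπ h
    obtain ⟨j, rfl⟩ := hπ j
    have e1 := hp (g * h) j
    have e2 := hp g h
    have e3 := hp h j
    have e4 := hp g (h * j)
    rw [map_mul] at e1 e4
    rw [← mul_assoc] at e4
    linear_combination e4 - e1 - e2 + e3
  refine ⟨⟨c, hcc⟩, Subtype.ext (funext fun r => ?_)⟩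
  rw [transgression_apply hR ⟨c, hcc⟩ hp r]
  change χ _ + χ _ = χ r
  rw [← h1]
  congr 1
  apply Subtype.ext
  have hr : π r = 1 := r.2
  simp only [Subgroup.coe_mul, hr, mul_one]
  group

/-- If the transgression vanishes, a primitive is constant on the fibres of `π`, and its negative
descends to a cochain on `V` bounding the cocycle. -/
theorem transgression_eq_zero_iff (hπ : Function.Surjective π) (hR : InFrattini π.ker)
    (c : cocycles₂ (triv V)) : transgression hR c = 0 ↔ c.1 ∈ coboundaries₂ (triv V) := by
  rw [mem_coboundaries_iff]
  constructor
  · intro h0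
    obtain ⟨k, hk⟩ := exists_isPrimitive π c.2
    have hz : ∀ f ∈ π.ker, k f + c.1 (1, 1) = 0 := fun f hf => by
      rw [← transgression_apply hR c hk ⟨f, hf⟩, h0]; rfl
    have hkk : ∀ f g, π f = π g → k f = k g := fun f g e => by
      have h1 := hk (f * g⁻¹) g
      have h2 : π (f * g⁻¹) = 1 := by rw [map_mul, map_inv, e, mul_inv_cancel]
      rw [inv_mul_cancel_right, h2, cocycle_one_fst c.2] at h1
      have h3 := hz _ h2
      linear_combination h1 + h3
    have hτ : ∀ v, π (Function.surjInv hπ v) = v := Function.surjInv_eq hπ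
    refine ⟨fun v => -k (Function.surjInv hπ v), fun g h => ?_⟩
    have h1 := hk (Function.surjInv hπ g) (Function.surjInv hπ h)
    rw [hτ, hτ, hkk _ (Function.surjInv hπ (g * h)) (by rw [map_mul, hτ, hτ, hτ])] at h1
    linear_combination -h1
  · rintro ⟨β, hβ⟩
    apply Subtype.ext
    funext r
    have hr : π r = 1 := r.2
    have hp : IsPrimitive π c.1 (fun f => -β (π f)) := fun f g => by
      dsimp only
      rw [hβ, map_mul]; ring
    rw [transgression_apply hR c hp, hβ, hr, mul_one]
    simp

/-- Hopf's formula for the second cohomology with coefficients in `𝔽₃`. -/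
theorem cohomologyRank_two (hπ : Function.Surjective π) (hR : InFrattini π.ker) :
    cohomologyRank 3 V 2 = Module.finrank (ZMod 3) (invHoms π.ker) := by
  have hs : Function.Surjective (H2π (triv V)).hom :=
    (ModuleCat.epi_iff_surjective (H2π (triv V))).1 inferInstance
  have hk : LinearMap.ker (H2π (triv V)).hom = LinearMap.ker (transgression hR) := by
    ext c
    rw [LinearMap.mem_ker, LinearMap.mem_ker, transgression_eq_zero_iff hπ hR]
    exact H2π_eq_zero_iff c
  have e1 := (LinearMap.quotKerEquivOfSurjective _ hs).finrank_eq
  have e2 := (LinearMap.quotKerEquivOfSurjective _ (transgression_surjective hπ hR)).finrank_eq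
  rw [hk] at e1
  exact e1.symm.trans e2

theorem cohomologyRank_one :
    cohomologyRank 3 V 1 = Module.finrank (ZMod 3) (Additive V →+ ZMod 3) :=
  (H1IsoOfIsTrivial (triv V)).toLinearEquiv.finrank_eq

end Hopf

end

noncomputable section

/-! ### Generator and relation rank of two-generated 3-groups -/

namespace Hopf

open SmallGroups TwoGenerated Magnus

theorem add_hom_eq {ξ : FreeGroup (Fin 2) → ZMod 3} (h : ∀ f g, ξ (f * g) = ξ f + ξ g)
    (f : FreeGroup (Fin 2)) : ξ f = expo 0 f * ξ x + expo 1 f * ξ y := by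
  let Ξ : FreeGroup (Fin 2) →* Multiplicative (ZMod 3) := MonoidHom.mk' ξ h
  let Ξ' : FreeGroup (Fin 2) →* Multiplicative (ZMod 3) :=
    MonoidHom.mk' (fun f => Multiplicative.ofAdd (expo 0 f * ξ x + expo 1 f * ξ y : ZMod 3))
      (fun f g => by
        rw [← ofAdd_add, expo_mul, expo_mul]
        push_cast
        congr 1
        ring)
  have : Ξ = Ξ' := by
    ext i
    fin_cases i
    · change ξ x = expo 0 x * ξ x + expo 1 x * ξ y
      rw [expo_of, expo_of]; simp
    · change ξ y = expo 0 y * ξ x + expo 1 y * ξ y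
      rw [expo_of, expo_of]; simp
  exact DFunLike.congr_fun this f

variable {R : Subgroup (FreeGroup (Fin 2))}

theorem inFrattini_iff : InFrattini R ↔
    ∀ r ∈ R, (expo 0 r : ZMod 3) = 0 ∧ (expo 1 r : ZMod 3) = 0 := by
  constructor
  · intro h r hr
    exact ⟨h (fun f => expo 0 f) (fun f g => by rw [expo_mul, Int.cast_add]) r hr,
      h (fun f => expo 1 f) (fun f g => by rw [expo_mul, Int.cast_add]) r hr⟩
  · intro h ξ hξ r hr
    rw [add_hom_eq hξ, (h r hr).1, (h r hr).2]
    ring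

theorem three_dvd_expo (hR : InFrattini R) (i : Fin 2) {r : FreeGroup (Fin 2)} (hr : r ∈ R) :
    ∃ n, expo i r = 3 * n := by
  obtain ⟨h0, h1⟩ := inFrattini_iff.1 hR r hr
  fin_cases i
  exacts [intCast_zmod_three_eq_zero h0, intCast_zmod_three_eq_zero h1]

/-- A third of an exponent sum. -/
def third (i : Fin 2) (f : FreeGroup (Fin 2)) : ZMod 3 := ((expo i f / 3 : ℤ) : ZMod 3)

theorem third_of_expo {i : Fin 2} {f : FreeGroup (Fin 2)} {n : ℤ} (h : expo i f = 3 * n) :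
    third i f = n := by
  rw [third, h, Int.mul_ediv_cancel_left _ (by norm_num)]

theorem third_isInvHom (hR : InFrattini R) (i : Fin 2) : IsInvHom R (third i) := by
  refine ⟨fun f hf g hg => ?_, fun f hf g => ?_⟩
  · obtain ⟨n, hn⟩ := three_dvd_expo hR i hf
    obtain ⟨m, hm⟩ := three_dvd_expo hR i hg
    have h : expo i (f * g) = 3 * (n + m) := by rw [expo_mul, hn, hm]; ring
    rw [third_of_expo h, third_of_expo hn, third_of_expo hm, Int.cast_add]
  · have : expo i (g * f * g⁻¹) = expo i f := by rw [expo_mul, expo_mul, expo_inv]; ring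
    rw [third, this, third]

/-- The restriction of an invariant homomorphism. -/
def restrict {χ : FreeGroup (Fin 2) → ZMod 3} (h : IsInvHom R χ) : invHoms R :=
  ⟨fun r => χ r, fun r t => h.map_mul _ r.2 _ t.2, fun g r t e => by
    dsimp only
    rw [e, h.conj _ r.2]⟩

theorem exists_isInvHom [hn : R.Normal] (χ : invHoms R) : ∃ ψ : FreeGroup (Fin 2) → ZMod 3,
    IsInvHom R ψ ∧ ∀ r : R, ψ r = χ.1 r := by
  classical
  obtain ⟨χ, h1, h2⟩ := χ
  let ψ : FreeGroup (Fin 2) → ZMod 3 := fun f => if h : f ∈ R then χ ⟨f, h⟩ else 0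
  have hψ : ∀ f (hf : f ∈ R), ψ f = χ ⟨f, hf⟩ := fun f hf => by simp only [ψ, dif_pos hf]
  refine ⟨ψ, ⟨fun f hf g hg => ?_, fun f hf g => ?_⟩, fun r => hψ _ r.2⟩
  · rw [hψ f hf, hψ g hg, hψ _ (mul_mem hf hg), ← h1]; rfl
  · rw [hψ f hf, hψ _ (hn.conj_mem f hf g), h2 g ⟨f, hf⟩ _ rfl]

/-- The values of an invariant homomorphism at two relators. -/
def values (r₁ r₂ : R) : invHoms R →ₗ[ZMod 3] ZMod 3 × ZMod 3 where
  toFun χ := (χ.1 r₁, χ.1 r₂)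
  map_add' _ _ := rfl
  map_smul' _ _ := rfl

/-- The relators `r₁, r₂` are `x³, y³` modulo commutators. -/
structure IsCubePair (r₁ r₂ : R) : Prop where
  fst_zero : expo 0 r₁ = 3
  fst_one : expo 1 r₁ = 0
  snd_zero : expo 0 r₂ = 0
  snd_one : expo 1 r₂ = 3

/-- The thirds of the two exponent sums are dual to the two cube relators, so the relation rank is
at least two. -/
theorem values_surjective (hR : InFrattini R) {r₁ r₂ : R} (h : IsCubePair r₁ r₂) :
    Function.Surjective (values r₁ r₂) := by
  rintro ⟨a, b⟩
  refine ⟨a • restrict (third_isInvHom hR 0) + b • restrict (third_isInvHom hR 1), ?_⟩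
  rw [map_add, map_smul, map_smul]
  have e1 : values r₁ r₂ (restrict (third_isInvHom hR 0)) = (1, 0) :=
    Prod.ext ((third_of_expo (n := 1) (by rw [h.fst_zero]; rfl)).trans (by simp))
      ((third_of_expo (n := 0) (by rw [h.snd_zero]; rfl)).trans (by simp))
  have e2 : values r₁ r₂ (restrict (third_isInvHom hR 1)) = (0, 1) :=
    Prod.ext ((third_of_expo (n := 0) (by rw [h.fst_one]; rfl)).trans (by simp))
      ((third_of_expo (n := 1) (by rw [h.snd_one]; rfl)).trans (by simp))
  rw [e1, e2]
  simp

theorem finrank_invHoms_eq_two (hR : InFrattini R) {r₁ r₂ : R} (h : IsCubePair r₁ r₂)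
    (hi : Function.Injective (values r₁ r₂)) : Module.finrank (ZMod 3) (invHoms R) = 2 := by
  rw [(LinearEquiv.ofBijective _ ⟨hi, values_surjective hR h⟩).finrank_eq]
  simp

theorem values_injective (hR : InFrattini R) {r₁ r₂ : R} (h : IsCubePair r₁ r₂)
    (hf : Module.finrank (ZMod 3) (invHoms R) = 2) : Function.Injective (values r₁ r₂) := by
  have : FiniteDimensional (ZMod 3) (invHoms R) := Module.finite_of_finrank_pos (by omega)
  exact (LinearMap.injective_iff_surjective_of_finrank_eq_finrank (by rw [hf]; simp)).2
    (values_surjective hR h)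

variable {V : Type} [Group V] {π : FreeGroup (Fin 2) →* V}

theorem cohomologyRank_one_eq_two (hπ : Function.Surjective π) (hR : InFrattini π.ker) :
    cohomologyRank 3 V 1 = 2 := by
  rw [cohomologyRank_one]
  let L : (Additive V →+ ZMod 3) →ₗ[ZMod 3] ZMod 3 × ZMod 3 :=
    { toFun := fun ξ => (ξ (Additive.ofMul (π x)), ξ (Additive.ofMul (π y)))
      map_add' := fun _ _ => rfl
      map_smul' := fun _ _ => rfl }
  have hi : Function.Injective L := by
    rw [← LinearMap.ker_eq_bot, LinearMap.ker_eq_bot']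
    intro ξ hξ
    apply DFunLike.ext
    intro v
    obtain ⟨f, hf⟩ := hπ v.toMul
    have := add_hom_eq (ξ := fun f => ξ (Additive.ofMul (π f)))
      (fun f g => by rw [map_mul, ofMul_mul, map_add]) f
    have h1 : ξ (Additive.ofMul (π x)) = 0 := congrArg Prod.fst hξ
    have h2 : ξ (Additive.ofMul (π y)) = 0 := congrArg Prod.snd hξ
    rw [h1, h2, mul_zero, mul_zero, add_zero, hf] at this
    exact this
  have hs : Function.Surjective L := by
    rintro ⟨a, b⟩
    let Ξ : FreeGroup (Fin 2) →* Multiplicative (ZMod 3) :=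
      MonoidHom.mk' (fun f => Multiplicative.ofAdd (expo 0 f * a + expo 1 f * b : ZMod 3))
        (fun f g => by
          rw [← ofAdd_add, expo_mul, expo_mul]
          push_cast
          congr 1
          ring)
    have hk : π.ker ≤ Ξ.ker := fun r hr => by
      obtain ⟨h0, h1⟩ := inFrattini_iff.1 hR r hr
      change (expo 0 r * a + expo 1 r * b : ZMod 3) = 0
      rw [h0, h1]; ring
    let f := π.liftOfSurjective hπ ⟨Ξ, hk⟩
    have hf : ∀ g, f (π g) = Ξ g := MonoidHom.liftOfRightInverse_comp_apply π _ _ ⟨Ξ, hk⟩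
    refine ⟨MonoidHom.toAdditiveLeft f, Prod.ext ?_ ?_⟩
    · change (f (π x)).toAdd = a
      rw [hf]
      change (expo 0 x * a + expo 1 x * b : ZMod 3) = a
      rw [expo_of, expo_of]; simp
    · change (f (π y)).toAdd = b
      rw [hf]
      change (expo 0 y * a + expo 1 y * b : ZMod 3) = b
      rw [expo_of, expo_of]; simp
  rw [(LinearEquiv.ofBijective L ⟨hi, hs⟩).finrank_eq]
  simp

end Hopf

/-! ### The two shapes give metabelian Schur `σ`-groups -/

namespace CubeShape

open Magnus SmallGroups TwoGenerated Hopf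

variable {M : CubeShape}

theorem inFrattini_J : InFrattini (J M) := by
  rw [inFrattini_iff]
  rintro r ⟨p, q, h⟩
  exact expo_eq_zero_of_lead (h.weaken (by norm_num))

/-- The relator `x³ (u^α v^β)⁻¹`. -/
def relatorX (M : CubeShape) : FreeGroup (Fin 2) := x ^ 3 * (u ^ M.α.val * v ^ M.β.val)⁻¹

/-- The relator `y³ (u^γ v^δ)⁻¹`. -/
def relatorY (M : CubeShape) : FreeGroup (Fin 2) := y ^ 3 * (u ^ M.γ.val * v ^ M.δ.val)⁻¹

theorem relatorX_mem (M : CubeShape) : relatorX M ∈ J M := by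
  rw [← (isModel_mk M).eq_one_iff, relatorX, map_mul, map_inv, mul_inv_eq_one]
  have := (isModel_mk M).satisfied.x_cube
  simpa only [map_pow, map_mul, map_commutatorElement] using this

theorem relatorY_mem (M : CubeShape) : relatorY M ∈ J M := by
  rw [← (isModel_mk M).eq_one_iff, relatorY, map_mul, map_inv, mul_inv_eq_one]
  have := (isModel_mk M).satisfied.y_cube
  simpa only [map_pow, map_mul, map_commutatorElement] using this

theorem expo_cube_mul (i j : Fin 2) {c : FreeGroup (Fin 2)} (hc : c ∈ lcs (FreeGroup (Fin 2)) 1) :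
    expo i (FreeGroup.of j ^ 3 * c⁻¹) = if j = i then 3 else 0 := by
  rw [expo_mul, expo_inv, expo_lcs i hc, ← zpow_natCast, expo_zpow, expo_of]
  split <;> simp

theorem uv_mem (n m : ℕ) : u ^ n * v ^ m ∈ lcs (FreeGroup (Fin 2)) 1 := by
  have h2 := lcs_antitone (G := FreeGroup (Fin 2)) one_le_two
  have hs : s ∈ lcs (FreeGroup (Fin 2)) 1 := commutator_mem_lcs_one x y
  exact mul_mem (pow_mem (h2 (commutator_mem_lcs_succ hs x)) _)
    (pow_mem (h2 (commutator_mem_lcs_succ hs y)) _)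

theorem isCubePair_relators (M : CubeShape) :
    IsCubePair (⟨_, relatorX_mem M⟩ : J M) ⟨_, relatorY_mem M⟩ where
  fst_zero := expo_cube_mul 0 0 (uv_mem _ _)
  fst_one := expo_cube_mul 1 0 (uv_mem _ _)
  snd_zero := expo_cube_mul 0 1 (uv_mem _ _)
  snd_one := expo_cube_mul 1 1 (uv_mem _ _)

/-- For the two shapes of Schur type an invariant homomorphism is determined by its values at the
two cube relators. -/
theorem eq_zero_of_isInvHom (hM : M.IsSchurShape) {χ : FreeGroup (Fin 2) → ZMod 3}
    (h : IsInvHom (J M) χ) (h1 : χ (relatorX M) = 0) (h2 : χ (relatorY M) = 0)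
    {f : FreeGroup (Fin 2)} (hf : f ∈ J M) : χ f = 0 := by
  let mk := QuotientGroup.mk' h.kernel
  have hker : mk.ker = h.kernel := QuotientGroup.ker_mk' _
  have hle : h.kernel ≤ J M := fun f hf => (h.mem_kernel.1 hf).1
  let p : FreeGroup (Fin 2) ⧸ h.kernel →* FreeGroup (Fin 2) ⧸ J M :=
    QuotientGroup.lift h.kernel (QuotientGroup.mk' (J M))
      (fun f hf => (QuotientGroup.eq_one_iff f).2 (hle hf))
  have hp : ∀ f, p (mk f) = 1 ↔ f ∈ J M := fun f => QuotientGroup.eq_one_iff f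
  have hc : p.ker ≤ Subgroup.center _ := by
    intro z hz
    obtain ⟨z, rfl⟩ := QuotientGroup.mk'_surjective _ z
    have hz : z ∈ J M := (hp z).1 hz
    rw [Subgroup.mem_center_iff]
    intro w
    obtain ⟨w, rfl⟩ := QuotientGroup.mk'_surjective _ w
    have hn := (inferInstance : (J M).Normal)
    rw [eq_comm, ← commutatorElement_eq_one_iff_mul_comm, ← map_commutatorElement,
      ← MonoidHom.mem_ker, hker, h.mem_kernel]
    refine ⟨?_, h.commutator hz w⟩
    have e : ⁅z, w⁆ = z * (w * z⁻¹ * w⁻¹) := by rw [commutatorElement_def]; group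
    rw [e]
    exact mul_mem hz (hn.conj_mem _ (inv_mem hz) w)
  -- An element of order two would die in the 3-group `F/J M`, hence lie in `J M`, where the
  -- injective value in `𝔽₃` of `χ` excludes it.
  have h2t : ∀ z : FreeGroup (Fin 2) ⧸ h.kernel, z ^ 2 = 1 → z = 1 := by
    intro z hz
    obtain ⟨z, rfl⟩ := QuotientGroup.mk'_surjective _ z
    have hz1 : p (mk z) = 1 := by
      apply eq_one_of_sq_eq_one (isModel_mk M).isPGroup
      rw [← map_pow, hz, map_one]
    rw [hp] at hz1
    rw [← map_pow, ← MonoidHom.mem_ker, hker, h.mem_kernel, h.map_pow hz1] at hz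
    rw [← MonoidHom.mem_ker, hker, h.mem_kernel]
    have key : ∀ t : ZMod 3, ((2 : ℕ) : ZMod 3) * t = 0 → t = 0 := by decide
    exact ⟨hz1, key _ hz.2⟩
  have hs : M.Satisfied (p (mk x)) (p (mk y)) := (isModel_mk M).satisfied
  have hm := hs.satisfiedMod hc
  obtain ⟨r1, r2, r3, r4, r5⟩ := hm.rigid hM h2t
  have hX : mk (relatorX M) = 1 := by
    rw [← MonoidHom.mem_ker, hker, h.mem_kernel]; exact ⟨relatorX_mem M, h1⟩
  have hY : mk (relatorY M) = 1 := by
    rw [← MonoidHom.mem_ker, hker, h.mem_kernel]; exact ⟨relatorY_mem M, h2⟩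
  rw [relatorX, map_mul, map_inv, mul_inv_eq_one] at hX
  rw [relatorY, map_mul, map_inv, mul_inv_eq_one] at hY
  simp only [map_pow, map_mul, map_commutatorElement] at hX hY
  -- Rigidity supplies every relation except the two for the cubes, which hold because `χ` vanishes
  -- on the cube relators. So `J M` lies in the kernel of `χ`.
  have hS : M.Satisfied (mk x) (mk y) :=
    ⟨r1, hm.central.u_cube hm.s_cube, hm.central.v_cube hm.s_cube, r2, r3, r4, r5, hX, hY⟩
  have := hS.J_le_ker hf
  rw [hker, h.mem_kernel] at this
  exact this.2

theorem values_relators_injective (hM : M.IsSchurShape) :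
    Function.Injective (values (⟨_, relatorX_mem M⟩ : J M) ⟨_, relatorY_mem M⟩) := by
  rw [← LinearMap.ker_eq_bot, LinearMap.ker_eq_bot']
  intro χ hχ
  obtain ⟨ψ, hψ, hψχ⟩ := exists_isInvHom χ
  apply Subtype.ext
  funext r
  rw [← hψχ]
  exact eq_zero_of_isInvHom hM hψ ((hψχ ⟨_, relatorX_mem M⟩).trans (congrArg Prod.fst hχ))
    ((hψχ ⟨_, relatorY_mem M⟩).trans (congrArg Prod.snd hχ)) r.2

/-- The automorphism of the free group which inverts the generators. -/
def invGen : FreeGroup (Fin 2) →* FreeGroup (Fin 2) := liftPair x⁻¹ y⁻¹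

@[simp] theorem invGen_x : invGen x = x⁻¹ := liftPair_x _ _

@[simp] theorem invGen_y : invGen y = y⁻¹ := liftPair_y _ _

theorem invGen_invGen (f : FreeGroup (Fin 2)) : invGen (invGen f) = f := by
  have : invGen.comp invGen = MonoidHom.id _ := by
    ext i
    fin_cases i
    · change invGen (invGen x) = x
      simp
    · change invGen (invGen y) = y
      simp
  exact DFunLike.congr_fun this f

variable {V : Type} [Group V] {π : FreeGroup (Fin 2) →* V}

/-- Minus the identity is a base change from every shape to itself, since both sides of the cube
relations are odd. -/
theorem IsModel.isModel_comp_invGen (h : M.IsModel π) : M.IsModel (π.comp invGen) := by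
  have hs : Function.Surjective (π.comp invGen) := fun v => by
    obtain ⟨f, rfl⟩ := h.surjective v
    exact ⟨invGen f, by rw [MonoidHom.comp_apply, invGen_invGen]⟩
  refine Satisfied.isModel ?_ (closure_pair_map _ hs closure_xy) h.card_eq
  have hx := lead_one x⁻¹
  have hy := lead_one y⁻¹
  simp only [expo_inv, expo_of, reduceIte] at hx hy
  simp only [MonoidHom.comp_apply, invGen_x, invGen_y]
  rw [satisfied_iff h.ker_eq hx hy]
  simp [CubeShape.IsBaseChange]

theorem IsModel.exists_mulEquiv {V' : Type} [Group V'] {π' : FreeGroup (Fin 2) →* V'}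
    (h : M.IsModel π) (h' : M.IsModel π') : ∃ e : V ≃* V', ∀ f, e (π f) = π' f := by
  refine ⟨((QuotientGroup.quotientKerEquivOfSurjective π h.surjective).symm.trans
    (QuotientGroup.quotientMulEquivOfEq (h.ker_eq.trans h'.ker_eq.symm))).trans
    (QuotientGroup.quotientKerEquivOfSurjective π' h'.surjective), fun f => ?_⟩
  have : (QuotientGroup.quotientKerEquivOfSurjective π h.surjective).symm (π f) =
      QuotientGroup.mk f := by
    rw [MulEquiv.symm_apply_eq]; rfl
  rw [MulEquiv.trans_apply, MulEquiv.trans_apply, this]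
  rfl

theorem mem_lcs_one_iff {v : V} : v ∈ lcs V 1 ↔ Abelianization.of v = 1 := by
  rw [← MonoidHom.mem_ker, Abelianization.ker_of]
  exact iff_of_eq (congrArg (v ∈ ·) Subgroup.top_lowerCentralSeries_one)

theorem IsModel.isSigmaGroup (h : M.IsModel π) : IsSigmaGroup V := by
  obtain ⟨σ, hσ⟩ := h.exists_mulEquiv h.isModel_comp_invGen
  refine ⟨σ, fun g => ?_⟩
  obtain ⟨f, rfl⟩ := h.surjective g
  rw [hσ]
  have : ((Abelianization.of).comp π).comp invGen = (invMonoidHom.comp Abelianization.of).comp π := by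
    ext i
    fin_cases i
    · change Abelianization.of (π (invGen x)) = (Abelianization.of (π x))⁻¹
      simp
    · change Abelianization.of (π (invGen y)) = (Abelianization.of (π y))⁻¹
      simp
  exact DFunLike.congr_fun this f

/-- The exponent sums modulo `3`. -/
def expoPair : FreeGroup (Fin 2) →* Multiplicative (ZMod 3) × Multiplicative (ZMod 3) :=
  MonoidHom.mk' (fun f => (Multiplicative.ofAdd (expo 0 f : ZMod 3),
    Multiplicative.ofAdd (expo 1 f : ZMod 3))) (fun f g => by
      rw [expo_mul, expo_mul, Int.cast_add, Int.cast_add, ofAdd_add, ofAdd_add]; rfl)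

theorem expoPair_eq_one_iff {f : FreeGroup (Fin 2)} :
    expoPair f = 1 ↔ (expo 0 f : ZMod 3) = 0 ∧ (expo 1 f : ZMod 3) = 0 := by
  rw [Prod.ext_iff]; rfl

theorem expoPair_surjective : Function.Surjective expoPair := by
  rintro ⟨a, b⟩
  refine ⟨x ^ (a.toAdd.val : ℤ) * y ^ (b.toAdd.val : ℤ), ?_⟩
  refine Prod.ext ?_ ?_
  · change ((expo 0 _ : ℤ) : ZMod 3) = a.toAdd
    simp [expo_mul, expo_zpow, expo_of]
  · change ((expo 1 _ : ℤ) : ZMod 3) = b.toAdd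
    simp [expo_mul, expo_zpow, expo_of]

theorem map_mem_lcs_one_iff (hR : InFrattini π.ker) (hπ : Function.Surjective π)
    (hx : π x ^ 3 ∈ lcs V 1) (hy : π y ^ 3 ∈ lcs V 1) {f : FreeGroup (Fin 2)} :
    π f ∈ lcs V 1 ↔ expoPair f = 1 := by
  rw [expoPair_eq_one_iff]
  constructor
  · intro hf
    rw [← map_lcs π hπ] at hf
    obtain ⟨g, hg, e⟩ := hf
    have hk : f * g⁻¹ ∈ π.ker := by rw [MonoidHom.mem_ker, map_mul, map_inv, e, mul_inv_cancel]
    have := inFrattini_iff.1 hR _ hk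
    rw [expo_mul, expo_mul, expo_inv, expo_inv, expo_lcs _ hg, expo_lcs _ hg] at this
    simpa using this
  · rintro ⟨h0, h1⟩
    obtain ⟨n, m, k, c, hc, -, -, rfl⟩ := exists_form_of_expo h0 h1
    have hs : s ∈ lcs (FreeGroup (Fin 2)) 1 := commutator_mem_lcs_one x y
    have hsc := map_mem_lcs π (mul_mem (zpow_mem hs k) (lcs_antitone one_le_two hc))
    simp only [map_mul, map_zpow, zpow_mul] at hsc ⊢
    norm_cast
    exact mul_mem (mul_mem (zpow_mem hx _) (zpow_mem hy _)) hsc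

theorem IsModel.hasAbelianizationThreeThree (h : M.IsModel π) : HasAbelianizationThreeThree V := by
  have h12 := lcs_antitone (G := V) one_le_two
  have hR : InFrattini π.ker := by rw [h.ker_eq]; exact inFrattini_J
  have hi : ∀ f, π f ∈ lcs V 1 ↔ expoPair f = 1 := fun f =>
    map_mem_lcs_one_iff hR h.surjective (h12 h.x_cube_mem) (h12 h.y_cube_mem)
  let q : FreeGroup (Fin 2) →* Abelianization V := Abelianization.of.comp π
  have hq : Function.Surjective q := (QuotientGroup.mk'_surjective _).comp h.surjective
  have hk : q.ker = expoPair.ker := by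
    ext f
    rw [MonoidHom.mem_ker, MonoidHom.mem_ker, ← hi, mem_lcs_one_iff]; rfl
  exact ⟨((QuotientGroup.quotientKerEquivOfSurjective q hq).symm.trans
    (QuotientGroup.quotientMulEquivOfEq hk)).trans
    (QuotientGroup.quotientKerEquivOfSurjective expoPair expoPair_surjective)⟩

theorem derivedSeries_two_eq : derivedSeries V 2 = ⁅lcs V 1, lcs V 1⁆ := by
  have : lcs V 1 = derivedSeries V 1 := by
    rw [derivedSeries_one]; exact Subgroup.top_lowerCentralSeries_one
  rw [this]; rfl

theorem IsModel.isMetabelian (h : M.IsModel π) : IsMetabelian V := by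
  rw [IsMetabelian, derivedSeries_two_eq, eq_bot_iff, Subgroup.commutator_le]
  intro a ha b hb
  obtain ⟨k, c, hc, rfl⟩ := exists_form_lcs_one h.closure_eq ha
  obtain ⟨l, d, hd, rfl⟩ := exists_form_lcs_one h.closure_eq hb
  have hz := lcs_le_center h.lcs_three
  rw [commutatorElement_mul_central (hz hc) (hz hd), Subgroup.mem_bot,
    commutatorElement_eq_one_iff_mul_comm]
  exact (Commute.refl _).zpow_zpow k l

theorem IsModel.isFiniteSchurSigmaGroup (hM : M.IsSchurShape) (h : M.IsModel π) :
    IsFiniteSchurSigmaGroup 3 V where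
  finite := h.finite
  isPGroup := h.isPGroup
  balanced := by
    have hR : InFrattini π.ker := by rw [h.ker_eq]; exact inFrattini_J
    rw [cohomologyRank_one_eq_two h.surjective hR, cohomologyRank_two h.surjective hR, h.ker_eq]
    exact finrank_invHoms_eq_two inFrattini_J (isCubePair_relators M)
      (values_relators_injective hM)
  sigma := h.isSigmaGroup

end CubeShape

end

noncomputable section

/-! ### The weight five obstruction for metabelian Schur `σ`-groups -/

namespace CubeShape

open Magnus SmallGroups TwoGenerated Hopf

variable {M : CubeShape}

/-- The word form with values `φ(ℓ) ψ(B)` on the brackets `[ℓ, B]` with `ℓ` of weight four. -/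
abbrev schurForm (M : CubeShape) (a b c e p q : ZMod 3) : List (ZMod 3 × List (Fin 2)) :=
  [(a * p, [0, 0, 0, 0, 1]), (-(a * q), [0, 0, 0, 1, 1]), (a * q - b * p, [0, 0, 1, 0, 1]),
    (c * p, [0, 0, 1, 1, 1]), (b * q - c * p, [0, 1, 0, 1, 1]), (-(c * q), [0, 1, 1, 1, 1]),
    (e * p, [0, 0, 1]), (-(e * q), [0, 1, 1]), (e * (M.α * p + M.β * q), [0, 0, 0]),
    (e * (M.γ * p + M.δ * q), [1, 1, 1])]

theorem schurForm_brackets (M : CubeShape) (a b c e p q : ZMod 3) {t}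
    (ht : t = schurForm M a b c e p q) :
    (wordForm t ⁅⁅P X, X⁆, X⁆ = 0 ∧ wordForm t ⁅⁅P X, X⁆, Y⁆ = 0) ∧
    (wordForm t ⁅⁅P X, Y⁆, X⁆ = -(a + e) * p ∧ wordForm t ⁅⁅P X, Y⁆, Y⁆ = -(a + e) * q) ∧
    (wordForm t ⁅⁅P Y, X⁆, X⁆ = (c + e) * p ∧ wordForm t ⁅⁅P Y, X⁆, Y⁆ = (c + e) * q) ∧
    (wordForm t ⁅⁅P Y, Y⁆, X⁆ = 0 ∧ wordForm t ⁅⁅P Y, Y⁆, Y⁆ = 0) ∧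
    (wordForm t ⁅⁅U, X⁆, X⁆ = a * p ∧ wordForm t ⁅⁅U, X⁆, Y⁆ = a * q) ∧
    (wordForm t ⁅⁅U, Y⁆, X⁆ = b * p ∧ wordForm t ⁅⁅U, Y⁆, Y⁆ = b * q) ∧
    (wordForm t ⁅⁅W, X⁆, X⁆ = b * p ∧ wordForm t ⁅⁅W, X⁆, Y⁆ = b * q) ∧
    (wordForm t ⁅⁅W, Y⁆, X⁆ = c * p ∧ wordForm t ⁅⁅W, Y⁆, Y⁆ = c * q) := by
  subst ht
  rw [P_X, P_Y]
  refine ⟨⟨?_, ?_⟩, ⟨?_, ?_⟩, ⟨?_, ?_⟩, ⟨?_, ?_⟩, ⟨?_, ?_⟩, ⟨?_, ?_⟩, ⟨?_, ?_⟩, ⟨?_, ?_⟩⟩ <;>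
  simp only [schurForm, wordForm, List.map_cons, List.map_nil, List.sum_cons, List.sum_nil,
    LinearMap.add_apply, LinearMap.smul_apply, LinearMap.zero_apply, Ring.lie_def, U_eq, W_eq, X, Y,
    rletter_eq_mono, mul_add, add_mul, mul_sub, sub_mul, mul_neg, neg_mul, mono_mul,
    List.cons_append, List.nil_append, map_add, map_sub, map_neg, cf_mono] <;> simp <;> ring

theorem schurForm_cubes (M : CubeShape) (a b c e p q : ZMod 3) {t}
    (ht : t = schurForm M a b c e p q) :
    wordForm t (P X) = e * (M.α * p + M.β * q) ∧ wordForm t (P Y) = e * (M.γ * p + M.δ * q) ∧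
      wordForm t U = e * p ∧ wordForm t W = e * q := by
  subst ht
  rw [P_X, P_Y]
  refine ⟨?_, ?_, ?_, ?_⟩ <;>
  simp only [schurForm, wordForm, List.map_cons, List.map_nil, List.sum_cons, List.sum_nil,
    LinearMap.add_apply, LinearMap.smul_apply, LinearMap.zero_apply, U_eq, W_eq, mul_add, map_add,
    map_neg, cf_mono] <;> simp

/-- By the Jacobi identity `[S,U] = [[U,X],Y] - [[U,Y],X]`, and likewise for `W`; the values are
those of `schurForm_brackets`. -/
theorem schurForm_weight_five (M : CubeShape) (a b c e p q : ZMod 3) {t}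
    (ht : t = schurForm M a b c e p q) :
    wordForm t ⁅S, U⁆ = a * q - b * p ∧ wordForm t ⁅S, W⁆ = b * q - c * p := by
  subst ht
  refine ⟨?_, ?_⟩ <;>
  simp only [schurForm, wordForm, List.map_cons, List.map_nil, List.sum_cons, List.sum_nil,
    LinearMap.add_apply, LinearMap.smul_apply, LinearMap.zero_apply, Ring.lie_def, S_eq, U_eq, W_eq,
    mul_add, add_mul, mul_sub, sub_mul, mul_neg, neg_mul, mono_mul, List.cons_append,
    List.nil_append, map_add, map_sub, map_neg, cf_mono] <;> simp

/-- This is the purpose of the coefficients at `XXX` and `YYY`: they make the form vanish on the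
relator terms of weight three, so that its lift takes values in multiples of nine on `J M`. -/
theorem schurForm_relation (M : CubeShape) (a b c e p q k l : ZMod 3) :
    wordForm (schurForm M a b c e p q) (k • P X + l • P Y + (-(k * M.α + l * M.γ)) • U +
      (-(k * M.β + l * M.δ)) • W) = 0 := by
  obtain ⟨h1, h2, h3, h4⟩ := schurForm_cubes M a b c e p q rfl
  generalize P X = A at *
  generalize P Y = B at *
  simp only [map_add, map_smul, smul_eq_mul, h1, h2, h3, h4]
  ring

/-- On these double brackets the form is the descent form times the linear form `X ↦ p`, `Y ↦ q`, so
the descent equations annihilate it. -/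
theorem Descent.schurForm_bracket {a b c e : ZMod 3} (h : Descent M a b c e)
    (p q k l i j i' j' : ZMod 3) :
    wordForm (schurForm M a b c e p q) ⁅⁅k • P X + l • P Y + (-(k * M.α + l * M.γ)) • U +
      (-(k * M.β + l * M.δ)) • W, i • X + j • Y⁆, i' • X + j' • Y⁆ = 0 := by
  obtain ⟨⟨h1, h1'⟩, ⟨h2, h2'⟩, ⟨h3, h3'⟩, ⟨h4, h4'⟩, ⟨h5, h5'⟩, ⟨h6, h6'⟩, ⟨h7, h7'⟩, ⟨h8, h8'⟩⟩ :=
    schurForm_brackets M a b c e p q rfl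
  generalize P X = A at *
  generalize P Y = B at *
  simp only [bracket_add, add_bracket, bracket_smul, smul_bracket, map_add, map_smul, smul_eq_mul,
    h1, h2, h3, h4, h5, h6, h7, h8, h1', h2', h3', h4', h5', h6', h7', h8']
  linear_combination (i' * p + j' * q) *
    (-(i * k) * h.xx - j * l * h.yy - j * k * h.yx + i * l * h.xy)

theorem expo_invGen (i : Fin 2) (f : FreeGroup (Fin 2)) : expo i (invGen f) = -expo i f := by
  have : (expoHom i).comp invGen = invMonoidHom.comp (expoHom i) := by
    ext j
    fin_cases j
    · change expoHom i (invGen x) = (expoHom i x)⁻¹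
      simp
    · change expoHom i (invGen y) = (expoHom i y)⁻¹
      simp
  exact congrArg Multiplicative.toAdd (DFunLike.congr_fun this f)

theorem lead_invGen_s : Lead 2 (magnus (invGen s)) S := by
  have hx := lead_x.inv one_ne_zero
  have hy := lead_y.inv one_ne_zero
  rw [← map_inv] at hx hy
  rw [map_commutatorElement, invGen_x, invGen_y]
  convert lead_comm 2 one_ne_zero one_ne_zero rfl hy hx using 1
  rw [S]
  simp only [Ring.lie_def, neg_mul_neg]

theorem lead_invGen_u : Lead 3 (magnus (invGen u)) (-U) := by
  have hx := lead_x.inv one_ne_zero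
  rw [← map_inv] at hx
  rw [map_commutatorElement, invGen_x]
  convert lead_comm 3 two_ne_zero one_ne_zero rfl lead_invGen_s hx using 1
  rw [U]
  simp only [Ring.lie_def, mul_neg, neg_mul]
  abel

theorem lead_invGen_v : Lead 3 (magnus (invGen v)) (-W) := by
  have hy := lead_y.inv one_ne_zero
  rw [← map_inv] at hy
  rw [map_commutatorElement, invGen_y]
  convert lead_comm 3 two_ne_zero one_ne_zero rfl lead_invGen_s hy using 1
  rw [W]
  simp only [Ring.lie_def, mul_neg, neg_mul]
  abel

/-- The coefficient of a word in the leading term. -/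
def leadCoeff (w : List (Fin 2)) (n : ℕ) (f : FreeGroup (Fin 2)) : ZMod 3 :=
  divNine (level [(1, w)] (5 - n) f)

theorem leadCoeff_eq {w : List (Fin 2)} {n : ℕ} (hn : n ≤ 5) {f : FreeGroup (Fin 2)} {z : RedAlg}
    (h : Lead n (magnus f) z) : leadCoeff w n f = cf w z := by
  rw [leadCoeff, level_eq_nine _ h (by omega), divNine_nine]
  simp [wordForm]

theorem leadCoeff_isInvHom (w : List (Fin 2)) {n : ℕ} (hn : n ≠ 0) (hn' : n ≤ 5)
    {R : Subgroup (FreeGroup (Fin 2))} (hR : ∀ r ∈ R, ∃ z, Lead n (magnus r) z) :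
    IsInvHom R (leadCoeff w n) := by
  refine ⟨fun f hf g hg => ?_, fun f hf g => ?_⟩
  · obtain ⟨z, hz⟩ := hR f hf
    obtain ⟨z', hz'⟩ := hR g hg
    have h := hz.mul hn hz'
    rw [← map_mul] at h
    rw [leadCoeff_eq hn' h, leadCoeff_eq hn' hz, leadCoeff_eq hn' hz', map_add]
  · obtain ⟨z, hz⟩ := hR f hf
    rw [leadCoeff_eq hn' hz, leadCoeff_eq hn' (lead_conj hz g)]

/-- The properties of the relation subgroup of a metabelian Schur `σ`-group. -/
structure IsSchurKernel (R : Subgroup (FreeGroup (Fin 2))) : Prop where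
  normal : R.Normal
  inFrattini : InFrattini R
  invGen_mem : ∀ r ∈ R, invGen r ∈ R
  exists_eq : ∀ χ, IsInvHom R χ → ∃ a b : ZMod 3, ∀ r ∈ R, χ r = a * third 0 r + b * third 1 r
  commutator_mem : ∀ f ∈ lcs (FreeGroup (Fin 2)) 1, ∀ g ∈ lcs (FreeGroup (Fin 2)) 1, ⁅f, g⁆ ∈ R

namespace IsSchurKernel

variable {R : Subgroup (FreeGroup (Fin 2))} {χ : FreeGroup (Fin 2) → ZMod 3}

theorem eq_zero_of_mem_lcs (h : IsSchurKernel R) (hχ : IsInvHom R χ) {r : FreeGroup (Fin 2)}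
    (hr : r ∈ R) (hr' : r ∈ lcs (FreeGroup (Fin 2)) 1) : χ r = 0 := by
  obtain ⟨a, b, e⟩ := h.exists_eq χ hχ
  rw [e r hr, third_of_expo (n := 0) (by rw [expo_lcs _ hr']; rfl),
    third_of_expo (n := 0) (by rw [expo_lcs _ hr']; rfl)]
  simp

theorem map_invGen (h : IsSchurKernel R) (hχ : IsInvHom R χ) {r : FreeGroup (Fin 2)}
    (hr : r ∈ R) : χ (invGen r) = -χ r := by
  obtain ⟨a, b, e⟩ := h.exists_eq χ hχ
  have h3 : ∀ i, third i (invGen r) = -third i r := fun i => by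
    obtain ⟨n, hn⟩ := three_dvd_expo h.inFrattini i hr
    have : expo i (invGen r) = 3 * (-n) := by rw [expo_invGen, hn]; ring
    rw [third_of_expo this, third_of_expo hn, Int.cast_neg]
  rw [e r hr, e _ (h.invGen_mem r hr), h3, h3]
  ring

theorem eq_zero_of_even (h : IsSchurKernel R) (hχ : IsInvHom R χ)
    (he : ∀ r ∈ R, χ (invGen r) = χ r) {r : FreeGroup (Fin 2)} (hr : r ∈ R) : χ r = 0 := by
  have h1 := h.map_invGen hχ hr
  rw [he r hr] at h1
  have key : ∀ t : ZMod 3, t = -t → t = 0 := by decide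
  exact key _ h1

theorem exists_form (h : IsSchurKernel R) {r : FreeGroup (Fin 2)} (hr : r ∈ R) :
    ∃ n m k : ℤ, ∃ c ∈ lcs (FreeGroup (Fin 2)) 2,
      expo 0 r = 3 * n ∧ expo 1 r = 3 * m ∧ r = x ^ (3 * n) * y ^ (3 * m) * (s ^ k * c) := by
  obtain ⟨h0, h1⟩ := inFrattini_iff.1 h.inFrattini r hr
  exact exists_form_of_expo h0 h1

/-- Inverting the generators fixes `S`, so its coefficient is an even invariant homomorphism,
whereas all invariant homomorphisms are odd. -/
theorem lead_two (h : IsSchurKernel R) {r : FreeGroup (Fin 2)} (hr : r ∈ R) :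
    Lead 2 (magnus r) 0 := by
  have hI : IsInvHom R (leadCoeff [1, 0] 2) :=
    leadCoeff_isInvHom _ two_ne_zero (by norm_num) fun r hr => by
      obtain ⟨n, m, k, c, hc, -, -, e⟩ := h.exists_form hr
      exact ⟨_, lead_two_of_expo hc e⟩
  have he : ∀ r ∈ R, leadCoeff [1, 0] 2 (invGen r) = leadCoeff [1, 0] 2 r := by
    intro r hr
    obtain ⟨n, m, k, c, hc, -, -, e⟩ := h.exists_form hr
    have l1 := lead_two_of_expo hc e
    have l2 : Lead 2 (magnus (invGen r)) ((k : ZMod 3) • S) := by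
      have h1 := ((lead_x.cube_one).zpow three_ne_zero (-n)).weaken (m := 2) (by norm_num)
      have h2 := ((lead_y.cube_one).zpow three_ne_zero (-m)).weaken (m := 2) (by norm_num)
      have h3 := (h1.mul two_ne_zero h2).mul two_ne_zero ((lead_invGen_s.zpow' two_ne_zero k).mul
        two_ne_zero (lead_zero_of_mem_lcs le_rfl (map_mem_lcs invGen hc)))
      rw [e]
      simp only [map_mul, map_zpow, zpow_mul, invGen_x, invGen_y, inv_zpow, ← zpow_neg]
      simpa using h3
    rw [leadCoeff_eq (by norm_num) l1, leadCoeff_eq (by norm_num) l2]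
  have h0 := h.eq_zero_of_even hI he hr
  obtain ⟨n, m, k, c, hc, -, -, e⟩ := h.exists_form hr
  have l1 := lead_two_of_expo hc e
  rw [leadCoeff_eq (by norm_num) l1, cf_S] at h0
  rwa [h0, zero_smul] at l1

theorem lead_three (h : IsSchurKernel R) {r : FreeGroup (Fin 2)} (hr : r ∈ R) :
    ∃ c d : ZMod 3,
      Lead 3 (magnus r) (third 0 r • P X + third 1 r • P Y + c • U + d • W) := by
  obtain ⟨n, m, k, l, o, d, hd, h0, h1, e⟩ := exists_form_of_lead_two (h.lead_two hr)
  rw [third_of_expo h0, third_of_expo h1]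
  exact ⟨_, _, lead_three_of_form hd e⟩

/-- The coefficients of `U` and `W` are invariant homomorphisms, hence combinations of the thirds,
which are the coefficients of `P X` and `P Y`. Such a linear dependence is a cube shape. -/
theorem exists_le_J (h : IsSchurKernel R) : ∃ M : CubeShape, R ≤ J M := by
  have hI : ∀ w, IsInvHom R (leadCoeff w 3) := fun w =>
    leadCoeff_isInvHom w three_ne_zero (by norm_num) fun r hr => by
      obtain ⟨c, d, hl⟩ := h.lead_three hr
      exact ⟨_, hl⟩
  obtain ⟨a, a', ha⟩ := h.exists_eq _ (hI [0, 0, 1])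
  obtain ⟨b, b', hb⟩ := h.exists_eq _ (hI [0, 1, 1])
  -- `J M` carries a minus sign at both `U` and `W`; at `W` it cancels against the sign of the word
  -- `XYY` in `W`.
  refine ⟨⟨-a, b, -a', b'⟩, fun r hr => ?_⟩
  obtain ⟨c, d, hl⟩ := h.lead_three hr
  obtain ⟨-, -, h3, h4⟩ := coeffs_degree_three (third 0 r) (third 1 r) c d
  have e1 := ha r hr
  have e2 := hb r hr
  rw [leadCoeff_eq (by norm_num) hl] at e1 e2
  rw [h3] at e1
  rw [e2] at h4
  rw [mem_J_iff hl]
  constructor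
  · dsimp only
    linear_combination e1
  · dsimp only
    linear_combination -h4

end IsSchurKernel

section Descent

variable {a b c e : ZMod 3} (p q : ZMod 3)

/-- The quasi-character defined by a word form of weight five. -/
def weightFive (M : CubeShape) (a b c e p q : ZMod 3) (f : FreeGroup (Fin 2)) : ZMod 3 :=
  divNine (level (schurForm M a b c e p q) 0 f)

theorem weightFive_eq {f : FreeGroup (Fin 2)} {z : RedAlg} (h : Lead 5 (magnus f) z) :
    weightFive M a b c e p q f = wordForm (schurForm M a b c e p q) z := by
  rw [weightFive, level_eq_nine _ h rfl, divNine_nine]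

/-- For `f` of weight three, `3(f - 1)` is `√3⁵` times a lift of the leading term, on which the form
vanishes by `schurForm_relation`. -/
theorem three_mul_level_of_mem_J {f : FreeGroup (Fin 2)} (hf : f ∈ J M) :
    3 * level (schurForm M a b c e p q) 0 f = 0 := by
  obtain ⟨k, l, z, hz, hm⟩ := hf
  have h1 := wordFormLift_nsmul (schurForm M a b c e p q) 3 (unif ^ 0 • ((magnus f : Alg) - 1))
  have h2 : (3 : ℕ) • (unif ^ 0 • ((magnus f : Alg) - 1)) = unif ^ 5 • z := by
    rw [hm, add_sub_cancel_left, pow_zero, one_smul, nsmul_eq_mul, Nat.cast_ofNat, three_mul_alg,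
      smul_smul, ← pow_add]
  rw [h2, wordFormLift_unif_pow_five, hz, schurForm_relation] at h1
  have h3 : nine 0 = 0 := by simp [nine]
  rw [h3] at h1
  exact_mod_cast h1.symm

theorem weightFive_mul {f g : FreeGroup (Fin 2)} (hf : f ∈ J M) (hg : g ∈ J M) :
    weightFive M a b c e p q (f * g) = weightFive M a b c e p q f + weightFive M a b c e p q g := by
  have hf' := three_mul_level_of_mem_J (a := a) (b := b) (c := c) (e := e) p q hf
  obtain ⟨k, l, hf⟩ := hf
  obtain ⟨k', l', hg⟩ := hg
  rw [weightFive, level_mul _ hf hg (by norm_num), divNine_add _ _ hf']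
  rfl

/-- The antisymmetrization of `weightFive` under the inversion of the generators. -/
def oddChar (M : CubeShape) (a b c e p q : ZMod 3) (f : FreeGroup (Fin 2)) : ZMod 3 :=
  weightFive M a b c e p q f - weightFive M a b c e p q (invGen f)

theorem oddChar_invGen (f : FreeGroup (Fin 2)) :
    oddChar M a b c e p q (invGen f) = -oddChar M a b c e p q f := by
  rw [oddChar, oddChar, invGen_invGen]; ring

variable {R : Subgroup (FreeGroup (Fin 2))}

theorem oddChar_mul (h : IsSchurKernel R) (hR : R ≤ J M) {f g : FreeGroup (Fin 2)} (hf : f ∈ R)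
    (hg : g ∈ R) :
    oddChar M a b c e p q (f * g) = oddChar M a b c e p q f + oddChar M a b c e p q g := by
  rw [oddChar, oddChar, oddChar, map_mul, weightFive_mul p q (hR hf) (hR hg),
    weightFive_mul p q (hR (h.invGen_mem f hf)) (hR (h.invGen_mem g hg))]
  ring

theorem oddChar_one (h : IsSchurKernel R) (hR : R ≤ J M) : oddChar M a b c e p q 1 = 0 := by
  have := oddChar_mul (a := a) (b := b) (c := c) (e := e) p q h hR (one_mem R) (one_mem R)
  rw [mul_one] at this
  exact left_eq_add.1 this

theorem oddChar_inv (h : IsSchurKernel R) (hR : R ≤ J M) {f : FreeGroup (Fin 2)} (hf : f ∈ R) :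
    oddChar M a b c e p q f⁻¹ = -oddChar M a b c e p q f := by
  have := oddChar_mul (a := a) (b := b) (c := c) (e := e) p q h hR hf (inv_mem hf)
  rw [mul_inv_cancel, oddChar_one p q h hR] at this
  linear_combination -this

theorem lead_five_double_bracket {r : FreeGroup (Fin 2)} (hr : r ∈ J M) (hd : Descent M a b c e)
    (f g : FreeGroup (Fin 2)) : weightFive M a b c e p q ⁅⁅r, f⁆, g⁆ = 0 := by
  obtain ⟨k, l, hr⟩ := hr
  rw [weightFive_eq p q (lead_comm 5 four_ne_zero one_ne_zero rfl
    (lead_comm 4 three_ne_zero one_ne_zero rfl hr (lead_one f)) (lead_one g))]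
  exact hd.schurForm_bracket ..

theorem oddChar_double_bracket (h : IsSchurKernel R) (hR : R ≤ J M) (hd : Descent M a b c e)
    {r : FreeGroup (Fin 2)} (hr : r ∈ R) (f g : FreeGroup (Fin 2)) :
    oddChar M a b c e p q ⁅⁅r, f⁆, g⁆ = 0 := by
  rw [oddChar, map_commutatorElement, map_commutatorElement,
    lead_five_double_bracket p q (hR hr) hd,
    lead_five_double_bracket p q (hR (h.invGen_mem r hr)) hd, sub_zero]

theorem commutator_mem_of_normal (hn : R.Normal) {r : FreeGroup (Fin 2)} (hr : r ∈ R)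
    (g : FreeGroup (Fin 2)) : ⁅r, g⁆ ∈ R := by
  have e : ⁅r, g⁆ = r * (g * r⁻¹ * g⁻¹) := by rw [commutatorElement_def]; group
  rw [e]
  exact mul_mem hr (hn.conj_mem _ (inv_mem hr) g)

theorem oddChar_conj_bracket (h : IsSchurKernel R) (hR : R ≤ J M) (hd : Descent M a b c e)
    {r : FreeGroup (Fin 2)} (hr : r ∈ R) (f g : FreeGroup (Fin 2)) :
    oddChar M a b c e p q (g * ⁅r, f⁆ * g⁻¹) = oddChar M a b c e p q ⁅r, f⁆ := by
  have h1 := commutator_mem_of_normal h.normal hr f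
  have h2 := commutator_mem_of_normal h.normal h1 g
  have e1 : g * ⁅r, f⁆ * g⁻¹ = ⁅⁅r, f⁆, g⁆⁻¹ * ⁅r, f⁆ := by
    rw [commutatorElement_def ⁅r, f⁆ g]; group
  rw [e1, oddChar_mul p q h hR (inv_mem h2) h1, oddChar_inv p q h hR h2,
    oddChar_double_bracket p q h hR hd hr, neg_zero, zero_add]

theorem oddChar_bracket_isInvHom (h : IsSchurKernel R) (hR : R ≤ J M) (hd : Descent M a b c e)
    (f : FreeGroup (Fin 2)) : IsInvHom R fun r => oddChar M a b c e p q ⁅r, f⁆ := by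
  have hm : ∀ r ∈ R, ∀ t ∈ R, oddChar M a b c e p q ⁅r * t, f⁆ =
      oddChar M a b c e p q ⁅r, f⁆ + oddChar M a b c e p q ⁅t, f⁆ := by
    intro r hr t ht
    have e1 : ⁅r * t, f⁆ = (r * ⁅t, f⁆ * r⁻¹) * ⁅r, f⁆ := by
      simp only [commutatorElement_def]; group
    rw [e1, oddChar_mul p q h hR (h.normal.conj_mem _ (commutator_mem_of_normal h.normal ht f) r)
      (commutator_mem_of_normal h.normal hr f), oddChar_conj_bracket p q h hR hd ht, add_comm]
  refine ⟨hm, fun r hr g => ?_⟩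
  have e1 : g * r * g⁻¹ = ⁅r, g⁆⁻¹ * r := by rw [commutatorElement_def]; group
  have h1 := commutator_mem_of_normal h.normal hr g
  have e2 : ⁅⁅r, g⁆⁻¹, f⁆ = ⁅r, g⁆⁻¹ * ⁅⁅r, g⁆, f⁆⁻¹ * ⁅r, g⁆⁻¹⁻¹ := by
    simp only [commutatorElement_def]; group
  have h3 := commutator_mem_of_normal h.normal h1 f
  rw [e1, hm _ (inv_mem h1) _ hr, e2]
  have h4 : ⁅r, g⁆⁻¹ * ⁅⁅r, g⁆, f⁆⁻¹ * ⁅r, g⁆⁻¹⁻¹ =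
      (⁅r, g⁆⁻¹ * ⁅⁅r, g⁆, f⁆ * ⁅r, g⁆⁻¹⁻¹)⁻¹ := by group
  rw [h4, oddChar_inv p q h hR (h.normal.conj_mem _ h3 _), oddChar_conj_bracket p q h hR hd h1,
    oddChar_double_bracket p q h hR hd hr, neg_zero, zero_add]

/-- Inverting the generators turns `⁅r, f⁆` into a conjugate of `⁅invGen r, f⁆⁻¹`. As `oddChar` is
odd, the invariant homomorphism `r ↦ oddChar ⁅r, f⁆` is even, hence zero. -/
theorem oddChar_bracket (h : IsSchurKernel R) (hR : R ≤ J M) (hd : Descent M a b c e)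
    {f : FreeGroup (Fin 2)} (hf : invGen f = f⁻¹) {r : FreeGroup (Fin 2)} (hr : r ∈ R) :
    oddChar M a b c e p q ⁅r, f⁆ = 0 := by
  refine h.eq_zero_of_even (oddChar_bracket_isInvHom p q h hR hd f) (fun r hr => ?_) hr
  have hr' := h.invGen_mem r hr
  have h1 := oddChar_invGen (M := M) (a := a) (b := b) (c := c) (e := e) p q ⁅r, f⁆
  have e1 : invGen ⁅r, f⁆ = f⁻¹ * ⁅invGen r, f⁆⁻¹ * f⁻¹⁻¹ := by
    rw [map_commutatorElement, hf]
    simp only [commutatorElement_def]; group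
  have e2 : f⁻¹ * ⁅invGen r, f⁆⁻¹ * f⁻¹⁻¹ = (f⁻¹ * ⁅invGen r, f⁆ * f⁻¹⁻¹)⁻¹ := by group
  have h2 := commutator_mem_of_normal h.normal hr' f
  rw [e1, e2, oddChar_inv p q h hR (h.normal.conj_mem _ h2 _),
    oddChar_conj_bracket p q h hR hd hr'] at h1
  exact neg_injective h1

theorem oddChar_isInvHom (h : IsSchurKernel R) (hR : R ≤ J M) (hd : Descent M a b c e) :
    IsInvHom R (oddChar M a b c e p q) := by
  refine ⟨fun f hf g hg => oddChar_mul p q h hR hf hg, fun r hr g => ?_⟩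
  have hgen : ∀ f, invGen f = f⁻¹ → ∀ r ∈ R,
      oddChar M a b c e p q (f * r * f⁻¹) = oddChar M a b c e p q r := by
    intro f hf r hr
    have e1 : f * r * f⁻¹ = ⁅r, f⁆⁻¹ * r := by rw [commutatorElement_def]; group
    have h1 := commutator_mem_of_normal h.normal hr f
    rw [e1, oddChar_mul p q h hR (inv_mem h1) hr, oddChar_inv p q h hR h1,
      oddChar_bracket p q h hR hd hf hr, neg_zero, zero_add]
  let H : Subgroup (FreeGroup (Fin 2)) :=
    { carrier := {f | ∀ r ∈ R, oddChar M a b c e p q (f * r * f⁻¹) = oddChar M a b c e p q r}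
      one_mem' := fun r _ => by simp
      mul_mem' := by
        intro f g hf hg r hr
        have e1 : f * g * r * (f * g)⁻¹ = f * (g * r * g⁻¹) * f⁻¹ := by group
        rw [e1, hf _ (h.normal.conj_mem _ hr g), hg r hr]
      inv_mem' := by
        intro f hf r hr
        have h1 := hf _ (h.normal.conj_mem _ hr f⁻¹)
        have e1 : f * (f⁻¹ * r * f⁻¹⁻¹) * f⁻¹ = r := by group
        rw [e1] at h1
        exact h1.symm }
  have hH : Subgroup.closure {x, y} ≤ H := by
    rw [Subgroup.closure_le]
    rintro z (rfl | rfl)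
    · exact hgen x invGen_x
    · exact hgen y invGen_y
  rw [closure_xy] at hH
  exact hH (Subgroup.mem_top g) r hr

theorem oddChar_eq {f : FreeGroup (Fin 2)} {z : RedAlg} (h : Lead 5 (magnus f) z)
    (h' : Lead 5 (magnus (invGen f)) (-z)) :
    oddChar M a b c e p q f = 2 * wordForm (schurForm M a b c e p q) z := by
  rw [oddChar, weightFive_eq p q h, weightFive_eq p q h', map_neg]
  ring

/-- The relation subgroup of a metabelian Schur `σ`-group does not admit a descent form. -/
theorem IsSchurKernel.not_descent (h : IsSchurKernel R) (hR : R ≤ J M) : ¬ Descent M a b c e := by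
  intro hd
  have hs : s ∈ lcs (FreeGroup (Fin 2)) 1 := commutator_mem_lcs_one x y
  have h12 := lcs_antitone (G := FreeGroup (Fin 2)) one_le_two
  have hu : u ∈ lcs (FreeGroup (Fin 2)) 1 := h12 (commutator_mem_lcs_succ hs x)
  have hv : v ∈ lcs (FreeGroup (Fin 2)) 1 := h12 (commutator_mem_lcs_succ hs y)
  -- `⁅s, u⁆` and `⁅s, v⁆` lie in `R` and have zero exponent sums, so `oddChar` vanishes on them.
  -- Their weight is odd, so it also equals twice the form there.
  have key : ∀ p q : ZMod 3, a * q - b * p = 0 ∧ b * q - c * p = 0 := by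
    intro p q
    have h2 : ∀ t : ZMod 3, 2 * t = 0 → t = 0 := by decide
    obtain ⟨e1, e2⟩ := schurForm_weight_five M a b c e p q rfl
    constructor
    · have h0 := h.eq_zero_of_mem_lcs (oddChar_isInvHom p q h hR hd) (h.commutator_mem s hs u hu)
        (h12 (commutator_mem_lcs_succ hs u))
      rw [oddChar_eq p q (lead_comm 5 two_ne_zero three_ne_zero rfl lead_s lead_u), e1] at h0
      · exact h2 _ h0
      · rw [map_commutatorElement]
        convert lead_comm 5 two_ne_zero three_ne_zero rfl lead_invGen_s lead_invGen_u using 1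
        simp only [Ring.lie_def, mul_neg, neg_mul]
        abel
    · have h0 := h.eq_zero_of_mem_lcs (oddChar_isInvHom p q h hR hd) (h.commutator_mem s hs v hv)
        (h12 (commutator_mem_lcs_succ hs v))
      rw [oddChar_eq p q (lead_comm 5 two_ne_zero three_ne_zero rfl lead_s lead_v), e2] at h0
      · exact h2 _ h0
      · rw [map_commutatorElement]
        convert lead_comm 5 two_ne_zero three_ne_zero rfl lead_invGen_s lead_invGen_v using 1
        simp only [Ring.lie_def, mul_neg, neg_mul]
        abel
  have k1 := key 0 1
  have k2 := key 1 0
  simp only [mul_one, mul_zero, sub_zero, zero_sub, neg_eq_zero] at k1 k2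
  rcases hd.ne with h0 | h0 | h0
  exacts [h0 k1.1, h0 k1.2, h0 k2.2]

end Descent

end CubeShape

end

noncomputable section

/-! ### From metabelian Schur `σ`-groups to the two shapes -/

namespace CubeShape

open Magnus SmallGroups TwoGenerated Hopf

variable {V : Type} [Group V]

theorem sigma_iterate_odd {σ : V ≃* V}
    (hσ : ∀ g, Abelianization.of (σ g) = (Abelianization.of g)⁻¹) {m : ℕ} (hm : Odd m) (g : V) :
    Abelianization.of (σ^[m] g) = (Abelianization.of g)⁻¹ := by
  have h2 : ∀ k g, Abelianization.of (σ^[2 * k] g) = Abelianization.of g := by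
    intro k
    induction k with
    | zero => intro g; rfl
    | succ k ih =>
      intro g
      have : 2 * (k + 1) = 2 * k + 2 := by ring
      rw [this, Function.iterate_add_apply, ih]
      change Abelianization.of (σ (σ g)) = _
      rw [hσ, hσ, inv_inv]
  obtain ⟨k, rfl⟩ := hm
  rw [Function.iterate_add_apply, h2]
  exact hσ g

/-- A `σ`-automorphism of a finite `3`-group may be chosen of `2`-power order. -/
theorem exists_two_power_sigma [Finite V] (h : IsSigmaGroup V) :
    ∃ (σ : V ≃* V) (n : ℕ), (∀ g, Abelianization.of (σ g) = (Abelianization.of g)⁻¹) ∧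
      ∀ g, σ^[2 ^ n] g = g := by
  obtain ⟨σ, hσ⟩ := h
  have : Finite (MulAut V) := inferInstanceAs (Finite (V ≃* V))
  let τ : MulAut V := σ
  have ho : orderOf τ ≠ 0 := (isOfFinOrder_of_finite τ).orderOf_pos.ne'
  -- Raising the automorphism to the odd part `m` of its order leaves 2-power order and still
  -- inverts the abelianization.
  obtain ⟨n, m, hm, hnm⟩ := Nat.exists_eq_two_pow_mul_odd ho
  have hit : ∀ (k : ℕ) (τ : MulAut V) g, (τ ^ k) g = τ^[k] g := fun k τ g => by
    induction k generalizing g with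
    | zero => rfl
    | succ k ih => rw [pow_succ, MulAut.mul_apply, ih, Function.iterate_succ_apply]
  refine ⟨τ ^ m, n, fun g => ?_, fun g => ?_⟩
  · have := sigma_iterate_odd hσ hm g
    rw [← this]
    exact congrArg _ (hit m τ g)
  · have h1 := hit (2 ^ n) (τ ^ m) g
    rw [← pow_mul, mul_comm, ← hnm, pow_orderOf_eq_one] at h1
    exact h1.symm

theorem odd_card_fiber [Finite V] (hV : IsPGroup 3 V) (A : Abelianization V) :
    Odd (Nat.card {g : V // Abelianization.of g = A}) := by
  have : Fact (Nat.Prime 3) := ⟨Nat.prime_three⟩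
  obtain ⟨g₀, rfl⟩ := QuotientGroup.mk'_surjective _ A
  let e : {g : V // Abelianization.of g = Abelianization.of g₀} ≃
      (Abelianization.of : V →* Abelianization V).ker :=
    { toFun := fun g => ⟨g.1 * g₀⁻¹, by
        rw [MonoidHom.mem_ker, map_mul, map_inv, g.2, mul_inv_cancel]⟩
      invFun := fun k => ⟨k.1 * g₀, by rw [map_mul, MonoidHom.mem_ker.1 k.2, one_mul]⟩
      left_inv := fun g => Subtype.ext (by simp)
      right_inv := fun k => Subtype.ext (by simp) }
  have hc := Nat.card_congr e
  obtain ⟨n, hn⟩ := (IsPGroup.iff_card.1 (hV.to_subgroup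
    (Abelianization.of : V →* Abelianization V).ker))
  rw [hn] at hc
  change Odd (Nat.card {g : V // Abelianization.of g = Abelianization.of g₀})
  rw [hc]
  exact Odd.pow (by decide)

/-- Every coset of the commutator subgroup contains an element inverted by `σ`. -/
theorem exists_inverted [Finite V] (hV : IsPGroup 3 V) {σ : V ≃* V} {n : ℕ}
    (hσ : ∀ g, Abelianization.of (σ g) = (Abelianization.of g)⁻¹) (hn : ∀ g, σ^[2 ^ n] g = g)
    (A : Abelianization V) : ∃ g : V, Abelianization.of g = A ∧ σ g = g⁻¹ := by
  classical
  have : Fintype {g : V // Abelianization.of g = A} := Fintype.ofFinite _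
  -- The fixed points of `θ` are the elements sought. They exist because `θ` has 2-power order on a
  -- coset of odd size.
  let θ : Function.End {g : V // Abelianization.of g = A} := fun g => ⟨(σ g.1)⁻¹, by
    rw [map_inv, hσ, inv_inv, g.2]⟩
  have h2 : ∀ k g, ((θ^[2 * k] g).1) = σ^[2 * k] g.1 := by
    intro k
    induction k with
    | zero => intro g; rfl
    | succ k ih =>
      intro g
      have : 2 * (k + 1) = 2 * k + 2 := by ring
      rw [this, Function.iterate_add_apply, Function.iterate_add_apply, ih]
      congr 1
      change (σ (σ g.1)⁻¹)⁻¹ = σ (σ g.1)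
      rw [map_inv, inv_inv]
  have hθ : θ ^ 2 ^ (n + 1) = 1 := by
    funext g
    apply Subtype.ext
    have h1 : θ ^ 2 ^ (n + 1) = θ^[2 ^ (n + 1)] :=
      hom_coe_pow (fun g : Function.End _ => g) rfl (fun _ _ => rfl) θ (2 ^ (n + 1))
    refine (congrArg Subtype.val (congrFun h1 g)).trans ?_
    rw [pow_succ', h2, two_mul, Function.iterate_add_apply, hn, hn]
    rfl
  have hf := Equiv.Perm.card_fixedPoints_modEq hθ
  have hodd := odd_card_fiber hV A
  rw [Nat.card_eq_fintype_card] at hodd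
  have hne : Fintype.card (Function.fixedPoints θ) ≠ 0 := by
    intro h0
    rw [h0] at hf
    have := (Nat.modEq_zero_iff_dvd.1 hf)
    exact (Nat.not_even_iff_odd.2 hodd) (even_iff_two_dvd.2 this)
  obtain ⟨⟨g, hg⟩⟩ := Fintype.card_pos_iff.1 (Nat.pos_of_ne_zero hne)
  refine ⟨g.1, g.2, ?_⟩
  have := congrArg Subtype.val hg
  change (σ g.1)⁻¹ = g.1 at this
  rw [← this, inv_inv, this]

theorem isSchurKernel_ker {π : FreeGroup (Fin 2) →* V} (hπ : Function.Surjective π)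
    (hx : π x ^ 3 ∈ lcs V 1) (hy : π y ^ 3 ∈ lcs V 1) (hR : InFrattini π.ker) {σ : V ≃* V}
    (hσx : σ (π x) = (π x)⁻¹) (hσy : σ (π y) = (π y)⁻¹)
    (hb : cohomologyRank 3 V 2 = cohomologyRank 3 V 1) (hm : IsMetabelian V) :
    IsSchurKernel π.ker where
  normal := inferInstance
  inFrattini := hR
  invGen_mem := by
    intro r hr
    have : π.comp invGen = σ.toMonoidHom.comp π := by
      ext i
      fin_cases i
      · change π (invGen x) = σ (π x)
        rw [invGen_x, map_inv, hσx]
      · change π (invGen y) = σ (π y)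
        rw [invGen_y, map_inv, hσy]
    have h := DFunLike.congr_fun this r
    rw [MonoidHom.comp_apply, MonoidHom.comp_apply, MonoidHom.mem_ker.1 hr, map_one] at h
    exact h
  exists_eq := by
    have hc : ∀ j : Fin 2, π (FreeGroup.of j) ^ 3 ∈ lcs V 1 →
        ∃ c ∈ lcs (FreeGroup (Fin 2)) 1, FreeGroup.of j ^ 3 * c⁻¹ ∈ π.ker := by
      intro j hj
      rw [← map_lcs π hπ] at hj
      obtain ⟨c, hc, e⟩ := hj
      exact ⟨c, hc, by rw [MonoidHom.mem_ker, map_mul, map_inv, e, map_pow, mul_inv_cancel]⟩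
    obtain ⟨c₁, hc₁, h₁⟩ := hc 0 hx
    obtain ⟨c₂, hc₂, h₂⟩ := hc 1 hy
    have hp : IsCubePair (⟨_, h₁⟩ : π.ker) ⟨_, h₂⟩ :=
      ⟨expo_cube_mul 0 0 hc₁, expo_cube_mul 1 0 hc₁, expo_cube_mul 0 1 hc₂, expo_cube_mul 1 1 hc₂⟩
    have hf : Module.finrank (ZMod 3) (invHoms π.ker) = 2 := by
      rw [← cohomologyRank_two hπ hR, hb, cohomologyRank_one_eq_two hπ hR]
    -- Balance makes the values at two cube relators a full set of coordinates, whence the thirds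
    -- span.
    have hi := values_injective hR hp hf
    intro χ hχ
    refine ⟨χ (FreeGroup.of 0 ^ 3 * c₁⁻¹), χ (FreeGroup.of 1 ^ 3 * c₂⁻¹), fun r hr => ?_⟩
    have e1 : third 0 (FreeGroup.of 0 ^ 3 * c₁⁻¹) = 1 :=
      (third_of_expo (n := 1) (by rw [hp.fst_zero]; rfl)).trans (by simp)
    have e2 : third 0 (FreeGroup.of 1 ^ 3 * c₂⁻¹) = 0 :=
      (third_of_expo (n := 0) (by rw [hp.snd_zero]; rfl)).trans (by simp)
    have e3 : third 1 (FreeGroup.of 0 ^ 3 * c₁⁻¹) = 0 :=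
      (third_of_expo (n := 0) (by rw [hp.fst_one]; rfl)).trans (by simp)
    have e4 : third 1 (FreeGroup.of 1 ^ 3 * c₂⁻¹) = 1 :=
      (third_of_expo (n := 1) (by rw [hp.snd_one]; rfl)).trans (by simp)
    have h : restrict hχ = χ (FreeGroup.of 0 ^ 3 * c₁⁻¹) • restrict (third_isInvHom hR 0) +
        χ (FreeGroup.of 1 ^ 3 * c₂⁻¹) • restrict (third_isInvHom hR 1) := by
      apply hi
      refine Prod.ext ?_ ?_
      · change χ (FreeGroup.of 0 ^ 3 * c₁⁻¹) =
          χ (FreeGroup.of 0 ^ 3 * c₁⁻¹) * third 0 (FreeGroup.of 0 ^ 3 * c₁⁻¹) +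
          χ (FreeGroup.of 1 ^ 3 * c₂⁻¹) * third 1 (FreeGroup.of 0 ^ 3 * c₁⁻¹)
        rw [e1, e3]; ring
      · change χ (FreeGroup.of 1 ^ 3 * c₂⁻¹) =
          χ (FreeGroup.of 0 ^ 3 * c₁⁻¹) * third 0 (FreeGroup.of 1 ^ 3 * c₂⁻¹) +
          χ (FreeGroup.of 1 ^ 3 * c₂⁻¹) * third 1 (FreeGroup.of 1 ^ 3 * c₂⁻¹)
        rw [e2, e4]; ring
    exact congrFun (congrArg Subtype.val h) ⟨r, hr⟩
  commutator_mem := by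
    intro f hf g hg
    rw [MonoidHom.mem_ker, map_commutatorElement, ← Subgroup.mem_bot]
    rw [IsMetabelian, derivedSeries_two_eq] at hm
    rw [← hm]
    exact Subgroup.commutator_mem_commutator (map_mem_lcs π hf) (map_mem_lcs π hg)

/-- A `3`-group mapping onto a group of Schur shape modulo its fourth term is of that shape. -/
theorem injective_of_schurShape [Finite V] (hV : IsPGroup 3 V) {Q : Type} [Group Q] {M : CubeShape}
    (hM : M.IsSchurShape) {ρ : FreeGroup (Fin 2) →* Q} (hρ : M.IsModel ρ) {p : V →* Q}
    (hp : Function.Surjective p) {a b : V} (hab : Subgroup.closure {a, b} = ⊤)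
    (ha : a ^ 3 ∈ lcs V 1) (hb : b ^ 3 ∈ lcs V 1) : Function.Injective p := by
  have : Fact (Nat.Prime 3) := ⟨Nat.prime_three⟩
  have := hV.isNilpotent
  have h3 : lcs V 3 ≤ p.ker := (lcs_le_ker_iff p hp 3).2 hρ.lcs_three
  -- `V ⧸ lcs V 3` has at most `3⁵` elements by normal forms, and it maps onto `Q`, which has
  -- exactly that many.
  have hk : p.ker = lcs V 3 := by
    refine le_antisymm ?_ h3
    have hmk := QuotientGroup.mk'_surjective (lcs V 3)
    have hq : lcs (V ⧸ lcs V 3) 3 = ⊥ := by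
      rw [← lcs_le_ker_iff _ hmk, QuotientGroup.ker_mk']
    obtain ⟨hfin, hcard⟩ := card_quotient_le_of_surjective hq (closure_pair_map _ hmk hab)
      (by rw [← map_pow]; exact map_mem_lcs _ ha) (by rw [← map_pow]; exact map_mem_lcs _ hb)
    let p' : V ⧸ lcs V 3 →* Q := QuotientGroup.lift (lcs V 3) p h3
    have hp' : Function.Surjective p' := QuotientGroup.lift_surjective_of_surjective _ _ hp _
    have hle := Nat.card_le_card_of_surjective p' hp'
    have hi := injective_of_card p' hp' (le_antisymm (by rw [hρ.card_eq]; exact hcard) hle)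
    intro z hz
    rw [← QuotientGroup.eq_one_iff]
    apply hi
    rw [map_one]
    exact hz
  have hmk := QuotientGroup.mk'_surjective (lcs V 4)
  have h4 : lcs (V ⧸ lcs V 4) 4 = ⊥ := by
    rw [← lcs_le_ker_iff _ hmk, QuotientGroup.ker_mk']
  let p' : V ⧸ lcs V 4 →* Q := QuotientGroup.lift (lcs V 4) p
    ((lcs_antitone (by norm_num : 3 ≤ 4)).trans h3)
  have hp' : Function.Surjective p' := QuotientGroup.lift_surjective_of_surjective _ _ hp _
  have hk' : p'.ker = lcs (V ⧸ lcs V 4) 3 := by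
    rw [← map_lcs _ hmk]
    ext z
    obtain ⟨z, rfl⟩ := hmk z
    constructor
    · intro hz
      exact ⟨z, hk.le hz, rfl⟩
    · rintro ⟨w, hw, e⟩
      rw [← e]
      exact h3 hw
  -- Rigidity of `V ⧸ lcs V 4` over `Q` gives `lcs V 3 ≤ lcs V 4`, which forces `lcs V 3` to be
  -- trivial.
  have h5 := hρ.lcs_three_eq_bot_of_extension hM (eq_one_of_sq_eq_one (hV.to_quotient _)) h4 hp' hk'
  rw [← lcs_le_ker_iff _ hmk, QuotientGroup.ker_mk'] at h5
  rw [← MonoidHom.ker_eq_bot_iff, hk, lcs_eq_bot_of_le_succ h5]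

theorem exists_isModel_of_isSchurKernel [Finite V] (hV : IsPGroup 3 V)
    {π : FreeGroup (Fin 2) →* V} (hπ : Function.Surjective π) (hx : π x ^ 3 ∈ lcs V 1)
    (hy : π y ^ 3 ∈ lcs V 1) (h : IsSchurKernel π.ker) :
    ∃ M : CubeShape, M.IsSchurShape ∧ ∃ ρ : FreeGroup (Fin 2) →* V, M.IsModel ρ := by
  obtain ⟨M, hM⟩ := h.exists_le_J
  rcases (isModel_mk M).schur_or_descent with ⟨M', hM', ρ, hρ⟩ | ⟨a, b, c, e, hd⟩
  · have hk : π.ker ≤ (QuotientGroup.mk' (J M)).ker := by rwa [QuotientGroup.ker_mk']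
    let p := π.liftOfSurjective hπ ⟨_, hk⟩
    have hp : ∀ g, p (π g) = QuotientGroup.mk' (J M) g :=
      MonoidHom.liftOfRightInverse_comp_apply π _ _ ⟨_, hk⟩
    have hps : Function.Surjective p := fun z => by
      obtain ⟨g, rfl⟩ := QuotientGroup.mk'_surjective _ z
      exact ⟨π g, hp g⟩
    have hi := injective_of_schurShape hV hM' hρ hps (closure_pair_map π hπ closure_xy) hx hy
    exact ⟨M', hM', _, hρ.comp_mulEquiv (MulEquiv.ofBijective p ⟨hi, hps⟩).symm⟩
  · exact absurd hd (h.not_descent hM)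

theorem exists_isModel_of_schur (h : IsFiniteSchurSigmaGroup 3 V)
    (hab : HasAbelianizationThreeThree V) (hm : IsMetabelian V) :
    ∃ M : CubeShape, M.IsSchurShape ∧ ∃ π : FreeGroup (Fin 2) →* V, M.IsModel π := by
  have : Fact (Nat.Prime 3) := ⟨Nat.prime_three⟩
  have := h.finite
  have := h.isPGroup.isNilpotent
  obtain ⟨e⟩ := hab
  obtain ⟨σ, n, hσ, hn⟩ := exists_two_power_sigma h.sigma
  obtain ⟨a, ha, hσa⟩ := exists_inverted h.isPGroup hσ hn (e.symm (expoPair x))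
  obtain ⟨b, hb, hσb⟩ := exists_inverted h.isPGroup hσ hn (e.symm (expoPair y))
  let π := liftPair a b
  have hπ : ∀ f, Abelianization.of (π f) = e.symm (expoPair f) := by
    have : Abelianization.of.comp π = e.symm.toMonoidHom.comp expoPair := by
      ext i
      fin_cases i
      · change Abelianization.of (π x) = e.symm (expoPair x)
        rw [liftPair_x, ha]
      · change Abelianization.of (π y) = e.symm (expoPair y)
        rw [liftPair_y, hb]
    exact fun f => DFunLike.congr_fun this f
  have hg : Subgroup.closure {π x, π y} = ⊤ := by
    apply closure_eq_top_of_map (f := Abelianization.of)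
    · rw [Abelianization.ker_of]
      exact Subgroup.top_lowerCentralSeries_one.ge
    · have hs : Function.Surjective (Abelianization.of.comp π) := fun z => by
        obtain ⟨f, hf⟩ := expoPair_surjective (e z)
        exact ⟨f, by rw [MonoidHom.comp_apply, hπ, hf, MulEquiv.symm_apply_apply]⟩
      exact closure_pair_map (Abelianization.of.comp π) hs closure_xy
  have h3 : ∀ f, π f ^ 3 ∈ lcs V 1 := fun f => by
    rw [mem_lcs_one_iff, ← map_pow, hπ, ← map_one e.symm]
    congr 1
    rw [expoPair_eq_one_iff, ← zpow_natCast, expo_zpow, expo_zpow]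
    have : (3 : ZMod 3) = 0 := rfl
    push_cast
    exact ⟨by linear_combination (expo 0 f : ZMod 3) * this,
      by linear_combination (expo 1 f : ZMod 3) * this⟩
  have hR : InFrattini π.ker := by
    rw [inFrattini_iff]
    intro r hr
    rw [← expoPair_eq_one_iff]
    apply e.symm.injective
    rw [← hπ, MonoidHom.mem_ker.1 hr, map_one, map_one]
  have hs := surjective_of_closure hg
  exact exists_isModel_of_isSchurKernel h.isPGroup hs (h3 x) (h3 y)
    (isSchurKernel_ker hs (h3 x) (h3 y) hR (σ := σ) (by rw [liftPair_x, hσa])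
      (by rw [liftPair_y, hσb]) h.balanced hm)

/-- The metabelian Schur `σ`-groups with abelianization of type `(3,3)`. -/
theorem schur_iff (V : Type) [Group V] :
    (IsFiniteSchurSigmaGroup 3 V ∧ HasAbelianizationThreeThree V ∧ IsMetabelian V) ↔
      ∃ M : CubeShape, M.IsSchurShape ∧ ∃ π : FreeGroup (Fin 2) →* V, M.IsModel π := by
  constructor
  · rintro ⟨h1, h2, h3⟩
    exact exists_isModel_of_schur h1 h2 h3
  · rintro ⟨M, hM, π, h⟩
    exact ⟨h.isFiniteSchurSigmaGroup hM, h.hasAbelianizationThreeThree, h.isMetabelian⟩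

end CubeShape

end

noncomputable section

/-! ### Transfer kernels -/

namespace CubeShape

open Magnus SmallGroups TwoGenerated Hopf

/-- The determinant of two vectors in the plane over `𝔽₃`. -/
def cross (p q : ZMod 3 × ZMod 3) : ZMod 3 := p.1 * q.2 - p.2 * q.1

/-- The rotation of a vector by a right angle. -/
def rot (p : ZMod 3 × ZMod 3) : ZMod 3 × ZMod 3 := (p.2, -p.1)

/-- The value is the sum of the squares of the coordinates, which is anisotropic since `-1` is not a
square modulo three. -/
theorem cross_rot_ne_zero : ∀ {z : ZMod 3 × ZMod 3}, z ≠ 0 → cross (rot z) z ≠ 0 := by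
  unfold cross rot; decide

theorem exists_smul_of_cross_eq_zero : ∀ {p z : ZMod 3 × ZMod 3}, z ≠ 0 → cross p z = 0 →
    ∃ t : ZMod 3, p = t • z := by
  unfold cross; decide

theorem cross_smul_self (t : ZMod 3) (z : ZMod 3 × ZMod 3) : cross (t • z) z = 0 := by
  simp only [cross, Prod.smul_fst, Prod.smul_snd, smul_eq_mul]; ring

theorem cross_sub (p q z : ZMod 3 × ZMod 3) : cross (p - q) z = cross p z - cross q z := by
  simp only [cross, Prod.fst_sub, Prod.snd_sub]; ring

/-- The exponents of `u` and `v` in the cube of an element with exponent vector `p`. -/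
def cubeVec (M : CubeShape) (p : ZMod 3 × ZMod 3) : ZMod 3 × ZMod 3 :=
  (p.1 * M.α + p.2 * M.γ + p.1 ^ 2 * p.2, p.1 * M.β + p.2 * M.δ - p.1 * p.2 ^ 2)

/-- The exponent vector of an element of the free group. -/
def expoVec (f : FreeGroup (Fin 2)) : ZMod 3 × ZMod 3 := (expo 0 f, expo 1 f)

theorem expoVec_mul (f g : FreeGroup (Fin 2)) : expoVec (f * g) = expoVec f + expoVec g := by
  simp [expoVec, expo_mul]

theorem expoVec_zpow (f : FreeGroup (Fin 2)) (n : ℤ) :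
    expoVec (f ^ n) = (n : ZMod 3) • expoVec f := by
  simp [expoVec, expo_zpow]

/-- An element of the free group with given exponent vector. -/
def lift (p : ZMod 3 × ZMod 3) : FreeGroup (Fin 2) := x ^ (p.1.val : ℤ) * y ^ (p.2.val : ℤ)

theorem expoVec_lift (p : ZMod 3 × ZMod 3) : expoVec (lift p) = p := by
  simp [expoVec, lift, expo_mul, expo_zpow, expo_of]

theorem expoVec_eq_zero_iff {f : FreeGroup (Fin 2)} : expoVec f = 0 ↔ expoPair f = 1 := by
  rw [expoPair_eq_one_iff, expoVec, Prod.ext_iff]; rfl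

theorem expoVec_of_mem_lcs {f : FreeGroup (Fin 2)} (hf : f ∈ lcs (FreeGroup (Fin 2)) 1) :
    expoVec f = 0 := by
  simp [expoVec, expo_lcs _ hf]

/-- The linear form with kernel spanned by `z`, on the free group. -/
def lineForm (z : ZMod 3 × ZMod 3) : FreeGroup (Fin 2) →* Multiplicative (ZMod 3) :=
  MonoidHom.mk' (fun f => Multiplicative.ofAdd (cross (expoVec f) z)) fun f g => by
    rw [expoVec_mul, ← ofAdd_add]
    simp only [cross, Prod.fst_add, Prod.snd_add]
    congr 1; ring

/-- The subgroup of elements with exponent vector a multiple of `z`. -/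
def line (z : ZMod 3 × ZMod 3) : Subgroup (FreeGroup (Fin 2)) := (lineForm z).ker

theorem mem_line {z : ZMod 3 × ZMod 3} {f : FreeGroup (Fin 2)} :
    f ∈ line z ↔ cross (expoVec f) z = 0 := Iff.rfl

theorem lineForm_surjective {z : ZMod 3 × ZMod 3} (hz : z ≠ 0) :
    Function.Surjective (lineForm z) := by
  have key : ∀ z : ZMod 3 × ZMod 3, z ≠ 0 → ∀ t : ZMod 3, ∃ p, cross p z = t := by
    unfold cross; decide
  intro t
  obtain ⟨p, hp⟩ := key z hz t.toAdd
  exact ⟨lift p, by change cross (expoVec (lift p)) z = t.toAdd; rw [expoVec_lift, hp]⟩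

theorem index_line {z : ZMod 3 × ZMod 3} (hz : z ≠ 0) : (line z).index = 3 := by
  rw [line, Subgroup.index_ker, MonoidHom.range_eq_top.2 (lineForm_surjective hz),
    Subgroup.card_top]
  simp

variable {M : CubeShape} {V : Type} [Group V] {π : FreeGroup (Fin 2) →* V} {z : ZMod 3 × ZMod 3}

namespace IsModel

theorem expoVec_eq_zero_iff_mem (h : M.IsModel π) {f : FreeGroup (Fin 2)} :
    expoVec f = 0 ↔ π f ∈ lcs V 1 := by
  have h12 := lcs_antitone (G := V) one_le_two
  have hR : InFrattini π.ker := by rw [h.ker_eq]; exact inFrattini_J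
  rw [expoVec_eq_zero_iff,
    map_mem_lcs_one_iff hR h.surjective (h12 h.x_cube_mem) (h12 h.y_cube_mem)]

theorem ker_le_line (h : M.IsModel π) (z : ZMod 3 × ZMod 3) : π.ker ≤ line z := by
  intro f hf
  rw [MonoidHom.mem_ker] at hf
  have : expoVec f = 0 := h.expoVec_eq_zero_iff_mem.2 (by rw [hf]; exact one_mem _)
  rw [mem_line, this]; simp [cross]

theorem mem_map_line (h : M.IsModel π) {f : FreeGroup (Fin 2)} :
    π f ∈ (line z).map π ↔ cross (expoVec f) z = 0 := by
  rw [← mem_line, ← Subgroup.mem_comap, Subgroup.comap_map_eq_self (h.ker_le_line z)]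

theorem index_map_line (h : M.IsModel π) (hz : z ≠ 0) : ((line z).map π).index = 3 := by
  rw [Subgroup.index_map_eq _ h.surjective (h.ker_le_line z), index_line hz]

theorem lead_bracket_lift (z : ZMod 3 × ZMod 3) :
    Lead 3 (magnus ⁅s, lift z⁆) (z.1 • U + z.2 • W) := by
  have hs : Lead 2 (magnus s) ((1 : ZMod 3) • S) := by rw [one_smul]; exact lead_s
  have := lead_bracket_three hs (lead_one_of_zpow z.1 z.2)
  rwa [one_mul, one_mul] at this

theorem eq_iff_of_lead (h : M.IsModel π) {f g : FreeGroup (Fin 2)} {p q : ZMod 3 × ZMod 3}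
    (hf : Lead 3 (magnus f) (p.1 • U + p.2 • W)) (hg : Lead 3 (magnus g) (q.1 • U + q.2 • W)) :
    π f = π g ↔ p = q := by
  have h1 := hf.mul three_ne_zero (hg.inv three_ne_zero)
  rw [← map_inv, ← map_mul] at h1
  have h2 : Lead 3 (magnus (f * g⁻¹))
      ((0 : ZMod 3) • P X + (0 : ZMod 3) • P Y + (p.1 - q.1) • U + (p.2 - q.2) • W) := by
    convert h1 using 1
    module
  rw [← mul_inv_eq_one, ← map_inv, ← map_mul, h.eq_one_iff, mem_J_iff h2, Prod.ext_iff]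
  simp [sub_eq_zero]

theorem exists_of_mem_map_line (h : M.IsModel π) (hz : z ≠ 0) {w : V} (hw : w ∈ (line z).map π) :
    ∃ (n k : ℤ), ∃ c ∈ Subgroup.center V, w = π (lift z) ^ n * (π s ^ k * c) := by
  obtain ⟨f, hf, rfl⟩ := hw
  obtain ⟨t, ht⟩ := exists_smul_of_cross_eq_zero hz (mem_line.1 hf)
  have h1 : π ((lift z) ^ (-(t.val : ℤ)) * f) ∈ lcs V 1 := by
    rw [← h.expoVec_eq_zero_iff_mem, expoVec_mul, expoVec_zpow, expoVec_lift, ht]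
    simp
  obtain ⟨k, c, hc, e⟩ := exists_form_lcs_one h.closure_eq h1
  refine ⟨t.val, k, c, lcs_le_center h.lcs_three hc, ?_⟩
  rw [map_commutatorElement, ← e, map_mul, map_zpow, zpow_neg, mul_inv_cancel_left]

/-- Up to central elements the subgroup is generated by `lift z` and `s`, and their commutator is
central. -/
theorem commutator_map_line (h : M.IsModel π) (hz : z ≠ 0) :
    ⁅(line z).map π, (line z).map π⁆ = Subgroup.zpowers (π ⁅s, lift z⁆) := by
  apply le_antisymm
  · have hc : Subgroup.zpowers (π ⁅s, lift z⁆) ≤ Subgroup.center V := by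
      rw [Subgroup.zpowers_le]
      exact lcs_le_center h.lcs_three
        (map_mem_lcs π (commutator_mem_lcs_succ (commutator_mem_lcs_one x y) _))
    have := normal_of_le_center hc
    rw [Subgroup.commutator_le]
    intro a ha b hb
    obtain ⟨n, k, c, hc, rfl⟩ := h.exists_of_mem_map_line hz ha
    obtain ⟨m, l, d, hd, rfl⟩ := h.exists_of_mem_map_line hz hb
    let q := QuotientGroup.mk' (Subgroup.zpowers (π ⁅s, lift z⁆))
    have hs : Commute (q (π s)) (q (π (lift z))) := by
      rw [← commutatorElement_eq_one_iff_commute, ← map_commutatorElement,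
        ← map_commutatorElement]
      exact (QuotientGroup.eq_one_iff _).2 (Subgroup.mem_zpowers _)
    have hcen : ∀ c ∈ Subgroup.center V, ∀ w, Commute (q c) (q w) := fun c hc w => by
      have := Subgroup.mem_center_iff.1 hc w
      rw [Commute, SemiconjBy, ← map_mul, ← map_mul, this]
    have hab : Commute (q (π (lift z) ^ n * (π s ^ k * c))) (q (π (lift z) ^ m * (π s ^ l * d))) := by
      have h1 : Commute (q (π (lift z) ^ n * π s ^ k)) (q (π (lift z) ^ m * π s ^ l)) := by
        simp only [map_mul, map_zpow]
        exact (((Commute.refl _).zpow_zpow _ _).mul_right (hs.symm.zpow_zpow _ _)).mul_left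
          ((hs.zpow_zpow _ _).mul_right ((Commute.refl _).zpow_zpow _ _))
      rw [← mul_assoc, ← mul_assoc, map_mul q _ c, map_mul q _ d]
      refine (h1.mul_right (hcen d hd _).symm).mul_left ((hcen c hc _).mul_right (hcen c hc _))
    rw [← commutatorElement_eq_one_iff_commute, ← map_commutatorElement] at hab
    exact (QuotientGroup.eq_one_iff _).1 hab
  · rw [Subgroup.zpowers_le, map_commutatorElement]
    refine Subgroup.commutator_mem_commutator (h.mem_map_line.2 ?_) (h.mem_map_line.2 ?_)
    · rw [expoVec_of_mem_lcs (commutator_mem_lcs_one x y)]; simp [cross]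
    · rw [expoVec_lift, cross]; ring

theorem mem_commutator_map_line (h : M.IsModel π) (hz : z ≠ 0) {f : FreeGroup (Fin 2)}
    {p : ZMod 3 × ZMod 3} (hf : Lead 3 (magnus f) (p.1 • U + p.2 • W)) :
    π f ∈ ⁅(line z).map π, (line z).map π⁆ ↔ cross p z = 0 := by
  have hp : ∀ t : ℤ, π ⁅s, lift z⁆ ^ t = π f ↔ (t : ZMod 3) • z = p := fun t => by
    rw [← map_zpow]
    refine h.eq_iff_of_lead ?_ hf
    rw [map_zpow]
    convert (lead_bracket_lift z).zpow' three_ne_zero t using 1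
    simp only [Prod.smul_fst, Prod.smul_snd, smul_eq_mul]
    module
  rw [h.commutator_map_line hz, Subgroup.mem_zpowers_iff]
  simp only [hp]
  constructor
  · rintro ⟨t, rfl⟩
    exact cross_smul_self _ _
  · intro hc
    obtain ⟨t, rfl⟩ := exists_smul_of_cross_eq_zero hz hc
    exact ⟨t.val, by simp⟩

theorem exists_cube (h : M.IsModel π) (f : FreeGroup (Fin 2)) : ∃ c, π c = π f ^ 3 ∧
    Lead 3 (magnus c) ((cubeVec M (expoVec f)).1 • U + (cubeVec M (expoVec f)).2 • W) := by
  set p := cubeVec M (expoVec f) with hp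
  refine ⟨u ^ p.1.val * v ^ p.2.val, ?_, ?_⟩
  · have hx : Lead 1 (magnus x) ((1 : ZMod 3) • X + (0 : ZMod 3) • Y) := by simpa using lead_x
    have hy : Lead 1 (magnus y) ((0 : ZMod 3) • X + (1 : ZMod 3) • Y) := by simpa using lead_y
    have := (cube_mem_J_iff (M := M) (a := p.1) (b := p.2) hx hy (lead_one f)).2
      ⟨by simp [hp, cubeVec, expoVec], by simp [hp, cubeVec, expoVec]⟩
    rw [← h.eq_one_iff, map_mul, map_inv, mul_inv_eq_one] at this
    rw [← map_pow, this]
  · have := (lead_u.zpow' three_ne_zero (p.1.val : ℤ)).mul three_ne_zero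
      (lead_v.zpow' three_ne_zero (p.2.val : ℤ))
    have hv : ∀ a : ZMod 3, (((a.val : ℕ) : ℤ) : ZMod 3) = a := by simp
    rwa [← map_zpow, ← map_zpow, ← map_mul, hv, hv, zpow_natCast, zpow_natCast] at this

theorem cube_mem_center (h : M.IsModel π) (w : V) : w ^ 3 ∈ Subgroup.center V := by
  obtain ⟨f, rfl⟩ := h.surjective w
  have h3 : Lead 3 (magnus (f ^ 3)) (P ((expo 0 f : ZMod 3) • X + (expo 1 f : ZMod 3) • Y)) := by
    rw [map_pow]; exact (lead_one f).cube_one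
  rw [Subgroup.mem_center_iff]
  intro w
  obtain ⟨g, rfl⟩ := h.surjective w
  rw [← commutatorElement_eq_one_iff_mul_comm, ← map_pow, ← map_commutatorElement, h.eq_one_iff]
  exact mem_J_of_lead (n := 4) (by norm_num) (lead_comm 4 one_ne_zero three_ne_zero rfl (lead_one g) h3)

theorem of_eq_one_iff {H : Subgroup V} {w : V} (hw : w ∈ H) :
    Abelianization.of (⟨w, hw⟩ : H) = 1 ↔ w ∈ ⁅H, H⁆ := by
  rw [← MonoidHom.mem_ker, Abelianization.ker_of, ← Subgroup.map_subtype_commutator]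
  constructor
  · intro h
    exact ⟨_, h, rfl⟩
  · rintro ⟨w', h, rfl⟩
    exact h

/-- A power of `π f` with a conjugate in the subgroup has exponent divisible by three, and cubes are
central. So the transfer is the power with exponent the index. -/
theorem transfer_of_cross_ne_zero (h : M.IsModel π) (hz : z ≠ 0) [((line z).map π).FiniteIndex]
    {f c : FreeGroup (Fin 2)} (hf : cross (expoVec f) z ≠ 0) (hc : π c = π f ^ 3) :
    ∃ hm : π c ∈ (line z).map π,
    MonoidHom.transfer (Abelianization.of : (line z).map π →* _) (π f) =
      Abelianization.of ⟨π c, hm⟩ := by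
  have hcm : π f ^ 3 ∈ (line z).map π := by
    have hfc : expoVec (f ^ (3 : ℤ)) = 0 := by
      rw [expoVec_zpow]
      have : ((3 : ℤ) : ZMod 3) = 0 := rfl
      rw [this, zero_smul]
    rw [← map_pow, h.mem_map_line]
    have e : f ^ 3 = f ^ (3 : ℤ) := by norm_cast
    rw [e, hfc]; simp [cross]
  have key : ∀ (k : ℕ) (w : V), w⁻¹ * π f ^ k * w ∈ (line z).map π →
      w⁻¹ * π f ^ k * w = π f ^ k := by
    intro k w hk
    obtain ⟨g, rfl⟩ := h.surjective w
    rw [← map_pow, ← map_inv, ← map_mul, ← map_mul, h.mem_map_line, ← zpow_natCast, expoVec_mul,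
      expoVec_mul, expoVec_zpow, ← zpow_neg_one, expoVec_zpow] at hk
    have hk' : ((k : ℤ) : ZMod 3) * cross (expoVec f) z = 0 := by
      rw [← hk]
      simp only [cross, Prod.fst_add, Prod.snd_add, Prod.smul_fst, Prod.smul_snd, smul_eq_mul]
      push_cast
      ring
    have : Fact (Nat.Prime 3) := ⟨Nat.prime_three⟩
    have h0 := (mul_eq_zero.1 hk').resolve_right hf
    obtain ⟨m, rfl⟩ : 3 ∣ k := (ZMod.natCast_eq_zero_iff k 3).1 (by exact_mod_cast h0)
    have hcen := Subgroup.mem_center_iff.1 (pow_mem (h.cube_mem_center (π f)) m) (π g)⁻¹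
    rw [pow_mul, hcen, inv_mul_cancel_right]
  refine ⟨hc ▸ hcm, ?_⟩
  rw [MonoidHom.transfer_eq_pow _ _ key]
  congr 1
  apply Subtype.ext
  change π f ^ _ = π c
  rw [h.index_map_line hz, hc]

/-- Elements inside the subgroup are written as `(f r) r⁻¹` with `r = lift (rot z)` outside it; both
transfers are then cubes. -/
theorem transfer_eq_one_iff (h : M.IsModel π) (hz : z ≠ 0) [((line z).map π).FiniteIndex]
    (f : FreeGroup (Fin 2)) :
    MonoidHom.transfer (Abelianization.of : (line z).map π →* _) (π f) = 1 ↔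
      if cross (expoVec f) z = 0 then
        cross (cubeVec M (expoVec f + rot z)) z = cross (cubeVec M (rot z)) z
      else cross (cubeVec M (expoVec f)) z = 0 := by
  split_ifs with hf
  · have hg : cross (expoVec (lift (rot z))) z ≠ 0 := by
      rw [expoVec_lift]; exact cross_rot_ne_zero hz
    have hfg : cross (expoVec (f * lift (rot z))) z ≠ 0 := by
      have : cross (expoVec (f * lift (rot z))) z =
          cross (expoVec f) z + cross (expoVec (lift (rot z))) z := by
        rw [expoVec_mul]; simp only [cross, Prod.fst_add, Prod.snd_add]; ring
      rwa [this, hf, zero_add]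
    obtain ⟨c, hc, hcl⟩ := h.exists_cube (f * lift (rot z))
    obtain ⟨d, hd, hdl⟩ := h.exists_cube (lift (rot z))
    obtain ⟨hcm, e1⟩ := h.transfer_of_cross_ne_zero hz hfg hc
    obtain ⟨hdm, e2⟩ := h.transfer_of_cross_ne_zero hz hg hd
    have e3 : f = f * lift (rot z) * (lift (rot z))⁻¹ := by group
    have hcd : π (c * d⁻¹) ∈ (line z).map π := by
      rw [map_mul, map_inv]; exact mul_mem hcm (inv_mem hdm)
    have e4 : MonoidHom.transfer (Abelianization.of : (line z).map π →* _) (π f) =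
        Abelianization.of ⟨π (c * d⁻¹), hcd⟩ := by
      rw [e3, map_mul π, map_inv π, map_mul, map_inv, e1, e2, ← map_inv, ← map_mul]
      congr 1
      apply Subtype.ext
      simp
    have hl := hcl.mul three_ne_zero (hdl.inv three_ne_zero)
    rw [← map_inv, ← map_mul] at hl
    rw [expoVec_mul, expoVec_lift] at *
    set p := cubeVec M (expoVec f + rot z)
    set q := cubeVec M (rot z)
    have hl' : Lead 3 (magnus (c * d⁻¹)) ((p - q).1 • U + (p - q).2 • W) := by
      convert hl using 1
      simp only [Prod.fst_sub, Prod.snd_sub]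
      module
    rw [e4, of_eq_one_iff, h.mem_commutator_map_line hz hl', cross_sub, sub_eq_zero]
  · obtain ⟨c, hc, hcl⟩ := h.exists_cube f
    obtain ⟨hcm, e⟩ := h.transfer_of_cross_ne_zero hz hf hc
    rw [e, of_eq_one_iff, h.mem_commutator_map_line hz hcl]

/-- `H` contains the derived subgroup but is not contained in it. Any element of `H` outside the
derived subgroup spans the line, and equality follows by comparing indices. -/
theorem exists_eq_map_line (h : M.IsModel π) {H : Subgroup V} (hH : H.index = 3) :
    ∃ z : ZMod 3 × ZMod 3, z ≠ 0 ∧ H = (line z).map π := by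
  have := h.finite
  have hn : H.Normal := Subgroup.normal_of_index_eq_minFac_card (by
    rw [hH, h.card_eq, Nat.Prime.pow_minFac Nat.prime_three (by norm_num)])
  have hle : lcs V 1 ≤ H := by
    have : Fact (Nat.Prime 3) := ⟨Nat.prime_three⟩
    have hcyc : IsCyclic (V ⧸ H) := isCyclic_of_prime_card (p := 3) hH
    have hcomm := hcyc.isMulCommutative
    refine lcs_succ_le_iff.2 fun a _ b => ?_
    rw [← QuotientGroup.eq_one_iff]
    change QuotientGroup.mk' H ⁅a, b⁆ = 1
    rw [map_commutatorElement, commutatorElement_eq_one_iff_mul_comm]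
    exact hcomm.is_comm.comm _ _
  have h9 : ¬ H ≤ lcs V 1 := by
    intro h1
    have hz0 : ((1, 0) : ZMod 3 × ZMod 3) ≠ 0 := by decide
    have hK : H ≤ (line (1, 0)).map π := fun w hw => by
      obtain ⟨f, rfl⟩ := h.surjective w
      rw [h.mem_map_line, h.expoVec_eq_zero_iff_mem.2 (h1 hw)]
      simp [cross]
    have hi := Subgroup.relIndex_mul_index hK
    rw [hH, h.index_map_line hz0] at hi
    have hx : π (lift (1, 0)) ∈ (line (1, 0)).map π := by
      rw [h.mem_map_line, expoVec_lift, cross]; ring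
    have h0 := h.expoVec_eq_zero_iff_mem.2 (h1 (Subgroup.relIndex_eq_one.1 (by omega) hx))
    rw [expoVec_lift] at h0
    exact hz0 h0
  obtain ⟨w, hwH, hw⟩ := Set.not_subset.1 h9
  obtain ⟨f, rfl⟩ := h.surjective w
  have hz : expoVec f ≠ 0 := fun h0 => hw (h.expoVec_eq_zero_iff_mem.1 h0)
  refine ⟨expoVec f, hz, ?_⟩
  have hK : (line (expoVec f)).map π ≤ H := by
    rintro _ ⟨g, hg, rfl⟩
    obtain ⟨t, ht⟩ := exists_smul_of_cross_eq_zero hz (mem_line.1 hg)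
    have h1 : π (f ^ (-(t.val : ℤ)) * g) ∈ lcs V 1 := by
      rw [← h.expoVec_eq_zero_iff_mem, expoVec_mul, expoVec_zpow, ht]
      simp
    have h2 := mul_mem (zpow_mem hwH t.val) (hle h1)
    rwa [← map_zpow, ← map_mul, zpow_neg, mul_inv_cancel_left] at h2
  have hi := Subgroup.relIndex_mul_index hK
  rw [hH, h.index_map_line hz] at hi
  exact le_antisymm (Subgroup.relIndex_eq_one.1 (by omega)) hK

end IsModel

/-- Generators of the four lines in the plane over `𝔽₃`. -/
def lineGen : Fin 4 → ZMod 3 × ZMod 3 := ![(1, -1), (1, 1), (0, 1), (1, 0)]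

theorem lineGen_ne_zero (i : Fin 4) : lineGen i ≠ 0 := by
  revert i; unfold lineGen; decide

namespace IsModel

/-- The four subgroups of index `3`. -/
def indexThree (h : M.IsModel π) (i : Fin 4) : IndexThreeSubgroup V :=
  ⟨(line (lineGen i)).map π, h.index_map_line (lineGen_ne_zero i)⟩

theorem indexThree_bijective (h : M.IsModel π) : Function.Bijective h.indexThree := by
  constructor
  · intro i j hij
    have key : ∀ i j : Fin 4, cross (lineGen i) (lineGen j) = 0 → i = j := by
      unfold cross lineGen; decide
    apply key
    have hi : π (lift (lineGen i)) ∈ (line (lineGen i)).map π := by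
      rw [h.mem_map_line, expoVec_lift, cross]; ring
    have e : (line (lineGen i)).map π = (line (lineGen j)).map π := congrArg Subtype.val hij
    rw [e, h.mem_map_line, expoVec_lift] at hi
    exact hi
  · rintro ⟨H, hH⟩
    obtain ⟨z, hz, rfl⟩ := h.exists_eq_map_line hH
    have key : ∀ z : ZMod 3 × ZMod 3, z ≠ 0 → ∃ i, ∀ p, cross p (lineGen i) = 0 ↔ cross p z = 0 := by
      unfold cross lineGen; decide
    obtain ⟨i, hi⟩ := key z hz
    refine ⟨i, Subtype.ext ?_⟩
    change (line (lineGen i)).map π = (line z).map π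
    congr 1
    ext f
    rw [mem_line, mem_line, hi]

theorem hasTransferKernelType (h : M.IsModel π) {ϰ : Fin 4 → Fin 4}
    (hϰ : ∀ i p, (if cross p (lineGen i) = 0 then
        cross (cubeVec M (p + rot (lineGen i))) (lineGen i) =
          cross (cubeVec M (rot (lineGen i))) (lineGen i)
      else cross (cubeVec M p) (lineGen i) = 0) ↔ cross p (lineGen (ϰ i)) = 0) :
    HasTransferKernelType V ϰ := by
  refine ⟨Equiv.ofBijective _ h.indexThree_bijective, fun i => ?_⟩
  change (artinTransfer (h.indexThree i).1).ker = (h.indexThree (ϰ i)).1.map Abelianization.of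
  ext A
  obtain ⟨w, rfl⟩ := QuotientGroup.mk'_surjective _ A
  obtain ⟨f, rfl⟩ := h.surjective w
  have : ((line (lineGen i)).map π).FiniteIndex := IndexThreeSubgroup.finiteIndex (h.indexThree i)
  have h1 := h.transfer_eq_one_iff (lineGen_ne_zero i) f
  rw [hϰ, ← h.mem_map_line] at h1
  refine h1.trans ⟨fun hm => ⟨_, hm, rfl⟩, ?_⟩
  rintro ⟨w, hw, e⟩
  have hk : w⁻¹ * π f ∈ lcs V 1 := by
    rw [mem_lcs_one_iff, map_mul, map_inv, e]
    exact inv_mul_cancel _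
  obtain ⟨g, rfl⟩ := h.surjective w
  have h0 : π (g⁻¹ * f) ∈ (line (lineGen (ϰ i))).map π := by
    rw [h.mem_map_line, h.expoVec_eq_zero_iff_mem.2 (by rwa [map_mul, map_inv])]
    simp [cross]
  have := mul_mem (show π g ∈ (line (lineGen (ϰ i))).map π from hw) h0
  rwa [← map_mul, mul_inv_cancel_left] at this

end IsModel

/-- The lines in `lineGen` are ordered so that the stated type appears without renumbering, here and
for `⟨243,7⟩`. -/
theorem hasTransferKernelType_G243_5 : HasTransferKernelType G243_5 typeD10 := by
  apply isModel_G243_5.hasTransferKernelType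
  unfold cross cubeVec rot lineGen shape5 typeD10
  decide

theorem hasTransferKernelType_G243_7 : HasTransferKernelType G243_7 typeD5 := by
  apply isModel_G243_7.hasTransferKernelType
  unfold cross cubeVec rot lineGen shape7 typeD5
  decide

end CubeShape

end

theorem mainTheorem9 :
    -- the metabelian Schur σ-groups with abelianization (3,3) are precisely two
    (∀ (V : Type) [Group V],
      (IsFiniteSchurSigmaGroup 3 V ∧ HasAbelianizationThreeThree V ∧ IsMetabelian V) ↔
        (Nonempty (V ≃* SmallGroups.G243_5) ∨ Nonempty (V ≃* SmallGroups.G243_7))) ∧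
    IsEmpty (SmallGroups.G243_5 ≃* SmallGroups.G243_7) ∧
    -- order, class and coclass
    (Nat.card SmallGroups.G243_5 = 3 ^ 5 ∧ Group.nilpotencyClass SmallGroups.G243_5 = 3 ∧
      HasCoclass 3 SmallGroups.G243_5 2) ∧
    (Nat.card SmallGroups.G243_7 = 3 ^ 5 ∧ Group.nilpotencyClass SmallGroups.G243_7 = 3 ∧
      HasCoclass 3 SmallGroups.G243_7 2) ∧
    -- transfer kernel types
    HasTransferKernelType SmallGroups.G243_5 typeD10 ∧
    HasTransferKernelType SmallGroups.G243_7 typeD5 ∧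
    -- the terminal immediate descendants of ⟨27,3⟩ with step size 2
    (∀ (V : Type) [Group V],
      (Finite V ∧ IsPGroup 3 V ∧ IsImmediateDescendantOfStep 3 2 V SmallGroups.G27_3 ∧
          IsTerminal 3 V) ↔
        (Nonempty (V ≃* SmallGroups.G243_5) ∨ Nonempty (V ≃* SmallGroups.G243_7))) ∧
    -- isolated vertices of the coclass forest
    IsIsolatedInCoclassForest 3 2 SmallGroups.G243_5 ∧
    IsIsolatedInCoclassForest 3 2 SmallGroups.G243_7 := by
  open CubeShape in
  exact ⟨fun V _ => (schur_iff V).trans (exists_isModel_iff V), isEmpty_mulEquiv,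
    ⟨isModel_G243_5.card_eq, isModel_G243_5.nilpotencyClass_eq, isModel_G243_5.hasCoclass⟩,
    ⟨isModel_G243_7.card_eq, isModel_G243_7.nilpotencyClass_eq, isModel_G243_7.hasCoclass⟩,
    hasTransferKernelType_G243_5, hasTransferKernelType_G243_7,
    fun V _ => (terminal_descendant_iff V).trans (exists_isModel_iff V),
    isModel_G243_5.isIsolated (Or.inl rfl), isModel_G243_7.isIsolated (Or.inr rfl)⟩
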